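/- Fix an integer $d\ge 1$ and let $\mathbb{Z}_d=\{0,1,\dots,d-1\}$. The Lee distance between two letters $a,b\in\mathbb{Z}_d$ is $d_L(a,b)=\min(|a-b|,\,d-|a-b|)$, and the Lee distance between two words $u,v$ of the same length $m$ over $\mathbb{Z}_d$ is $d_L(u,v)=\sum_{i=0}^{m-1}d_L(u[i],v[i])$. For an integer $k\ge 0$, a word $w$ over $\mathbb{Z}_d$ has a $k$-Lee-error border if it has a suffix $s$ and a prefix $p$ of the same length with $d_L(s,p)=k$; the border is called proper if this length is greater than $0$ and less than the length of $w$ (for $k\ge 1$ every $k$-Lee-error border is proper). Then there is an algorithm on a word random access machine (unit cost per operation, words of $O(\log(n+k))$ bits) which, given $k$ and a word $w$ of length $n$ over $\mathbb{Z}_d$, decides in time $O(kn)$ and space $O(n)$ (counted in machine words) whether $w$ has a $k$-Lee-error border; likewise there is such an algorithm, with the same bounds, which decides whether $w$ has a proper $k$-Lee-error border. The algorithms and the implied constants may depend on $d$, but not on $k$, $n$ or $w$; in the degenerate cases $k=0$ or $n=0$ the bounds are to be read as $O((k+1)(n+1))$ and $O(n+1)$. -/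

import Mathlib

/-! Lee distance and Lee-error borders of words over the alphabet `{0, …, d - 1}`. -/

namespace LeeBorder

/-- Lee distance between two letters: `min (|a - b|) (d - |a - b|)`.
The subtraction in `ℕ` does not truncate, since `|a - b| < d`. -/
def letterDist {d : ℕ} (a b : Fin d) : ℕ :=
  min ((a : ℤ) - (b : ℤ)).natAbs (d - ((a : ℤ) - (b : ℤ)).natAbs)

/-- Lee distance between two words of the same length: the sum of the letterwise distances. -/
def wordDist {d : ℕ} (u v : List (Fin d)) : ℕ :=
  (List.zipWith letterDist u v).sum

/-- `w` has a suffix and a prefix of the same length at Lee distance exactly `k`. -/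
def HasBorder {d : ℕ} (k : ℕ) (w : List (Fin d)) : Prop :=
  ∃ s p : List (Fin d), s <:+ w ∧ p <+: w ∧ s.length = p.length ∧ wordDist s p = k

/-- The same, where the suffix and the prefix are nonempty and different from the whole word.
This differs from `HasBorder` only for `k = 0`, where `HasBorder` always holds. -/
def HasProperBorder {d : ℕ} (k : ℕ) (w : List (Fin d)) : Prop :=
  ∃ s p : List (Fin d), s <:+ w ∧ p <+: w ∧ s.length = p.length ∧
    0 < s.length ∧ s.length < w.length ∧ wordDist s p = k

end LeeBorder

/-! A word random access machine: registers and arrays of words, with indirect addressing,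
unit cost per operation, and structured control flow. -/

namespace WordRAM

/-- A memory state: the registers `reg 0, reg 1, …` and the arrays `mem 0, mem 1, …`.
A program names its registers and arrays statically, so that it uses only finitely many. -/
structure State where
  reg : ℕ → ℕ
  mem : ℕ → ℕ → ℕ

/-- The arithmetic operations and comparisons of the machine. -/
inductive Op
  | add | sub | mul | div | mod | lt | eq

/-- Subtraction is truncated, `a / 0 = 0`, `a % 0 = a`; comparisons return `1` or `0`. -/
def Op.eval : Op → ℕ → ℕ → ℕ
  | .add, a, b => a + b
  | .sub, a, b => a - b
  | .mul, a, b => a * b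
  | .div, a, b => a / b
  | .mod, a, b => a % b
  | .lt, a, b => if a < b then 1 else 0
  | .eq, a, b => if a = b then 1 else 0

/-- Expressions: constants, registers, array cells (`load A e` is the cell of the array `A`
whose index is the value of `e`), and operations. -/
inductive Expr
  | const (c : ℕ)
  | reg (x : ℕ)
  | load (A : ℕ) (e : Expr)
  | op (o : Op) (e₁ e₂ : Expr)

/-- The value of an expression. -/
def Expr.eval (σ : State) : Expr → ℕ
  | .const c => c
  | .reg x => σ.reg x
  | .load A e => σ.mem A (e.eval σ)
  | .op o e₁ e₂ => o.eval (e₁.eval σ) (e₂.eval σ)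

/-- The evaluation of the expression is free of faults on a machine whose words hold the numbers
below `W` and whose arrays have `S` cells each: all intermediate values are below `W`, and all
cells that are read have an index below `S`. -/
def Expr.Ok (W S : ℕ) (σ : State) : Expr → Prop
  | .const c => c < W
  | .reg x => σ.reg x < W
  | .load A e => e.Ok W S σ ∧ e.eval σ < S ∧ σ.mem A (e.eval σ) < W
  | .op o e₁ e₂ => e₁.Ok W S σ ∧ e₂.Ok W S σ ∧ o.eval (e₁.eval σ) (e₂.eval σ) < W

/-- The time to evaluate an expression: one unit for each constant, register access, memory
access and operation. -/
def Expr.cost : Expr → ℕ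
  | .const _ => 1
  | .reg _ => 1
  | .load _ e => e.cost + 1
  | .op _ e₁ e₂ => e₁.cost + e₂.cost + 1

/-- Programs. `store A i e` writes the value of `e` to the cell of the array `A` whose index is
the value of `i`. A condition counts as true when its value is not `0`. -/
inductive Prog
  | nop
  | assign (x : ℕ) (e : Expr)
  | store (A : ℕ) (i e : Expr)
  | seq (p q : Prog)
  | cond (e : Expr) (p q : Prog)
  | loop (e : Expr) (p : Prog)

/-- `Exec W S p σ t τ`: on the machine whose words hold the numbers below `W` and whose arrays
have `S` cells each, the program `p`, started in the state `σ`, halts without a fault after time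
`t` in the state `τ`. A program that produces a number `≥ W`, or that accesses a cell of index
`≥ S`, or that runs forever, has no execution. A program that names `m` arrays and `r` registers
thus uses at most `m * S + r` words of memory. -/
inductive Exec (W S : ℕ) : Prog → State → ℕ → State → Prop
  | nop (σ : State) : Exec W S .nop σ 1 σ
  | assign (σ : State) (x : ℕ) (e : Expr) (he : e.Ok W S σ) :
      Exec W S (.assign x e) σ (e.cost + 1)
        ⟨Function.update σ.reg x (e.eval σ), σ.mem⟩
  | store (σ : State) (A : ℕ) (i e : Expr) (hi : i.Ok W S σ) (he : e.Ok W S σ)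
      (hS : i.eval σ < S) :
      Exec W S (.store A i e) σ (i.cost + e.cost + 1)
        ⟨σ.reg, Function.update σ.mem A (Function.update (σ.mem A) (i.eval σ) (e.eval σ))⟩
  | seq {p q : Prog} {σ₁ σ₂ σ₃ : State} {t₁ t₂ : ℕ}
      (hp : Exec W S p σ₁ t₁ σ₂) (hq : Exec W S q σ₂ t₂ σ₃) :
      Exec W S (.seq p q) σ₁ (t₁ + t₂) σ₃
  | cond_true {e : Expr} {p : Prog} (q : Prog) {σ τ : State} {t : ℕ}
      (he : e.Ok W S σ) (h : e.eval σ ≠ 0) (hp : Exec W S p σ t τ) :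
      Exec W S (.cond e p q) σ (e.cost + 1 + t) τ
  | cond_false {e : Expr} (p : Prog) {q : Prog} {σ τ : State} {t : ℕ}
      (he : e.Ok W S σ) (h : e.eval σ = 0) (hq : Exec W S q σ t τ) :
      Exec W S (.cond e p q) σ (e.cost + 1 + t) τ
  | loop_true {e : Expr} {p : Prog} {σ₁ σ₂ σ₃ : State} {t₁ t₂ : ℕ}
      (he : e.Ok W S σ₁) (h : e.eval σ₁ ≠ 0) (hp : Exec W S p σ₁ t₁ σ₂)
      (hl : Exec W S (.loop e p) σ₂ t₂ σ₃) :
      Exec W S (.loop e p) σ₁ (e.cost + 1 + t₁ + t₂) σ₃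
  | loop_false {e : Expr} (p : Prog) {σ : State} (he : e.Ok W S σ) (h : e.eval σ = 0) :
      Exec W S (.loop e p) σ (e.cost + 1) σ

/-- The initial state on the input `(k, w)`: register `0` holds the length of `w`, register `1`
holds `k`, the array `0` holds the letters of `w`, and everything else is `0`. -/
def input {d : ℕ} (k : ℕ) (w : List (Fin d)) : State where
  reg x := if x = 0 then w.length else if x = 1 then k else 0
  mem A i := if A = 0 then ((w[i]?).map Fin.val).getD 0 else 0

/-- The property `P k w` of a number `k` and a word `w` over the fixed alphabet `{0, …, d - 1}`
can be decided in time `O(T n k)` and space `O(S n k)`, where `n` is the length of `w`: one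
program does it for all `k` and `w`, on words of `O(log (n + k))` bits. The answer (`1` for yes,
`0` for no) is left in register `0`. -/
def DecidableInTimeSpace {d : ℕ} (P : ℕ → List (Fin d) → Prop) (T S : ℕ → ℕ → ℕ) : Prop :=
  ∃ (p : Prog) (C : ℕ), ∀ (k : ℕ) (w : List (Fin d)), ∃ (t : ℕ) (τ : State),
    Exec (2 ^ (C * Nat.clog 2 (w.length + k + 2))) (C * S w.length k) p (input k w) t τ ∧
    t ≤ C * T w.length k ∧
    (P k w → τ.reg 0 = 1) ∧ (¬ P k w → τ.reg 0 = 0)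

end WordRAM

/-! A proper border of length `n - i` compares each letter with the one `i` positions later, so the
question is whether some shift `i` with `1 ≤ i < n` has `shiftDist` equal to `k`. Distinct letters
have Lee distance at least `1` and the partial sums are monotone, so a shift can be rejected as soon
as its sum exceeds `k`, after at most `k + 1` mismatches. The equal letters between two mismatches
contribute nothing (`shiftDist_add`) and are skipped by one longest common extension query. With
constant-time queries a shift costs `O(k + 1)` (`checkShift_runs`), and all shifts together `O((k +
1)(n + 1))`.

The queries need linear preprocessing, in four layers. (1) The suffix array is built by the skew
method: the suffixes at positions not divisible by three are sorted through a text of names of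
letter triples (`IsReduction.sfx_lt`), the others by their first letter and the rank of the rest,
and the two lists are merged. The recursion becomes a loop down a stack of texts and a loop back up;
lengths shrink by a factor `3/4` (`four_mul_sampleLen_le`), so the total is linear. (2) Common
extensions of neighbours in the suffix array are computed in text order, where they drop by at most
one per step (`lcp_le_succ`). (3) The extension of any two suffixes is a range minimum of these
values (`isRangeMin_lce`). (4) Range minima use blocks of logarithmic size `B`: a sparse table over
the roughly `n / B` blocks has `O(n)` entries, and inside a block the monotone stack of each
position is kept as a bit mask (`IsMinMask.isRangeMin`). Logarithms, powers of two and lowest bits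
are tabulated, since the machine has no bit operations.

Programs are verified with the triples `Runs`, which bound the running time together with the
postcondition. Loop-free pieces reduce to verification conditions; amortised loops are charged
against potentials. All numbers that occur are bounded linearly in `n`, `k` and `d`, so words of
`O(log (n + k))` bits suffice. -/

namespace WordRAM

/-! ### Notation for programs -/

instance : Add Expr := ⟨.op .add⟩
instance : Sub Expr := ⟨.op .sub⟩
instance : Mul Expr := ⟨.op .mul⟩
instance : Div Expr := ⟨.op .div⟩
instance : Mod Expr := ⟨.op .mod⟩
instance (c : ℕ) : OfNat Expr c := ⟨.const c⟩

/-- The comparison `a < b`. -/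
def Expr.lt (a b : Expr) : Expr := .op .lt a b

/-- The comparison `a = b`. -/
def Expr.eq (a b : Expr) : Expr := .op .eq a b

infix:52 " ≔ " => Prog.assign
infixr:50 " ;; " => Prog.seq

/-- `for x in [0, e) do p`. -/
def Prog.forTo (x : ℕ) (e : Expr) (p : Prog) : Prog :=
  x ≔ 0 ;; .loop (.lt (.reg x) e) (p ;; x ≔ .reg x + 1)

/-- The state after the assignment of `v` to the register `x`. -/
def State.setReg (σ : State) (x v : ℕ) : State := ⟨Function.update σ.reg x v, σ.mem⟩

/-- The state after the assignment of `v` to the cell `i` of the array `A`. -/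
def State.setMem (σ : State) (A i v : ℕ) : State :=
  ⟨σ.reg, Function.update σ.mem A (Function.update (σ.mem A) i v)⟩

@[simp] lemma State.setReg_reg (σ : State) (x v y : ℕ) :
    (σ.setReg x v).reg y = if y = x then v else σ.reg y := by
  simp [State.setReg, Function.update_apply]

@[simp] lemma State.setReg_mem (σ : State) (x v : ℕ) : (σ.setReg x v).mem = σ.mem := rfl

@[simp] lemma State.setMem_reg (σ : State) (A i v : ℕ) : (σ.setMem A i v).reg = σ.reg := rfl

@[simp] lemma State.setMem_mem (σ : State) (A i v B : ℕ) :
    (σ.setMem A i v).mem B = if B = A then Function.update (σ.mem B) i v else σ.mem B := by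
  by_cases h : B = A
  · subst h; simp [State.setMem]
  · simp [State.setMem, h]

section
variable (σ : State) (a b e : Expr)

@[simp] lemma Expr.eval_add : (a + b).eval σ = a.eval σ + b.eval σ := rfl
@[simp] lemma Expr.eval_sub : (a - b).eval σ = a.eval σ - b.eval σ := rfl
@[simp] lemma Expr.eval_mul : (a * b).eval σ = a.eval σ * b.eval σ := rfl
@[simp] lemma Expr.eval_div : (a / b).eval σ = a.eval σ / b.eval σ := rfl
@[simp] lemma Expr.eval_mod : (a % b).eval σ = a.eval σ % b.eval σ := rfl
@[simp] lemma Expr.eval_lt :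
    (Expr.lt a b).eval σ = if a.eval σ < b.eval σ then 1 else 0 := rfl
@[simp] lemma Expr.eval_eq :
    (Expr.eq a b).eval σ = if a.eval σ = b.eval σ then 1 else 0 := rfl
@[simp] lemma Expr.eval_ofNat (c : ℕ) :
    Expr.eval σ ofNat(c) = OfNat.ofNat c := rfl
@[simp] lemma Expr.eval_zero : Expr.eval σ 0 = 0 := rfl
@[simp] lemma Expr.eval_one : Expr.eval σ 1 = 1 := rfl
@[simp] lemma Expr.eval_const (c : ℕ) : Expr.eval σ (.const c) = c := rfl
@[simp] lemma Expr.eval_reg (x : ℕ) : Expr.eval σ (.reg x) = σ.reg x := rfl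
@[simp] lemma Expr.eval_load (A : ℕ) : Expr.eval σ (.load A e) = σ.mem A (e.eval σ) := rfl

@[simp] lemma Expr.cost_add : (a + b).cost = a.cost + b.cost + 1 := rfl
@[simp] lemma Expr.cost_sub : (a - b).cost = a.cost + b.cost + 1 := rfl
@[simp] lemma Expr.cost_mul : (a * b).cost = a.cost + b.cost + 1 := rfl
@[simp] lemma Expr.cost_div : (a / b).cost = a.cost + b.cost + 1 := rfl
@[simp] lemma Expr.cost_mod : (a % b).cost = a.cost + b.cost + 1 := rfl
@[simp] lemma Expr.cost_lt : (Expr.lt a b).cost = a.cost + b.cost + 1 := rfl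
@[simp] lemma Expr.cost_eq : (Expr.eq a b).cost = a.cost + b.cost + 1 := rfl
@[simp] lemma Expr.cost_ofNat (c : ℕ) : Expr.cost ofNat(c) = 1 := rfl
@[simp] lemma Expr.cost_zero : Expr.cost 0 = 1 := rfl
@[simp] lemma Expr.cost_one : Expr.cost 1 = 1 := rfl
@[simp] lemma Expr.cost_const (c : ℕ) : Expr.cost (.const c) = 1 := rfl
@[simp] lemma Expr.cost_reg (x : ℕ) : Expr.cost (.reg x) = 1 := rfl
@[simp] lemma Expr.cost_load (A : ℕ) : Expr.cost (.load A e) = e.cost + 1 := rfl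

end

/-! ### Verification conditions -/

/-- All words of memory hold numbers below `W`, and `1 < W`. -/
structure Good (W : ℕ) (σ : State) : Prop where
  one_lt : 1 < W
  reg : ∀ x, σ.reg x < W
  mem : ∀ A i, σ.mem A i < W

/-- Conditions for the evaluation of an expression in a `Good` state to be free of faults. -/
def Expr.Safe (W S : ℕ) (σ : State) : Expr → Prop
  | .const c => c < W
  | .reg _ => True
  | .load _ e => e.Safe W S σ ∧ e.eval σ < S
  | .op .add a b => a.Safe W S σ ∧ b.Safe W S σ ∧ a.eval σ + b.eval σ < W
  | .op .mul a b => a.Safe W S σ ∧ b.Safe W S σ ∧ a.eval σ * b.eval σ < W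
  | .op _ a b => a.Safe W S σ ∧ b.Safe W S σ

section
variable (W S : ℕ) (σ : State) (a b e : Expr)

@[simp] lemma Expr.safe_add : (a + b).Safe W S σ ↔
    a.Safe W S σ ∧ b.Safe W S σ ∧ a.eval σ + b.eval σ < W := Iff.rfl
@[simp] lemma Expr.safe_sub : (a - b).Safe W S σ ↔ a.Safe W S σ ∧ b.Safe W S σ := Iff.rfl
@[simp] lemma Expr.safe_mul : (a * b).Safe W S σ ↔
    a.Safe W S σ ∧ b.Safe W S σ ∧ a.eval σ * b.eval σ < W := Iff.rfl
@[simp] lemma Expr.safe_div : (a / b).Safe W S σ ↔ a.Safe W S σ ∧ b.Safe W S σ := Iff.rfl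
@[simp] lemma Expr.safe_mod : (a % b).Safe W S σ ↔ a.Safe W S σ ∧ b.Safe W S σ := Iff.rfl
@[simp] lemma Expr.safe_lt : (Expr.lt a b).Safe W S σ ↔ a.Safe W S σ ∧ b.Safe W S σ := Iff.rfl
@[simp] lemma Expr.safe_eq : (Expr.eq a b).Safe W S σ ↔ a.Safe W S σ ∧ b.Safe W S σ := Iff.rfl
@[simp] lemma Expr.safe_ofNat (c : ℕ) :
    Expr.Safe W S σ ofNat(c) ↔ OfNat.ofNat c < W := Iff.rfl
@[simp] lemma Expr.safe_zero : Expr.Safe W S σ 0 ↔ 0 < W := Iff.rfl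
@[simp] lemma Expr.safe_one : Expr.Safe W S σ 1 ↔ 1 < W := Iff.rfl
@[simp] lemma Expr.safe_const (c : ℕ) : Expr.Safe W S σ (.const c) ↔ c < W := Iff.rfl
@[simp] lemma Expr.safe_reg (x : ℕ) : Expr.Safe W S σ (.reg x) := trivial
@[simp] lemma Expr.safe_load (A : ℕ) : Expr.Safe W S σ (.load A e) ↔
    e.Safe W S σ ∧ e.eval σ < S := Iff.rfl

end

variable {W S : ℕ}

lemma Expr.Ok.lt_bound {σ : State} {e : Expr} (he : e.Ok W S σ) : e.eval σ < W := by
  cases e with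
  | const c => exact he
  | reg x => exact he
  | load A e => exact he.2.2
  | op o e₁ e₂ => exact he.2.2

/-- Subtraction, division and remainder do not exceed their first operand, and comparisons give at
most `1`. In a `Good` state overflow therefore has to be excluded only for constants, sums and
products. -/
lemma Expr.Safe.ok {σ : State} (hσ : Good W σ) : ∀ {e : Expr}, e.Safe W S σ → e.Ok W S σ
  | .const _, h => h
  | .reg x, _ => hσ.reg x
  | .load _ _, h => ⟨Expr.Safe.ok hσ h.1, h.2, hσ.mem _ _⟩
  | .op .add _ _, h => ⟨Expr.Safe.ok hσ h.1, Expr.Safe.ok hσ h.2.1, h.2.2⟩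
  | .op .mul _ _, h => ⟨Expr.Safe.ok hσ h.1, Expr.Safe.ok hσ h.2.1, h.2.2⟩
  | .op .sub _ _, h => ⟨Expr.Safe.ok hσ h.1, Expr.Safe.ok hσ h.2,
      lt_of_le_of_lt (Nat.sub_le _ _) (Expr.Safe.ok hσ h.1).lt_bound⟩
  | .op .div _ _, h => ⟨Expr.Safe.ok hσ h.1, Expr.Safe.ok hσ h.2,
      lt_of_le_of_lt (Nat.div_le_self _ _) (Expr.Safe.ok hσ h.1).lt_bound⟩
  | .op .mod _ _, h => ⟨Expr.Safe.ok hσ h.1, Expr.Safe.ok hσ h.2,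
      lt_of_le_of_lt (Nat.mod_le _ _) (Expr.Safe.ok hσ h.1).lt_bound⟩
  | .op .lt _ _, h => ⟨Expr.Safe.ok hσ h.1, Expr.Safe.ok hσ h.2, by
      have := hσ.one_lt; simp only [Op.eval]; split <;> omega⟩
  | .op .eq _ _, h => ⟨Expr.Safe.ok hσ h.1, Expr.Safe.ok hσ h.2, by
      have := hσ.one_lt; simp only [Op.eval]; split <;> omega⟩

lemma Good.setReg {σ : State} (h : Good W σ) (x : ℕ) {v : ℕ} (hv : v < W) :
    Good W (σ.setReg x v) where
  one_lt := h.one_lt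
  reg y := by rw [State.setReg_reg]; split_ifs <;> [exact hv; exact h.reg y]
  mem := h.mem

lemma Good.setMem {σ : State} (h : Good W σ) (A i : ℕ) {v : ℕ} (hv : v < W) :
    Good W (σ.setMem A i v) where
  one_lt := h.one_lt
  reg := h.reg
  mem B j := by
    rw [State.setMem_mem]
    split_ifs
    · rw [Function.update_apply]; split_ifs <;> [exact hv; exact h.mem B j]
    · exact h.mem B j

/-- Every value that is written has passed the check in `Ok`, so goodness never has to be part of a
loop invariant. -/
lemma Exec.good {p : Prog} {σ τ : State} {t : ℕ} (h : Exec W S p σ t τ) :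
    Good W σ → Good W τ := by
  induction h with
  | nop => exact id
  | assign σ x e he => exact fun h => h.setReg x he.lt_bound
  | store σ A i e hi he hS => exact fun h => h.setMem A _ he.lt_bound
  | seq _ _ ih₁ ih₂ => exact fun h => ih₂ (ih₁ h)
  | cond_true _ _ _ _ ih => exact ih
  | cond_false _ _ _ _ ih => exact ih
  | loop_true _ _ _ _ ih₁ ih₂ => exact fun h => ih₂ (ih₁ h)
  | loop_false => exact id

/-- The registers that a program assigns to. -/
def Prog.wregs : Prog → List ℕ
  | .nop => []
  | .assign x _ => [x]
  | .store _ _ _ => []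
  | .seq p q => p.wregs ++ q.wregs
  | .cond _ p q => p.wregs ++ q.wregs
  | .loop _ p => p.wregs

/-- The arrays that a program writes to. -/
def Prog.wmems : Prog → List ℕ
  | .nop => []
  | .assign _ _ => []
  | .store A _ _ => [A]
  | .seq p q => p.wmems ++ q.wmems
  | .cond _ p q => p.wmems ++ q.wmems
  | .loop _ p => p.wmems

/-- `σ` and `τ` differ only in registers and arrays that `p` writes to. -/
structure Frame (p : Prog) (σ τ : State) : Prop where
  reg : ∀ x, x ∉ p.wregs → τ.reg x = σ.reg x
  mem : ∀ A, A ∉ p.wmems → τ.mem A = σ.mem A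

lemma Frame.refl (p : Prog) (σ : State) : Frame p σ σ := ⟨fun _ _ => rfl, fun _ _ => rfl⟩

lemma Frame.trans {p : Prog} {σ τ υ : State} (h : Frame p σ τ) (h' : Frame p τ υ) :
    Frame p σ υ :=
  ⟨fun x hx => (h'.reg x hx).trans (h.reg x hx), fun A hA => (h'.mem A hA).trans (h.mem A hA)⟩

lemma Frame.mono {p q : Prog} {σ τ : State} (h : Frame p σ τ) (hr : p.wregs ⊆ q.wregs)
    (hm : p.wmems ⊆ q.wmems) : Frame q σ τ :=
  ⟨fun x hx => h.reg x fun h => hx (hr h), fun A hA => h.mem A fun h => hA (hm h)⟩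

/-- The lists of written registers and arrays are computed from the syntax. For a concrete program
the preservation of everything else is thus a decidable membership question, and invariants need to
mention only what changes. -/
lemma Exec.frame {p : Prog} {σ τ : State} {t : ℕ} (h : Exec W S p σ t τ) : Frame p σ τ := by
  induction h with
  | nop => exact Frame.refl _ _
  | assign σ x e he =>
    exact ⟨fun y hy => Function.update_of_ne (by simpa [Prog.wregs] using hy) _ _, fun _ _ => rfl⟩
  | store σ A i e hi he hS =>
    exact ⟨fun _ _ => rfl, fun y hy => Function.update_of_ne (by simpa [Prog.wmems] using hy) _ _⟩
  | seq _ _ ih₁ ih₂ =>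
    exact (ih₁.mono (by simp [Prog.wregs]) (by simp [Prog.wmems])).trans
      (ih₂.mono (by simp [Prog.wregs]) (by simp [Prog.wmems]))
  | cond_true _ _ _ _ ih => exact ih.mono (by simp [Prog.wregs]) (by simp [Prog.wmems])
  | cond_false _ _ _ _ ih => exact ih.mono (by simp [Prog.wregs]) (by simp [Prog.wmems])
  | loop_true _ _ _ _ ih₁ ih₂ =>
    exact (ih₁.mono (by simp [Prog.wregs]) (by simp [Prog.wmems])).trans ih₂
  | loop_false => exact Frame.refl _ _

/-- Started in `σ`, if that is a `Good` state, the program `p` halts without a fault after time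
at most `T` in a state that satisfies `Q`. -/
def Runs (W S : ℕ) (p : Prog) (σ : State) (T : ℕ) (Q : State → Prop) : Prop :=
  Good W σ → ∃ t τ, Exec W S p σ t τ ∧ t ≤ T ∧ Q τ

lemma Runs.mono {p : Prog} {σ : State} {T T' : ℕ} {Q Q' : State → Prop}
    (h : Runs W S p σ T Q) (hT : T ≤ T') (hQ : ∀ τ, Q τ → Frame p σ τ → Good W τ → Q' τ) :
    Runs W S p σ T' Q' := fun hσ =>
  let ⟨t, τ, he, ht, hq⟩ := h hσ
  ⟨t, τ, he, ht.trans hT, hQ τ hq he.frame (he.good hσ)⟩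

lemma Runs.seq {p q : Prog} {σ : State} (T₁ T₂ : ℕ) {T : ℕ} {Q₁ Q : State → Prop}
    (hp : Runs W S p σ T₁ Q₁)
    (hq : ∀ τ, Q₁ τ → Frame p σ τ → Runs W S q τ T₂ Q) (hT : T₁ + T₂ ≤ T) :
    Runs W S (p ;; q) σ T Q := fun hσ => by
  obtain ⟨t, τ, he, ht, h⟩ := hp hσ
  obtain ⟨t', τ', he', ht', h'⟩ := hq τ h he.frame (he.good hσ)
  exact ⟨t + t', τ', .seq he he', by omega, h'⟩

/-- The condition for a loop-free program to run without a fault and to establish `Q`. -/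
def Prog.vc (W S : ℕ) : Prog → State → (State → Prop) → Prop
  | .nop, σ, Q => Q σ
  | .assign x e, σ, Q => e.Safe W S σ ∧ Q (σ.setReg x (e.eval σ))
  | .store A i e, σ, Q => i.Safe W S σ ∧ e.Safe W S σ ∧ i.eval σ < S ∧
      Q (σ.setMem A (i.eval σ) (e.eval σ))
  | .seq p q, σ, Q => p.vc W S σ fun τ => q.vc W S τ Q
  | .cond e p q, σ, Q => e.Safe W S σ ∧ (e.eval σ ≠ 0 → p.vc W S σ Q) ∧
      (e.eval σ = 0 → q.vc W S σ Q)
  | .loop _ _, _, _ => False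

/-- A bound for the running time of a loop-free program. -/
def Prog.flatCost : Prog → ℕ
  | .nop => 1
  | .assign _ e => e.cost + 1
  | .store _ i e => i.cost + e.cost + 1
  | .seq p q => p.flatCost + q.flatCost
  | .cond e p q => e.cost + 1 + max p.flatCost q.flatCost
  | .loop _ _ => 0

lemma Runs.of_vc' (p : Prog) : ∀ (σ : State) (Q : State → Prop), p.vc W S σ Q →
    Runs W S p σ p.flatCost Q := by
  induction p with
  | nop => exact fun σ Q h _ => ⟨_, _, .nop σ, le_rfl, h⟩
  | assign x e => exact fun σ Q h hσ => ⟨_, _, .assign σ x e (h.1.ok hσ), le_rfl, h.2⟩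
  | store A i e =>
    exact fun σ Q h hσ =>
      ⟨_, _, .store σ A i e (h.1.ok hσ) (h.2.1.ok hσ) h.2.2.1, le_rfl, h.2.2.2⟩
  | seq p q ihp ihq =>
    exact fun σ Q h => Runs.seq _ _ (ihp σ _ h) (fun τ hτ _ => ihq τ Q hτ) le_rfl
  | cond e p q ihp ihq =>
    intro σ Q h hσ
    by_cases he : e.eval σ = 0
    · obtain ⟨t, τ, h1, h2, h3⟩ := ihq σ Q (h.2.2 he) hσ
      exact ⟨_, τ, .cond_false p (h.1.ok hσ) he h1, by simp only [Prog.flatCost]; omega, h3⟩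
    · obtain ⟨t, τ, h1, h2, h3⟩ := ihp σ Q (h.2.1 he) hσ
      exact ⟨_, τ, .cond_true q (h.1.ok hσ) he h1, by simp only [Prog.flatCost]; omega, h3⟩
  | loop => exact fun σ Q h => h.elim

lemma Runs.of_vc {p : Prog} {σ : State} {T : ℕ} {Q : State → Prop} (hT : p.flatCost ≤ T)
    (h : p.vc W S σ Q) : Runs W S p σ T Q :=
  (Runs.of_vc' p σ Q h).mono hT fun _ h _ _ => h

lemma Runs.cond {e : Expr} {p q : Prog} {σ : State} {T : ℕ} (T' : ℕ) {Q : State → Prop}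
    (he : e.Safe W S σ) (hp : e.eval σ ≠ 0 → Runs W S p σ T' Q)
    (hq : e.eval σ = 0 → Runs W S q σ T' Q) (hT : T' + e.cost + 1 ≤ T) :
    Runs W S (.cond e p q) σ T Q := by
  intro hσ
  by_cases h : e.eval σ = 0
  · obtain ⟨t, τ, h1, h2, h3⟩ := hq h hσ
    exact ⟨_, τ, .cond_false p (he.ok hσ) h h1, by omega, h3⟩
  · obtain ⟨t, τ, h1, h2, h3⟩ := hp h hσ
    exact ⟨_, τ, .cond_true q (he.ok hσ) h h1, by omega, h3⟩

/-- The rule for a loop with a known number `m` of iterations; `φ i` bounds the time that is left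
after `i` iterations. -/
lemma Runs.loop {e : Expr} {p : Prog} {σ : State} {T : ℕ} {Q : State → Prop} (m : ℕ)
    (I : ℕ → State → Prop) (U φ : ℕ → ℕ) (h0 : I 0 σ)
    (he : ∀ i ≤ m, ∀ τ, I i τ → Frame p σ τ → e.Safe W S τ ∧ (e.eval τ ≠ 0 ↔ i < m))
    (hb : ∀ i < m, ∀ τ, I i τ → Frame p σ τ → e.eval τ ≠ 0 → Runs W S p τ (U i) (I (i + 1)))
    (hφ : ∀ i < m, U i + e.cost + 1 + φ (i + 1) ≤ φ i) (hφm : e.cost + 1 ≤ φ m)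
    (hT : φ 0 ≤ T) (hQ : ∀ τ, I m τ → Frame p σ τ → Q τ) :
    Runs W S (.loop e p) σ T Q := by
  intro hσ
  suffices H : ∀ j i τ, i + j = m → I i τ → Frame p σ τ → Good W τ →
      ∃ t υ, Exec W S (.loop e p) τ t υ ∧ t ≤ φ i ∧ Q υ by
    obtain ⟨t, υ, h1, h2, h3⟩ := H m 0 σ (by omega) h0 (Frame.refl _ _) hσ
    exact ⟨t, υ, h1, h2.trans hT, h3⟩
  intro j
  induction j with
  | zero =>
    intro i τ hi hI hf hg
    obtain rfl : i = m := by omega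
    obtain ⟨h1, h2⟩ := he i le_rfl τ hI hf
    exact ⟨_, τ, .loop_false p (h1.ok hg) (by simpa using h2), hφm, hQ τ hI hf⟩
  | succ j ih =>
    intro i τ hi hI hf hg
    obtain ⟨h1, h2⟩ := he i (by omega) τ hI hf
    have h3 := h2.2 (by omega)
    obtain ⟨t, υ, h4, h5, h6⟩ := hb i (by omega) τ hI hf h3 hg
    obtain ⟨t', υ', h7, h8, h9⟩ :=
      ih (i + 1) υ (by omega) h6 (hf.trans h4.frame) (h4.good hg)
    have := hφ i (by omega)
    exact ⟨_, υ', .loop_true (h1.ok hg) h3 h4 h7, by omega, h9⟩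

/-- Unrolling one iteration serves loops whose number of rounds emerges from an induction on the
data, as in `popMask_exists`. -/
lemma Runs.loop_step {e : Expr} {p : Prog} {σ : State} (T₁ T₂ : ℕ) {T : ℕ}
    {Q Q₁ : State → Prop} (he : e.Safe W S σ) (h : e.eval σ ≠ 0) (hp : Runs W S p σ T₁ Q₁)
    (hl : ∀ τ, Q₁ τ → Frame p σ τ → Runs W S (.loop e p) τ T₂ Q)
    (hT : T₁ + T₂ + e.cost + 1 ≤ T) : Runs W S (.loop e p) σ T Q := fun hσ => by
  obtain ⟨t, τ, h1, h2, h3⟩ := hp hσ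
  obtain ⟨t', τ', h4, h5, h6⟩ := hl τ h3 h1.frame (h1.good hσ)
  exact ⟨_, τ', .loop_true (he.ok hσ) h h1 h4, by omega, h6⟩

lemma Runs.loop_exit {e : Expr} {p : Prog} {σ : State} {T : ℕ} {Q : State → Prop}
    (he : e.Safe W S σ) (h : e.eval σ = 0) (hT : e.cost + 1 ≤ T) (hQ : Q σ) :
    Runs W S (.loop e p) σ T Q := fun hσ => ⟨_, σ, .loop_false p (he.ok hσ) h, hT, hQ⟩

/-- The rule for a loop with a decreasing measure and a uniform bound for the time of the body. -/
lemma Runs.loop_measure {e : Expr} {p : Prog} {σ : State} {T : ℕ} {Q : State → Prop}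
    (I : State → Prop) (μ : State → ℕ) (U : ℕ) (h0 : I σ)
    (he : ∀ τ, I τ → Frame p σ τ → e.Safe W S τ)
    (hb : ∀ τ, I τ → Frame p σ τ → e.eval τ ≠ 0 →
      Runs W S p τ U fun υ => I υ ∧ μ υ < μ τ)
    (hT : μ σ * (U + e.cost + 1) + e.cost + 1 ≤ T)
    (hQ : ∀ τ, I τ → Frame p σ τ → e.eval τ = 0 → Q τ) :
    Runs W S (.loop e p) σ T Q := by
  intro hσ
  suffices H : ∀ j τ, μ τ ≤ j → I τ → Frame p σ τ → Good W τ →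
      ∃ t υ, Exec W S (.loop e p) τ t υ ∧ t ≤ j * (U + e.cost + 1) + e.cost + 1 ∧ Q υ by
    obtain ⟨t, υ, h1, h2, h3⟩ := H _ σ le_rfl h0 (Frame.refl _ _) hσ
    exact ⟨t, υ, h1, h2.trans hT, h3⟩
  intro j
  induction j with
  | zero =>
    intro τ hμ hI hf hg
    by_cases h : e.eval τ = 0
    · exact ⟨_, τ, .loop_false p ((he τ hI hf).ok hg) h, by omega, hQ τ hI hf h⟩
    · obtain ⟨_, _, _, _, h6⟩ := hb τ hI hf h hg
      omega
  | succ j ih =>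
    intro τ hμ hI hf hg
    by_cases h : e.eval τ = 0
    · exact ⟨_, τ, .loop_false p ((he τ hI hf).ok hg) h, by omega, hQ τ hI hf h⟩
    · obtain ⟨t, υ, h4, h5, h6, h6'⟩ := hb τ hI hf h hg
      obtain ⟨t', υ', h7, h8, h9⟩ := ih υ (by omega) h6 (hf.trans h4.frame) (h4.good hg)
      exact ⟨_, υ', .loop_true ((he τ hI hf).ok hg) h h4 h7, by rw [Nat.succ_mul]; omega, h9⟩

/-- The rule for `forTo`; `φ i τ` bounds the time that is left after `i` iterations, if they lead
to the state `τ`. -/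
lemma Runs.forTo_potential {x : ℕ} {e : Expr} {p : Prog} {σ : State} {T : ℕ}
    {Q : State → Prop} (m : ℕ) (I : ℕ → State → Prop) (φ : ℕ → State → ℕ) (hx : x ∉ p.wregs)
    (hm : m < W) (h0 : I 0 (σ.setReg x 0))
    (he : ∀ τ, Frame (.forTo x e p) σ τ → e.Safe W S τ ∧ e.eval τ = m)
    (hb : ∀ i < m, ∀ τ, I i τ → τ.reg x = i → Frame (.forTo x e p) σ τ →
      ∃ U, Runs W S p τ U fun υ => I (i + 1) (υ.setReg x (i + 1)) ∧
        U + e.cost + 7 + φ (i + 1) (υ.setReg x (i + 1)) ≤ φ i τ)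
    (hT : φ 0 (σ.setReg x 0) + e.cost + 5 ≤ T)
    (hQ : ∀ τ, I m τ → τ.reg x = m → Frame (.forTo x e p) σ τ → Q τ) :
    Runs W S (.forTo x e p) σ T Q := by
  intro hg
  have hW := hg.one_lt
  have hf0 : Frame (.forTo x e p) σ (σ.setReg x 0) :=
    ⟨fun y hy => by
      have : y ≠ x := by rintro rfl; simp [Prog.forTo, Prog.wregs] at hy
      simp [this], fun _ _ => rfl⟩
  have hsub : ∀ {τ υ}, Frame (p ;; x ≔ .reg x + 1) τ υ → Frame (.forTo x e p) σ τ →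
      Frame (.forTo x e p) σ υ := fun h h' =>
    h'.trans (h.mono (by simp [Prog.forTo, Prog.wregs]) (by simp [Prog.forTo, Prog.wmems]))
  -- A test of the loop costs `e.cost + 3`, the increment `4` and the initialisation `2`. This gives
  -- `e.cost + 7` for the overhead of a round, and `e.cost + 5` for the initialisation with the last
  -- test.
  suffices H : ∀ j i τ, i + j = m → I i τ → τ.reg x = i → Frame (.forTo x e p) σ τ → Good W τ →
      ∃ t υ, Exec W S (.loop (.lt (.reg x) e) (p ;; x ≔ .reg x + 1)) τ t υ ∧
        t ≤ φ i τ + e.cost + 3 ∧ Q υ by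
    have h1 : Exec W S (x ≔ 0) σ 2 (σ.setReg x 0) := Exec.assign σ x 0 (by
      change 0 < W; omega)
    obtain ⟨t, υ, h2, h3, h4⟩ := H m 0 (σ.setReg x 0) (by omega) h0 (by simp) hf0 (h1.good hg)
    exact ⟨_, υ, .seq h1 h2, by omega, h4⟩
  intro j
  induction j with
  | zero =>
    intro i τ hi hI hxi hf hg
    obtain ⟨h1, h2⟩ := he τ hf
    refine ⟨_, τ, .loop_false _ ((Expr.Safe.ok hg (by simp [h1]))) (by simp [h2, hxi]; omega),
      by simp; omega, hQ τ ?_ ?_ hf⟩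
    · rwa [show m = i by omega]
    · rw [hxi]; omega
  | succ j ih =>
    intro i τ hi hI hxi hf hg
    obtain ⟨h1, h2⟩ := he τ hf
    obtain ⟨U, hU⟩ := hb i (by omega) τ hI hxi hf
    obtain ⟨t, υ, h4, h5, h6, h7⟩ := hU hg
    have hxυ : υ.reg x = i := (h4.frame.reg x hx).trans hxi
    have h8 : Exec W S (x ≔ .reg x + 1) υ 4 (υ.setReg x (i + 1)) := by
      have := Exec.assign (W := W) (S := S) υ x (.reg x + 1)
        (Expr.Safe.ok (h4.good hg) (by simp [hxυ]; omega))
      simpa [hxυ, State.setReg] using this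
    have h9 := Exec.seq h4 h8
    obtain ⟨t', υ', k1, k2, k3⟩ := ih (i + 1) _ (by omega) h6 (by simp) (hsub h9.frame hf)
      (h9.good hg)
    refine ⟨_, υ', .loop_true (Expr.Safe.ok hg (by simp [h1])) (by simp [h2, hxi]; omega) h9 k1,
      by simp; omega, k3⟩

/-- The rule for `forTo`; `φ i` bounds the time that is left after `i` iterations. -/
lemma Runs.forTo' {x : ℕ} {e : Expr} {p : Prog} {σ : State} {T : ℕ} {Q : State → Prop} (m : ℕ)
    (I : ℕ → State → Prop) (U φ : ℕ → ℕ) (hx : x ∉ p.wregs) (hm : m < W)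
    (h0 : I 0 (σ.setReg x 0))
    (he : ∀ τ, Frame (.forTo x e p) σ τ → e.Safe W S τ ∧ e.eval τ = m)
    (hb : ∀ i < m, ∀ τ, I i τ → τ.reg x = i → Frame (.forTo x e p) σ τ →
      Runs W S p τ (U i) fun υ => I (i + 1) (υ.setReg x (i + 1)))
    (hφ : ∀ i < m, U i + e.cost + 7 + φ (i + 1) ≤ φ i) (hT : φ 0 + e.cost + 5 ≤ T)
    (hQ : ∀ τ, I m τ → τ.reg x = m → Frame (.forTo x e p) σ τ → Q τ) :
    Runs W S (.forTo x e p) σ T Q :=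
  Runs.forTo_potential m I (fun i _ => φ i) hx hm h0 he
    (fun i hi τ hI hxi hf => ⟨U i, (hb i hi τ hI hxi hf).mono le_rfl
      fun _ h _ _ => ⟨h, hφ i hi⟩⟩) hT hQ

/-- The rule for `forTo` with a uniform bound for the time of the body. -/
lemma Runs.forTo {x : ℕ} {e : Expr} {p : Prog} {σ : State} {T : ℕ} {Q : State → Prop} (m : ℕ)
    (I : ℕ → State → Prop) (U : ℕ) (hx : x ∉ p.wregs) (hm : m < W)
    (h0 : I 0 (σ.setReg x 0))
    (he : ∀ τ, Frame (.forTo x e p) σ τ → e.Safe W S τ ∧ e.eval τ = m)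
    (hb : ∀ i < m, ∀ τ, I i τ → τ.reg x = i → Frame (.forTo x e p) σ τ →
      Runs W S p τ U fun υ => I (i + 1) (υ.setReg x (i + 1)))
    (hT : m * (U + e.cost + 7) + e.cost + 5 ≤ T)
    (hQ : ∀ τ, I m τ → τ.reg x = m → Frame (.forTo x e p) σ τ → Q τ) :
    Runs W S (.forTo x e p) σ T Q := by
  refine Runs.forTo' m I (fun _ => U) (fun i => (m - i) * (U + e.cost + 7)) hx hm h0 he hb
    ?_ (by simpa using hT) hQ
  intro i hi
  obtain ⟨j, rfl⟩ : ∃ j, m = i + 1 + j := ⟨m - (i + 1), by omega⟩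
  rw [show i + 1 + j - i = j + 1 by omega, show i + 1 + j - (i + 1) = j by omega, Nat.succ_mul]
  omega

end WordRAM


namespace WordRAM

/-! ### Sorted enumerations -/

/-- `A` enumerates the numbers below `m` in strictly increasing order of their `f`-values. -/
structure SortedBy {α : Type*} [LT α] (f : ℕ → α) (m : ℕ) (A : ℕ → ℕ) : Prop where
  lt : ∀ a < m, A a < m
  mono : ∀ a b, a < b → b < m → f (A a) < f (A b)

namespace SortedBy
variable {α : Type*} [LinearOrder α] {f : ℕ → α} {m : ℕ} {A : ℕ → ℕ}

lemma lt_iff (h : SortedBy f m A) {a b : ℕ} (ha : a < m) (hb : b < m) :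
    f (A a) < f (A b) ↔ a < b := by
  refine ⟨fun hab => ?_, fun hab => h.mono a b hab hb⟩
  by_contra hn
  rcases (not_lt.1 hn).lt_or_eq with h' | h'
  · exact lt_asymm hab (h.mono b a h' ha)
  · subst h'; exact lt_irrefl _ hab

lemma inj (h : SortedBy f m A) {a b : ℕ} (ha : a < m) (hb : b < m) (hab : A a = A b) : a = b := by
  rcases lt_trichotomy a b with h' | h' | h'
  · exact absurd (h.mono a b h' hb) (by simp [hab])
  · exact h'
  · exact absurd (h.mono b a h' ha) (by simp [hab])

/-- An injective map of a finite set to itself is onto. -/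
lemma surj (h : SortedBy f m A) {x : ℕ} (hx : x < m) : ∃ a < m, A a = x := by
  have : (Finset.range m).image A = Finset.range m := by
    apply Finset.eq_of_subset_of_card_le
    · intro y hy
      obtain ⟨a, ha, rfl⟩ := Finset.mem_image.1 hy
      exact Finset.mem_range.2 (h.lt a (Finset.mem_range.1 ha))
    · rw [Finset.card_image_of_injOn]
      intro a ha b hb hab
      exact h.inj (by simpa using ha) (by simpa using hb) hab
  have hx' : x ∈ (Finset.range m).image A := by rw [this]; exact Finset.mem_range.2 hx
  obtain ⟨a, ha, rfl⟩ := Finset.mem_image.1 hx'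
  exact ⟨a, Finset.mem_range.1 ha, rfl⟩

lemma congr {B : ℕ → ℕ} (h : SortedBy f m A) (hB : ∀ a < m, B a = A a) : SortedBy f m B :=
  ⟨fun a ha => by rw [hB a ha]; exact h.lt a ha,
    fun a b hab hb => by rw [hB a (hab.trans hb), hB b hb]; exact h.mono a b hab hb⟩

lemma of_lt_imp {β : Type*} [LT β] {g : ℕ → β} (h : SortedBy f m A)
    (hg : ∀ x < m, ∀ y < m, f x < f y → g x < g y) : SortedBy g m A :=
  ⟨h.lt, fun a b hab hb => hg _ (h.lt a (hab.trans hb)) _ (h.lt b hb) (h.mono a b hab hb)⟩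

/-- Rearranging an enumeration `A` by a placement `pos` that is strictly monotone for `g`. -/
lemma of_pos {β : Type*} [LinearOrder β] {g : ℕ → β} {B pos : ℕ → ℕ} (h : SortedBy f m A)
    (hg : ∀ i < m, ∀ j < m, i ≠ j → g (A i) < g (A j) ∨ g (A j) < g (A i))
    (hpos : ∀ i < m, pos i < m)
    (hmono : ∀ i < m, ∀ j < m, g (A i) < g (A j) → pos i < pos j)
    (hB : ∀ i < m, B (pos i) = A i) : SortedBy g m B := by
  -- Different items are comparable under `g` and `pos` is strictly monotone, so `pos` is injective
  -- and hence a permutation of the numbers below `m`.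
  have hs : ∀ a < m, ∃ i < m, pos i = a := by
    intro a ha
    have : (Finset.range m).image pos = Finset.range m := by
      apply Finset.eq_of_subset_of_card_le
      · intro y hy
        obtain ⟨i, hi, rfl⟩ := Finset.mem_image.1 hy
        exact Finset.mem_range.2 (hpos i (Finset.mem_range.1 hi))
      · rw [Finset.card_image_of_injOn]
        intro i hi j hj hij
        have hi := Finset.mem_range.1 (Finset.mem_coe.1 hi)
        have hj := Finset.mem_range.1 (Finset.mem_coe.1 hj)
        by_contra hne
        rcases hg i hi j hj hne with h' | h'
        · exact absurd hij (hmono i hi j hj h').ne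
        · exact absurd hij (hmono j hj i hi h').ne'
    have ha' : a ∈ (Finset.range m).image pos := by rw [this]; exact Finset.mem_range.2 ha
    obtain ⟨i, hi, rfl⟩ := Finset.mem_image.1 ha'
    exact ⟨i, Finset.mem_range.1 hi, rfl⟩
  constructor
  · intro a ha
    obtain ⟨i, hi, rfl⟩ := hs a ha
    rw [hB i hi]; exact h.lt i hi
  · intro a b hab hb
    obtain ⟨i, hi, rfl⟩ := hs a (hab.trans hb)
    obtain ⟨j, hj, rfl⟩ := hs b hb
    rw [hB i hi, hB j hj]
    have hne : i ≠ j := by rintro rfl; exact lt_irrefl _ hab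
    rcases hg i hi j hj hne with h' | h'
    · exact h'
    · exact absurd (hmono j hj i hi h') (lt_asymm hab)

end SortedBy

/-! ### Counting sort -/

/-- The first free place for the key `v` after `i` of the `m` items have been distributed. -/
def slot (κ : ℕ → ℕ) (m v i : ℕ) : ℕ := Nat.count (fun j => κ j < v) m + Nat.count (fun j => κ j = v) i

lemma count_lt_succ (κ : ℕ → ℕ) (m v : ℕ) : Nat.count (fun j => κ j < v + 1) m =
    Nat.count (fun j => κ j < v) m + Nat.count (fun j => κ j = v) m := by
  induction m with
  | zero => simp
  | succ m ih =>
    rw [Nat.count_succ, Nat.count_succ, Nat.count_succ, ih]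
    split_ifs <;> omega

/-- The items with key `κ i` fill an interval of places that ends where the next larger key begins.
-/
lemma slot_lt_of_lt {κ : ℕ → ℕ} {m i v : ℕ} (hi : i < m) (h : κ i < v) :
    slot κ m (κ i) i < Nat.count (fun j => κ j < v) m := by
  have h1 : Nat.count (fun j => κ j = κ i) i < Nat.count (fun j => κ j = κ i) m :=
    Nat.count_strict_mono rfl hi
  have h2 := count_lt_succ κ m (κ i)
  have h3 : Nat.count (fun j => κ j < κ i + 1) m ≤ Nat.count (fun j => κ j < v) m :=
    Nat.count_mono_left fun j _ hj => by omega
  unfold slot; omega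

lemma slot_lt {κ : ℕ → ℕ} {m i : ℕ} (hi : i < m) : slot κ m (κ i) i < m :=
  (slot_lt_of_lt hi (Nat.lt_succ_self _)).trans_le (Nat.count_le _)

/-- The second alternative is the stability of the sort: items with equal keys keep their order. -/
lemma slot_mono {κ : ℕ → ℕ} {m i j : ℕ} (hi : i < m)
    (h : κ i < κ j ∨ κ i = κ j ∧ i < j) : slot κ m (κ i) i < slot κ m (κ j) j := by
  rcases h with h | ⟨h, hij⟩
  · exact (slot_lt_of_lt hi h).trans_le (Nat.le_add_right _ _)
  · rw [← h]
    exact Nat.add_lt_add_left (Nat.count_strict_mono (p := fun l => κ l = κ i) rfl hij) _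

/-- Stable counting sort of the items in the array `5` by their keys in the array `4`. Register
`10` holds the number of items, register `11` an upper bound for the keys. -/
def countingSort : Prog :=
  .forTo 12 (.reg 11 + 1) (.store 7 (.reg 12) 0) ;;
  .forTo 12 (.reg 10)
    (13 ≔ .load 4 (.load 5 (.reg 12)) ;; .store 7 (.reg 13) (.load 7 (.reg 13) + 1)) ;;
  14 ≔ 0 ;;
  .forTo 12 (.reg 11 + 1)
    (13 ≔ .load 7 (.reg 12) ;; .store 7 (.reg 12) (.reg 14) ;; 14 ≔ .reg 14 + .reg 13) ;;
  .forTo 12 (.reg 10)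
    (13 ≔ .load 4 (.load 5 (.reg 12)) ;; .store 6 (.load 7 (.reg 13)) (.load 5 (.reg 12)) ;;
      .store 7 (.reg 13) (.load 7 (.reg 13) + 1)) ;;
  .forTo 12 (.reg 10) (.store 5 (.reg 12) (.load 6 (.reg 12)))

variable {W S : ℕ}

/-- The order `f` records the previous arrangement. By stability the new key is put in front of it,
so that repeated calls implement radix sort. Array `7` holds first the number of items with each
key, then the start of each key's interval, and finally the next free place in it; after `i` items
this is `slot κ m v i`. -/
lemma countingSort_runs {α : Type*} [LinearOrder α] (f : ℕ → α) {σ : State} {m K : ℕ}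
    (h10 : σ.reg 10 = m) (h11 : σ.reg 11 = K) (hord : SortedBy f m (σ.mem 5))
    (hkey : ∀ j < m, σ.mem 4 j ≤ K) (hmS : m ≤ S) (hKS : K < S) (hW : m + K + 2 < W) :
    Runs W S countingSort σ (200 * (m + K + 1))
      fun τ => SortedBy (fun j => toLex (σ.mem 4 j, f j)) m (τ.mem 5) := by
  set κ : ℕ → ℕ := fun i => σ.mem 4 (σ.mem 5 i) with hκ
  have hκK : ∀ i < m, κ i ≤ K := fun i hi => hkey _ (hord.lt i hi)
  have hordS : ∀ i < m, σ.mem 5 i < S := fun i hi => (hord.lt i hi).trans_le hmS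
  unfold countingSort
  refine Runs.seq (20 * (K + 1) + 20) (70 * m + 40 * (K + 1) + 60)
    (Q₁ := fun τ => ∀ v ≤ K, τ.mem 7 v = 0) ?_ ?_ (by omega)
  · refine Runs.forTo (K + 1) (fun i τ => ∀ v < i, τ.mem 7 v = 0) 3 (by decide) (by omega)
      (by simp) ?_ ?_ (by simp; omega) ?_
    · intro τ hf
      have := hf.reg 11 (by decide)
      simp [this, h11]; omega
    · intro i hi τ hI hx hf
      refine Runs.of_vc le_rfl ?_
      simp only [Prog.vc]
      simp [hx, Function.update_apply]
      refine ⟨by omega, by omega, fun v hv hne => hI v (by omega)⟩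
    · exact fun τ hI _ _ v hv => hI v (by omega)
  intro τ₁ hz hf₁
  refine Runs.seq (30 * m + 10) (40 * m + 40 * (K + 1) + 50)
    (Q₁ := fun τ => ∀ v ≤ K, τ.mem 7 v = Nat.count (fun j => κ j = v) m) ?_ ?_ (by omega)
  · refine Runs.forTo m (fun i τ => ∀ v ≤ K, τ.mem 7 v = Nat.count (fun j => κ j = v) i) 10
      (by decide) (by omega) (by simpa using hz) ?_ ?_ (by simp; omega) ?_
    · intro τ hf
      simp [hf.reg 10 (by decide), hf₁.reg 10 (by decide), h10]
    · intro i hi τ hI hx hf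
      have h4 : τ.mem 4 = σ.mem 4 := (hf.mem 4 (by decide)).trans (hf₁.mem 4 (by decide))
      have h5 : τ.mem 5 = σ.mem 5 := (hf.mem 5 (by decide)).trans (hf₁.mem 5 (by decide))
      have hk := hκK i hi
      have h7 := hI (κ i) hk
      have hc := Nat.count_le (fun j => κ j = κ i) (n := i)
      have hs := hordS i hi
      refine Runs.of_vc (by decide) ?_
      simp only [Prog.vc]
      simp [hx, h4, h5]
      change _ ∧ (κ i < S ∧ _ ∧ τ.mem 7 (κ i) + 1 < W) ∧ κ i < S ∧ _
      refine ⟨by omega, by omega, by omega, fun v hv => ?_⟩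
      change Function.update (τ.mem 7) (κ i) (τ.mem 7 (κ i) + 1) v = _
      rw [Nat.count_succ, Function.update_apply]
      by_cases h : v = κ i
      · subst h; simp [h7]
      · simp [h, Ne.symm h, hI v hv]
    · exact fun τ hI _ _ => hI
  intro τ₂ hc hf₂
  refine Runs.seq 2 (40 * m + 40 * (K + 1) + 45) (Q₁ := fun τ => τ = τ₂.setReg 14 0)
    (Runs.of_vc le_rfl (by simp [Prog.vc]; omega)) ?_ (by omega)
  rintro _ rfl -
  refine Runs.seq (30 * (K + 1) + 10) (40 * m + 20)
    (Q₁ := fun τ => ∀ v ≤ K, τ.mem 7 v = slot κ m v 0) ?_ ?_ (by omega)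
  · refine Runs.forTo (K + 1) (fun i τ => τ.reg 14 = Nat.count (fun j => κ j < i) m ∧
        (∀ v < i, τ.mem 7 v = slot κ m v 0) ∧ ∀ v ≤ K, i ≤ v → τ.mem 7 v = τ₂.mem 7 v) 11
      (by decide) (by omega) (by simp) ?_ ?_ (by simp; omega) ?_
    · intro τ hf
      simp [hf.reg 11 (by decide), hf₂.reg 11 (by decide), hf₁.reg 11 (by decide), h11]
      omega
    · rintro i hi τ ⟨hI1, hI2, hI3⟩ hx hf
      have h7 := (hI3 i (by omega) le_rfl).trans (hc i (by omega))
      have hle := count_lt_succ κ m i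
      have hle' := Nat.count_le (fun j => κ j < i + 1) (n := m)
      simp only [Nat.lt_succ_iff] at hle hle'
      refine Runs.of_vc (by decide) ?_
      simp only [Prog.vc]
      simp [hx, hI1, h7, Function.update_apply]
      refine ⟨by omega, by omega, by omega, ?_, ?_⟩
      · intro v hv
        split_ifs with h
        · simp [slot, h]
        · exact hI2 v (by omega)
      · intro v hv hiv
        rw [if_neg (by omega)]
        exact hI3 v hv (by omega)
    · exact fun τ hI _ _ v hv => hI.2.1 v (by omega)
  intro τ₃ hs₃ hf₃
  have g4 : τ₃.mem 4 = σ.mem 4 := (hf₃.mem 4 (by decide)).trans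
    ((hf₂.mem 4 (by decide)).trans (hf₁.mem 4 (by decide)))
  have g5 : τ₃.mem 5 = σ.mem 5 := (hf₃.mem 5 (by decide)).trans
    ((hf₂.mem 5 (by decide)).trans (hf₁.mem 5 (by decide)))
  have g10 : τ₃.reg 10 = m := (hf₃.reg 10 (by decide)).trans
    ((hf₂.reg 10 (by decide)).trans ((hf₁.reg 10 (by decide)).trans h10))
  refine Runs.seq (25 * m + 10) (15 * m + 10)
    (Q₁ := fun τ => ∀ i < m, τ.mem 6 (slot κ m (κ i) i) = σ.mem 5 i) ?_ ?_ (by omega)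
  · refine Runs.forTo m (fun i τ => (∀ v ≤ K, τ.mem 7 v = slot κ m v i) ∧
        ∀ j < i, τ.mem 6 (slot κ m (κ j) j) = σ.mem 5 j) 15
      (by decide) (by omega) ⟨by simpa using hs₃, by simp⟩ ?_ ?_ (by simp; omega) ?_
    · intro τ hf
      simp [hf.reg 10 (by decide), g10]
    · rintro i hi τ ⟨hI1, hI2⟩ hx hf
      have h4 : τ.mem 4 = σ.mem 4 := (hf.mem 4 (by decide)).trans g4
      have h5 : τ.mem 5 = σ.mem 5 := (hf.mem 5 (by decide)).trans g5
      have hk := hκK i hi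
      have h7 := hI1 (κ i) hk
      have hs := hordS i hi
      have hsl := slot_lt (κ := κ) hi
      refine Runs.of_vc (by decide) ?_
      simp only [Prog.vc]
      simp [hx, h4, h5]
      simp only [show σ.mem 4 (σ.mem 5 i) = κ i from rfl, h7]
      refine ⟨by omega, by omega, by omega, by omega, by omega, by omega, ?_, ?_⟩
      · intro v hv
        rw [Function.update_apply]
        split_ifs with h
        · subst h; simp [slot, Nat.count_succ]; omega
        · rw [hI1 v hv]; simp [slot, Nat.count_succ, Ne.symm h]
      · intro j hj
        rw [Function.update_apply]
        split_ifs with h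
        · rcases hj.lt_or_eq with hj | hj
          -- Two items never share a slot, so this write does not overwrite an earlier item.
          · exfalso
            rcases lt_trichotomy (κ j) (κ i) with h' | h' | h'
            · exact (slot_mono (hj.trans hi) (Or.inl h')).ne h
            · exact (slot_mono (hj.trans hi) (Or.inr ⟨h', hj⟩)).ne h
            · exact (slot_mono hi (Or.inl h')).ne h.symm
          · rw [hj]
        · refine hI2 j (Nat.lt_of_le_of_ne (by omega) ?_)
          rintro rfl; exact h rfl
    · exact fun τ hI _ _ => hI.2
  intro τ₄ ht hf₄
  have k10 : τ₄.reg 10 = m := (hf₄.reg 10 (by decide)).trans g10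
  refine Runs.forTo m (fun i τ => ∀ j < i, τ.mem 5 j = τ₄.mem 6 j) 4
      (by decide) (by omega) (by simp) ?_ ?_ (by simp; omega) ?_
  · intro τ hf
    simp [hf.reg 10 (by decide), k10]
  · rintro i hi τ hI hx hf
    refine Runs.of_vc (by decide) ?_
    simp only [Prog.vc]
    simp [hx, hf.mem 6 (by decide), Function.update_apply]
    refine ⟨by omega, fun j hj => ?_⟩
    split_ifs with h
    · rw [h]
    · exact hI j (by omega)
  · intro τ hI _ _
    refine SortedBy.congr (A := τ₄.mem 6) (SortedBy.of_pos (pos := fun i => slot κ m (κ i) i)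
      hord ?_ (fun i hi => slot_lt hi) ?_ ht) hI
    · intro i hi j hj hne
      simp only [Prod.Lex.toLex_lt_toLex]
      rcases hne.lt_or_gt with h | h
      · have := hord.mono i j h hj
        simp only [this, and_true]
        rcases lt_trichotomy (σ.mem 4 (σ.mem 5 i)) (σ.mem 4 (σ.mem 5 j)) with h | h | h <;>
          simp [h]
      · have := hord.mono j i h hi
        simp only [this, and_true]
        rcases lt_trichotomy (σ.mem 4 (σ.mem 5 i)) (σ.mem 4 (σ.mem 5 j)) with h | h | h <;>
          simp [h]
    · intro i hi j hj h
      simp only [Prod.Lex.toLex_lt_toLex, hord.lt_iff hi hj] at h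
      exact slot_mono hi h

end WordRAM


/-! ### Suffixes and their reduction to the positions that are not divisible by three -/

namespace Suffix

/-- The suffix of `s` that starts at `i`, with the lexicographic order. -/
def sfx (s : ℕ → ℕ) (i : ℕ) : Lex (ℕ → ℕ) := toLex fun h => s (i + h)

/-- `s` is a text of length `n`: positive letters, followed by zeros. -/
structure IsText (s : ℕ → ℕ) (n : ℕ) : Prop where
  pos : ∀ i < n, 0 < s i
  zero : ∀ i, n ≤ i → s i = 0

variable {s : ℕ → ℕ} {n : ℕ}

lemma sfx_lt_iff {i j : ℕ} :
    sfx s i < sfx s j ↔ ∃ h, (∀ g < h, s (i + g) = s (j + g)) ∧ s (i + h) < s (j + h) := Iff.rfl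

lemma sfx_lt_succ {i j : ℕ} : sfx s i < sfx s j ↔
    s i < s j ∨ s i = s j ∧ sfx s (i + 1) < sfx s (j + 1) := by
  rw [sfx_lt_iff, sfx_lt_iff]
  constructor
  · rintro ⟨h, h1, h2⟩
    cases h with
    | zero => exact Or.inl h2
    | succ h =>
      refine Or.inr ⟨h1 0 (by omega), h, fun g hg => ?_, ?_⟩
      · have := h1 (g + 1) (by omega)
        rwa [show i + (g + 1) = i + 1 + g by omega, show j + (g + 1) = j + 1 + g by omega] at this
      · rwa [show i + (h + 1) = i + 1 + h by omega, show j + (h + 1) = j + 1 + h by omega] at h2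
  · rintro (h | ⟨h0, h, h1, h2⟩)
    · exact ⟨0, by simp, h⟩
    · refine ⟨h + 1, fun g hg => ?_, ?_⟩
      · cases g with
        | zero => exact h0
        | succ g =>
          have := h1 g (by omega)
          rwa [show i + (g + 1) = i + 1 + g by omega, show j + (g + 1) = j + 1 + g by omega]
      · rwa [show i + (h + 1) = i + 1 + h by omega, show j + (h + 1) = j + 1 + h by omega]

lemma IsText.pos_iff (hs : IsText s n) {i : ℕ} : 0 < s i ↔ i < n := by
  refine ⟨fun h => ?_, hs.pos i⟩
  by_contra hn
  rw [hs.zero i (by omega)] at h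
  exact lt_irrefl _ h

/-- The zeros behind the text reveal its end: a suffix determines the number of its positive
letters, hence its starting position. -/
lemma IsText.sfx_injective (hs : IsText s n) {i j : ℕ} (hi : i < n) (h : sfx s i = sfx s j) :
    i = j := by
  have H : ∀ g, s (i + g) = s (j + g) := fun g => congrFun (ofLex_inj.2 h) g
  have H' : ∀ g, i + g < n ↔ j + g < n := fun g => by rw [← hs.pos_iff, H g, hs.pos_iff]
  have h1 := H' (n - i - 1)
  have h2 := H' (n - i)
  omega

lemma IsText.sfx_lt_of_le (hs : IsText s n) {i j : ℕ} (hj : j < n) (hi : n ≤ i) :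
    sfx s i < sfx s j := by
  refine sfx_lt_succ.2 (Or.inl ?_)
  rw [hs.zero i hi]; exact hs.pos j hj

lemma IsText.sfx_eq_of_le (hs : IsText s n) {i j : ℕ} (hj : n ≤ j) (hi : n ≤ i) :
    sfx s i = sfx s j := by
  unfold sfx; congr 1; ext h
  rw [hs.zero _ (by omega), hs.zero _ (by omega)]

/-- The number of sample positions of a text of length `n`. -/
def sampleLen (n : ℕ) : ℕ := (n + 2) / 3 + n / 3

/-- The `t`-th sample position: first those congruent to `1`, then those congruent to `2`. -/
def samplePos (n t : ℕ) : ℕ := if t < (n + 2) / 3 then 3 * t + 1 else 3 * (t - (n + 2) / 3) + 2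

/-- The three letters at position `p`. -/
def triple (s : ℕ → ℕ) (p : ℕ) : ℕ ×ₗ ℕ ×ₗ ℕ := toLex (s p, toLex (s (p + 1), s (p + 2)))

/-- `s'` is a text of names of the triples at the sample positions. -/
structure IsReduction (s : ℕ → ℕ) (n : ℕ) (s' : ℕ → ℕ) : Prop where
  text : IsText s' (sampleLen n)
  lt_iff : ∀ t < sampleLen n, ∀ u < sampleLen n,
    s' t < s' u ↔ triple s (samplePos n t) < triple s (samplePos n u)

/-- Equality occurs for `n % 3 = 1`: the positions congruent to `1` then include the position `n`
behind the text. As a result the last triple of the first group always contains a zero, which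
separates the two groups. -/
lemma samplePos_le {t : ℕ} (ht : t < sampleLen n) : samplePos n t ≤ n := by
  unfold samplePos sampleLen at *; split_ifs <;> omega

lemma samplePos_mod (t : ℕ) : samplePos n t % 3 ≠ 0 := by
  unfold samplePos; split_ifs <;> omega

lemma samplePos_inj {t u : ℕ} (h : samplePos n t = samplePos n u) : t = u := by
  unfold samplePos at h; split_ifs at h <;> omega

lemma exists_samplePos {p : ℕ} (hp : p < n) (h : p % 3 ≠ 0) :
    ∃ t < sampleLen n, samplePos n t = p := by
  rcases (by omega : p % 3 = 1 ∨ p % 3 = 2) with h | h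
  · refine ⟨p / 3, ?_, ?_⟩
    · unfold sampleLen; omega
    · unfold samplePos; rw [if_pos (by omega)]; omega
  · refine ⟨(n + 2) / 3 + p / 3, ?_, ?_⟩
    · unfold sampleLen; omega
    · unfold samplePos; rw [if_neg (by omega)]; omega

lemma IsReduction.eq_of_triple_eq {s' : ℕ → ℕ} (h : IsReduction s n s') {t u : ℕ}
    (ht : t < sampleLen n) (hu : u < sampleLen n)
    (htu : triple s (samplePos n t) = triple s (samplePos n u)) : s' t = s' u := by
  have h1 := h.lt_iff t ht u hu
  have h2 := h.lt_iff u hu t ht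
  simp only [htu, lt_irrefl, iff_false, not_lt] at h1 h2
  omega

/-- Moving by one name in `s'` moves by three letters in `s`, as long as the group of sample
positions is not left. If the suffixes of `s` first differ at `g`, their triples agree before index
`g / 3` and differ in the right direction there. All earlier letters are positive, so the comparison
is settled before either side can leave its group for the other. -/
lemma IsReduction.sfx_lt {s' : ℕ → ℕ} (h : IsReduction s n s') (hs : IsText s n) {t u : ℕ}
    (ht : t < sampleLen n) (htu : sfx s (samplePos n t) < sfx s (samplePos n u)) : sfx s' t < sfx s' u := by
  obtain ⟨g, h1, h2⟩ := sfx_lt_iff.1 htu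
  have hb : samplePos n u + g < n := hs.pos_iff.1 (by omega)
  have ha : ∀ i < g, samplePos n t + i < n := fun i hi => by
    rw [← hs.pos_iff, h1 i hi]; exact hs.pos _ (by omega)
  -- the index of the first triple that differs
  obtain ⟨j, r, hr, rfl⟩ : ∃ j r, r < 3 ∧ g = 3 * j + r := ⟨g / 3, g % 3, by omega, by omega⟩
  have hu1 : ∀ i ≤ j, u + i < sampleLen n ∧ samplePos n (u + i) = samplePos n u + 3 * i := by
    intro i hi
    unfold samplePos sampleLen at *
    split_ifs at hb ⊢ <;> omega
  -- The names from `t` on may run out exactly at index `j`, hence only `≤`; in that case `s'` is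
  -- zero there and still smaller.
  have ht1 : ∀ i ≤ j, t + i ≤ sampleLen n ∧ (t + i < sampleLen n →
      samplePos n (t + i) = samplePos n t + 3 * i) := by
    intro i hi
    rcases Nat.eq_zero_or_pos i with rfl | hi0
    · exact ⟨by simpa using ht.le, by simp⟩
    · have := ha (3 * (i - 1) + 2) (by omega)
      unfold samplePos sampleLen at *
      split_ifs at this ⊢ <;> omega
  have ht2 : ∀ i < j, t + i < sampleLen n := by
    intro i hi
    have := (ht1 (i + 1) hi).1
    omega
  refine sfx_lt_iff.2 ⟨j, fun i hi => ?_, ?_⟩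
  · refine h.eq_of_triple_eq (ht2 i hi) (hu1 i hi.le).1 ?_
    rw [(ht1 i hi.le).2 (ht2 i hi), (hu1 i hi.le).2]
    have e0 := h1 (3 * i) (by omega)
    have e1 := h1 (3 * i + 1) (by omega)
    have e2 := h1 (3 * i + 2) (by omega)
    simp only [triple, add_assoc, e0, e1, e2]
  · rcases (ht1 j le_rfl).1.lt_or_eq with hlt | heq
    · rw [h.lt_iff _ hlt _ (hu1 j le_rfl).1, (ht1 j le_rfl).2 hlt, (hu1 j le_rfl).2]
      simp only [triple, Prod.Lex.toLex_lt_toLex, add_assoc]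
      rcases (by omega : r = 0 ∨ r = 1 ∨ r = 2) with rfl | rfl | rfl
      · exact Or.inl h2
      · exact Or.inr ⟨h1 (3 * j) (by omega), Or.inl h2⟩
      · exact Or.inr ⟨h1 (3 * j) (by omega), Or.inr ⟨h1 (3 * j + 1) (by omega), h2⟩⟩
    · rw [heq, h.text.zero _ le_rfl]
      exact h.text.pos _ (hu1 j le_rfl).1

end Suffix


namespace WordRAM
open Suffix

variable {W S : ℕ}

/-! ### The descent to a reduced text -/

/-- `A[i] := e` for all `i` below the number in register `10`; the index is in register `16`. -/
def fill (A : ℕ) (e : Expr) : Prog := .forTo 16 (.reg 10) (.store A (.reg 16) e)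

lemma fill_runs (A : ℕ) (e : Expr) (v : ℕ → ℕ) {σ : State} {m : ℕ} (h10 : σ.reg 10 = m)
    (hm : m ≤ S) (hmW : m < W)
    (he : ∀ i < m, ∀ τ : State, τ.reg 16 = i → (∀ y, y ≠ 16 → τ.reg y = σ.reg y) →
      (∀ B, B ≠ A → τ.mem B = σ.mem B) → e.Safe W S τ ∧ e.eval τ = v i) :
    Runs W S (fill A e) σ (m * (e.cost + 10) + 6) fun τ => ∀ i < m, τ.mem A i = v i := by
  refine Runs.forTo m (fun i τ => ∀ j < i, τ.mem A j = v j) (e.cost + 2)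
      (by simp [Prog.wregs]) hmW (by simp) ?_ ?_ (by simp) ?_
  · intro τ hf
    simp [hf.reg 10 (by simp [Prog.wregs, Prog.forTo]), h10]
  · intro i hi τ hI hx hf
    obtain ⟨h1, h2⟩ := he i hi τ hx
      (fun y hy => hf.reg y (by simpa [Prog.wregs, Prog.forTo] using hy))
      (fun B hB => hf.mem B (by simpa [Prog.wmems, Prog.forTo] using hB))
    refine Runs.of_vc (by simp [Prog.flatCost]; omega) ?_
    simp only [Prog.vc]
    simp [hx, Function.update_apply, h1, h2]
    refine ⟨by omega, fun j hj => ?_⟩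
    split_ifs with h
    · rw [h]
    · exact hI j (by omega)
  · exact fun τ hI _ _ => hI

/-- Computes the sample positions of a text whose length is in register `3`. -/
def samplePosProg : Prog :=
  5 ≔ (.reg 3 + 2) / 3 ;; 10 ≔ .reg 5 + .reg 3 / 3 ;;
  .forTo 16 (.reg 10) (.cond (.lt (.reg 16) (.reg 5)) (.store 3 (.reg 16) (3 * .reg 16 + 1))
    (.store 3 (.reg 16) (3 * (.reg 16 - .reg 5) + 2)))

lemma samplePosProg_runs {σ : State} {n : ℕ} (h3 : σ.reg 3 = n) (hS : n ≤ S)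
    (hW : 2 * n + 10 < W) :
    Runs W S samplePosProg σ (30 * n + 40) fun τ => τ.reg 5 = (n + 2) / 3 ∧
      τ.reg 10 = sampleLen n ∧ ∀ t < sampleLen n, τ.mem 3 t = samplePos n t := by
  refine Runs.seq 6 (30 * n + 30) (Q₁ := fun τ => τ = σ.setReg 5 ((n + 2) / 3))
    (Runs.of_vc (by decide) (by simp [Prog.vc, h3]; omega)) ?_ (by omega)
  rintro _ rfl -
  refine Runs.seq 6 (30 * n + 20)
    (Q₁ := fun τ => τ = (σ.setReg 5 ((n + 2) / 3)).setReg 10 (sampleLen n))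
    (Runs.of_vc (by decide) (by simp [Prog.vc, h3, sampleLen]; omega)) ?_ (by omega)
  rintro _ rfl -
  have hl : sampleLen n ≤ n := by unfold sampleLen; omega
  refine Runs.forTo (sampleLen n) (fun i τ => ∀ t < i, τ.mem 3 t = samplePos n t) 16
    (by decide) (by omega) (by simp) ?_ ?_ (by simp; omega) ?_
  · intro τ hf
    simp [hf.reg 10 (by decide)]
  · intro i hi τ hI hx hf
    have h5 : τ.reg 5 = (n + 2) / 3 := by simp [hf.reg 5 (by decide)]
    have hp := samplePos_le hi
    unfold samplePos at hp
    refine Runs.of_vc (by decide) ?_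
    simp only [Prog.vc]
    simp [hx, h5, Function.update_apply]
    refine ⟨fun h => ⟨by rw [if_pos h] at hp; omega, by omega, fun t ht => ?_⟩,
      fun h => ⟨by rw [if_neg (by omega)] at hp; omega, by omega, fun t ht => ?_⟩⟩
    · split_ifs with h1
      · rw [samplePos, h1, if_pos h]
      · exact hI t (by omega)
    · split_ifs with h1
      · rw [samplePos, h1, if_neg (by omega)]
      · exact hI t (by omega)
  · intro τ hI _ hf
    simp [hf.reg 10 (by decide), hf.reg 5 (by decide)]
    exact hI

/-- Along a weakly increasing sequence, the number of changes so far grows exactly where the value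
grows. Counting changes therefore replaces the values by small numbers in the same order; this is
how triples receive their names. -/
lemma count_ne_lt_iff {α : Type*} [LinearOrder α] {g : ℕ → α} {m : ℕ}
    (hg : ∀ a b, a ≤ b → b < m → g a ≤ g b) {a b : ℕ} (ha : a < m) (hb : b < m) :
    Nat.count (fun i => g i ≠ g (i + 1)) a < Nat.count (fun i => g i ≠ g (i + 1)) b ↔
      g a < g b := by
  have H : ∀ j a, a + j < m →
      (Nat.count (fun i => g i ≠ g (i + 1)) a < Nat.count (fun i => g i ≠ g (i + 1)) (a + j) ↔
      g a < g (a + j)) := by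
    intro j
    induction j with
    | zero => simp
    | succ j ih =>
      intro a haj
      have h1 := ih a (by omega)
      have h2 := hg a (a + j) (by omega) (by omega)
      have h3 := hg (a + j) (a + j + 1) (by omega) (by omega)
      have h4 := Nat.count_monotone (fun i => g i ≠ g (i + 1)) (show a ≤ a + j by omega)
      beta_reduce at h4
      rw [← add_assoc, Nat.count_succ]
      by_cases h : g (a + j) = g (a + j + 1)
      · simp only [h, ne_eq, not_true_eq_false, if_false, add_zero]
        rw [← h]; exact h1
      · rw [if_pos h]
        exact ⟨fun _ => h2.trans_lt (lt_of_le_of_ne h3 h), fun _ => Nat.lt_succ_of_le h4⟩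
  rcases le_total a b with h | h
  · obtain ⟨j, rfl⟩ := Nat.exists_eq_add_of_le h
    exact H j a hb
  · exact iff_of_false (Nat.count_monotone _ h).not_gt (hg b a h ha).not_gt

/-- The name of the `a`-th triple in the enumeration `A` of the sample positions. -/
def tripleName (s : ℕ → ℕ) (n : ℕ) (A : ℕ → ℕ) (a : ℕ) : ℕ :=
  1 + Nat.count (fun i => triple s (samplePos n (A i)) ≠ triple s (samplePos n (A (i + 1)))) a

/-- Writes the names of the triples to the array `1` behind the current text. -/
def nameTriples : Prog :=
  15 ≔ .reg 2 + .reg 3 + 3 ;; 17 ≔ 1 ;; 19 ≔ .reg 2 + .load 3 (.load 5 0) ;;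
  .forTo 16 (.reg 10)
    (18 ≔ .reg 2 + .load 3 (.load 5 (.reg 16)) ;;
      .cond (Expr.eq (.load 1 (.reg 18)) (.load 1 (.reg 19)) *
          Expr.eq (.load 1 (.reg 18 + 1)) (.load 1 (.reg 19 + 1)) *
          Expr.eq (.load 1 (.reg 18 + 2)) (.load 1 (.reg 19 + 2)))
        .nop (17 ≔ .reg 17 + 1) ;;
      .store 1 (.reg 15 + .load 5 (.reg 16)) (.reg 17) ;; 19 ≔ .reg 18)

lemma triple_eq_iff {s : ℕ → ℕ} {p q : ℕ} : triple s p = triple s q ↔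
    s p = s q ∧ s (p + 1) = s (q + 1) ∧ s (p + 2) = s (q + 2) := by
  simp [triple]

/-- Register `17` holds the current name and register `19` the address of the triple named last. The
names start at `1`, so that zero remains free to mark the end of the new text. Since `A` is
injective, no name is overwritten. -/
lemma nameTriples_runs {σ : State} {s A : ℕ → ℕ} {n o : ℕ} (h2 : σ.reg 2 = o) (h3 : σ.reg 3 = n)
    (h10 : σ.reg 10 = sampleLen n) (hn : 2 ≤ n)
    (hpos : ∀ t < sampleLen n, σ.mem 3 t = samplePos n t)
    (hs : ∀ j < n + 3, σ.mem 1 (o + j) = s j)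
    (hA : ∀ a < sampleLen n, σ.mem 5 a = A a) (hA' : ∀ a < sampleLen n, A a < sampleLen n)
    (hAi : ∀ a < sampleLen n, ∀ b < sampleLen n, A a = A b → a = b)
    (hS : o + 2 * n + 10 ≤ S) (hW : S < W) :
    Runs W S nameTriples σ (60 * n + 40) fun τ => τ.reg 15 = o + n + 3 ∧
      (∀ a < sampleLen n, τ.mem 1 (o + n + 3 + A a) = tripleName s n A a) ∧
      ∀ i, i < o + n + 3 ∨ o + n + 3 + sampleLen n ≤ i → τ.mem 1 i = σ.mem 1 i := by
  have hl : sampleLen n < n := by unfold sampleLen; omega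
  have hl0 : 0 < sampleLen n := by unfold sampleLen; omega
  have hA0 := hA' 0 hl0
  have hp0 := samplePos_le hA0
  refine Runs.seq 6 (60 * n + 30) (Q₁ := fun τ => τ = σ.setReg 15 (o + n + 3))
    (Runs.of_vc (by decide) (by simp [Prog.vc, h3, h2]; omega)) ?_ (by omega)
  rintro _ rfl -
  refine Runs.seq 2 (60 * n + 28)
    (Q₁ := fun τ => τ = (σ.setReg 15 (o + n + 3)).setReg 17 1)
    (Runs.of_vc (by decide) (by simp [Prog.vc]; omega)) ?_ (by omega)
  rintro _ rfl -
  refine Runs.seq 6 (60 * n + 20)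
    (Q₁ := fun τ => τ = ((σ.setReg 15 (o + n + 3)).setReg 17 1).setReg 19
      (o + samplePos n (A 0)))
    (Runs.of_vc (by decide) (by
      simp [Prog.vc, h2, hA 0 hl0, hpos _ hA0]; omega)) ?_ (by omega)
  rintro _ rfl -
  refine Runs.forTo (sampleLen n) (fun i τ => τ.reg 17 = tripleName s n A (i - 1) ∧
      τ.reg 19 = o + samplePos n (A (i - 1)) ∧
      (∀ a < i, τ.mem 1 (o + n + 3 + A a) = tripleName s n A a) ∧
      ∀ i, i < o + n + 3 ∨ o + n + 3 + sampleLen n ≤ i → τ.mem 1 i = σ.mem 1 i) 45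
    (by decide) (by omega) (by simp [tripleName]) ?_ ?_ (by simp; omega) ?_
  · intro τ hf
    simp [hf.reg 10 (by decide), h10]
  · rintro i hi τ ⟨hI1, hI2, hI3, hI4⟩ hx hf
    have e2 : τ.reg 2 = o := by simp [hf.reg 2 (by decide), h2]
    have e15 : τ.reg 15 = o + n + 3 := by simp [hf.reg 15 (by decide)]
    have m3 : ∀ t < sampleLen n, τ.mem 3 t = samplePos n t := by
      simpa [hf.mem 3 (by decide)] using hpos
    have m5 : ∀ t < sampleLen n, τ.mem 5 t = A t := by
      simpa [hf.mem 5 (by decide)] using hA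
    have ai := hA' i hi
    have pi := samplePos_le ai
    have pi' := samplePos_le (hA' (i - 1) (by omega))
    -- For `i = 0` the subtraction truncates and the first triple is compared with itself, so the
    -- name stays `1`.
    have hname : tripleName s n A i = tripleName s n A (i - 1) +
        if triple s (samplePos n (A i)) = triple s (samplePos n (A (i - 1))) then 0 else 1 := by
      cases i with
      | zero => simp
      | succ i =>
        simp only [tripleName, Nat.count_succ, Nat.add_sub_cancel, eq_comm, ne_eq, add_assoc]
        split_ifs <;> simp_all
    have hle : tripleName s n A i ≤ n := by
      have := Nat.count_le (fun i => triple s (samplePos n (A i)) ≠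
        triple s (samplePos n (A (i + 1)))) (n := i)
      unfold tripleName; omega
    simp only [triple_eq_iff] at hname
    have m1 : ∀ j < n + 3, τ.mem 1 (o + j) = s j := fun j hj => by
      rw [hI4 _ (by omega)]; exact hs j hj
    have a0 := m1 (samplePos n (A i)) (by omega)
    have a1 := m1 (samplePos n (A i) + 1) (by omega)
    have a2 := m1 (samplePos n (A i) + 2) (by omega)
    have b0 := m1 (samplePos n (A (i - 1))) (by omega)
    have b1 := m1 (samplePos n (A (i - 1)) + 1) (by omega)
    have b2 := m1 (samplePos n (A (i - 1)) + 2) (by omega)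
    simp only [← add_assoc] at a1 a2 b1 b2
    have hpost : ∀ v, v = tripleName s n A i →
        (∀ a ≤ i, Function.update (τ.mem 1) (o + n + 3 + A i) v (o + n + 3 + A a) =
          tripleName s n A a) ∧
        ∀ j, j ≤ o + n + 2 ∨ o + n + 3 + sampleLen n ≤ j →
          Function.update (τ.mem 1) (o + n + 3 + A i) v j = σ.mem 1 j := by
      rintro v rfl
      refine ⟨fun a ha => ?_, fun j hj => ?_⟩
      · rw [Function.update_apply]
        split_ifs with h
        · rw [hAi a (by omega) i hi (by omega)]
        · refine hI3 a (lt_of_le_of_ne ha ?_)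
          rintro rfl; exact h rfl
      · rw [Function.update_of_ne (by omega)]
        exact hI4 j (by omega)
    refine Runs.of_vc (by decide) ?_
    simp only [Prog.vc]
    simp [hx, e2, e15, m3, m5, a0, a1, a2, b0, b1, b2, hI1, hI2, hi, ai, Nat.lt_succ_iff]
    refine ⟨by omega, ⟨⟨by omega, by omega, by split_ifs <;> omega⟩, by omega,
      by split_ifs <;> omega⟩, fun h1 h2 h3 => ?_, fun h => ?_⟩
    · rw [if_pos ⟨h3, h2, h1⟩] at hname
      exact ⟨by omega, by omega, by omega, hpost _ (by omega)⟩
    · rw [if_neg fun h' => h h'.2.2 h'.2.1 h'.1] at hname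
      exact ⟨by omega, by omega, by omega, by omega, hpost _ (by omega)⟩
  · intro τ hI _ hf
    refine ⟨by simp [hf.reg 15 (by decide)], hI.2.2.1, hI.2.2.2⟩

/-- Stable sorting by the key `e` of the item in register `16`. -/
def sortBy (e : Expr) : Prog := fill 4 e ;; countingSort

lemma sortBy_runs {α : Type*} [LinearOrder α] (e : Expr) (v : ℕ → ℕ) (f : ℕ → α) {σ : State}
    {m K : ℕ} (h10 : σ.reg 10 = m) (h11 : σ.reg 11 = K) (hord : SortedBy f m (σ.mem 5))
    (hv : ∀ j < m, v j ≤ K) (hmS : m ≤ S) (hKS : K < S) (hW : m + K + 2 < W)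
    (he : ∀ i < m, ∀ τ : State, τ.reg 16 = i → (∀ y, y ≠ 16 → τ.reg y = σ.reg y) →
      (∀ B, B ≠ 4 → τ.mem B = σ.mem B) → e.Safe W S τ ∧ e.eval τ = v i) :
    Runs W S (sortBy e) σ (m * (e.cost + 10) + 6 + 200 * (m + K + 1))
      fun τ => SortedBy (fun j => toLex (v j, f j)) m (τ.mem 5) := by
  refine Runs.seq _ _ (fill_runs 4 e v h10 hmS (by omega) he) ?_ le_rfl
  intro τ hτ hf
  have e10 := hf.reg 10 (by simp [fill, Prog.forTo, Prog.wregs])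
  have e11 := hf.reg 11 (by simp [fill, Prog.forTo, Prog.wregs])
  have m5 := hf.mem 5 (by simp [fill, Prog.forTo, Prog.wmems])
  refine (countingSort_runs f (e10.trans h10) (e11.trans h11) (by rw [m5]; exact hord)
    (fun j hj => by rw [hτ j hj]; exact hv j hj) hmS hKS hW).mono le_rfl ?_
  intro υ hυ _ _
  refine hυ.of_lt_imp fun x hx y hy hxy => ?_
  simpa only [hτ x hx, hτ y hy] using hxy

/-- Adds the reduced text to the stack of texts in the array `1`. The registers `2`, `3`, `4`
hold the address of the current text, its length and its level. -/
def downStep (d : ℕ) : Prog :=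
  samplePosProg ;; 11 ≔ .reg 3 + .const d ;; fill 5 (.reg 16) ;;
  sortBy (.load 1 (.reg 2 + .load 3 (.reg 16) + 2)) ;;
  sortBy (.load 1 (.reg 2 + .load 3 (.reg 16) + 1)) ;;
  sortBy (.load 1 (.reg 2 + .load 3 (.reg 16))) ;;
  nameTriples ;;
  2 ≔ .reg 15 ;; 3 ≔ .reg 10 ;; 4 ≔ .reg 4 + 1 ;; .store 2 (.reg 4) (.reg 3)

/-- Radix sort of the triples: three stable passes, starting with the last letter, give the
lexicographic order. The key bound `n + d` covers both the letters of the input and the names on the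
lower levels, which are at most the length of their text. -/
lemma downStep_runs {d : ℕ} {σ : State} {s : ℕ → ℕ} {n o l : ℕ} (h2 : σ.reg 2 = o)
    (h3 : σ.reg 3 = n) (h4 : σ.reg 4 = l) (hn : 2 ≤ n) (hd : ∀ j, s j ≤ n + d)
    (hs : ∀ j < n + 3, σ.mem 1 (o + j) = s j)
    (hS : o + 2 * n + d + 10 ≤ S) (hlS : l + 1 < S) (hW : S + 2 * n + d + 20 < W) :
    Runs W S (downStep d) σ (1500 * (n + d + 1)) fun τ =>
      τ.reg 2 = o + n + 3 ∧ τ.reg 3 = sampleLen n ∧ τ.reg 4 = l + 1 ∧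
      τ.mem 2 = Function.update (σ.mem 2) (l + 1) (sampleLen n) ∧
      (∀ i, i < o + n + 3 ∨ o + n + 3 + sampleLen n ≤ i → τ.mem 1 i = σ.mem 1 i) ∧
      ∃ s', IsReduction s n s' ∧ (∀ t, s' t ≤ sampleLen n) ∧
        ∀ t < sampleLen n, τ.mem 1 (o + n + 3 + t) = s' t := by
  have hl : sampleLen n < n := by unfold sampleLen; omega
  refine Runs.seq (30 * n + 40) (1460 * (n + d + 1) - 40) (samplePosProg_runs h3 (by omega)
    (by omega)) ?_ (by omega)
  rintro τ₁ ⟨-, a10, am3⟩ hf₁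
  have a2 := (hf₁.reg 2 (by decide)).trans h2
  have a3 := (hf₁.reg 3 (by decide)).trans h3
  have a4 := (hf₁.reg 4 (by decide)).trans h4
  have am1 := hf₁.mem 1 (by decide)
  have am2 := hf₁.mem 2 (by decide)
  refine Runs.seq 4 (1460 * (n + d + 1) - 44) (Q₁ := fun τ => τ = τ₁.setReg 11 (n + d))
    (Runs.of_vc le_rfl (by simp [Prog.vc, a3]; omega)) ?_ (by omega)
  rintro _ rfl -
  refine Runs.seq (11 * n + 6) (1440 * (n + d + 1) - 44) ((fill_runs 5 (.reg 16) (fun i => i)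
    (m := sampleLen n) (by simpa using a10) (by omega) (by omega)
    (fun i hi τ hi' _ _ => by simpa using hi')).mono (by simp; omega) fun τ h _ _ => h) ?_ (by omega)
  intro τ₂ hτ₂ hf₂
  -- The index is the last component of the sorting key; it keeps the order strict when triples
  -- coincide.
  have hord : SortedBy (fun j : ℕ => j) (sampleLen n) (τ₂.mem 5) :=
    SortedBy.congr (A := fun i => i) ⟨fun a ha => ha, fun a b h _ => h⟩ hτ₂
  have b2 : τ₂.reg 2 = o := by simp [hf₂.reg 2 (by decide), a2]
  have b3 : τ₂.reg 3 = n := by simp [hf₂.reg 3 (by decide), a3]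
  have b4 : τ₂.reg 4 = l := by simp [hf₂.reg 4 (by decide), a4]
  have b10 : τ₂.reg 10 = sampleLen n := by simp [hf₂.reg 10 (by decide), a10]
  have b11 : τ₂.reg 11 = n + d := by simp [hf₂.reg 11 (by decide)]
  have bm1 : τ₂.mem 1 = σ.mem 1 := by simp [hf₂.mem 1 (by decide), am1]
  have bm2 : τ₂.mem 2 = σ.mem 2 := by simp [hf₂.mem 2 (by decide), am2]
  have bm3 : ∀ t < sampleLen n, τ₂.mem 3 t = samplePos n t := by
    simpa [hf₂.mem 3 (by decide)] using am3
  refine Runs.seq (220 * n + 6 + 200 * (n + d + 1)) (1010 * (n + d + 1) - 60) ((sortBy_runs _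
    (fun t => s (samplePos n t + 2)) _ b10 b11 hord (fun j _ => hd _) (by omega)
    (by omega) (by omega) ?_).mono (by simp; omega) fun τ h _ _ => h) ?_ (by omega)
  · intro i hi τ e16 er em
    have hp := samplePos_le hi
    have := hs (samplePos n i + 2) (by omega)
    rw [← add_assoc] at this
    simp [e16, er 2 (by decide), b2, em 3 (by decide), bm3 i hi, em 1 (by decide), bm1, this]
    omega
  intro τ₃ hord₃ hf₃
  have c2 := (hf₃.reg 2 (by decide)).trans b2
  have c3 := (hf₃.reg 3 (by decide)).trans b3
  have c4 := (hf₃.reg 4 (by decide)).trans b4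
  have c10 := (hf₃.reg 10 (by decide)).trans b10
  have c11 := (hf₃.reg 11 (by decide)).trans b11
  have cm1 := (hf₃.mem 1 (by decide)).trans bm1
  have cm2 := (hf₃.mem 2 (by decide)).trans bm2
  have cm3 : ∀ t < sampleLen n, τ₃.mem 3 t = samplePos n t := by
    rw [hf₃.mem 3 (by decide)]; exact bm3
  refine Runs.seq (220 * n + 6 + 200 * (n + d + 1)) (580 * (n + d + 1) - 60) ((sortBy_runs _
    (fun t => s (samplePos n t + 1)) _ c10 c11 hord₃ (fun j _ => hd _) (by omega)
    (by omega) (by omega) ?_).mono (by simp; omega) fun τ h _ _ => h) ?_ (by omega)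
  · intro i hi τ e16 er em
    have hp := samplePos_le hi
    have := hs (samplePos n i + 1) (by omega)
    rw [← add_assoc] at this
    simp [e16, er 2 (by decide), c2, em 3 (by decide), cm3 i hi, em 1 (by decide), cm1, this]
    omega
  intro τ₄ hord₄ hf₄
  have e2 := (hf₄.reg 2 (by decide)).trans c2
  have e3 := (hf₄.reg 3 (by decide)).trans c3
  have e4 := (hf₄.reg 4 (by decide)).trans c4
  have e10 := (hf₄.reg 10 (by decide)).trans c10
  have e11 := (hf₄.reg 11 (by decide)).trans c11
  have em1 := (hf₄.mem 1 (by decide)).trans cm1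
  have em2 := (hf₄.mem 2 (by decide)).trans cm2
  have em3 : ∀ t < sampleLen n, τ₄.mem 3 t = samplePos n t := by
    rw [hf₄.mem 3 (by decide)]; exact cm3
  refine Runs.seq (220 * n + 6 + 200 * (n + d + 1)) (150 * (n + d + 1) - 60) ((sortBy_runs _
    (fun t => s (samplePos n t)) _ e10 e11 hord₄ (fun j _ => hd _) (by omega)
    (by omega) (by omega) ?_).mono (by simp; omega) fun τ h _ _ => h) ?_ (by omega)
  · intro i hi τ e16 er em
    have hp := samplePos_le hi
    have := hs (samplePos n i) (by omega)
    simp [e16, er 2 (by decide), e2, em 3 (by decide), em3 i hi, em 1 (by decide), em1, this]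
    omega
  intro τ₅ hord₅ hf₅
  have g2 := (hf₅.reg 2 (by decide)).trans e2
  have g3 := (hf₅.reg 3 (by decide)).trans e3
  have g4 := (hf₅.reg 4 (by decide)).trans e4
  have g10 := (hf₅.reg 10 (by decide)).trans e10
  have g11 := (hf₅.reg 11 (by decide)).trans e11
  have gm1 := (hf₅.mem 1 (by decide)).trans em1
  have gm2 := (hf₅.mem 2 (by decide)).trans em2
  have gm3 : ∀ t < sampleLen n, τ₅.mem 3 t = samplePos n t := by
    rw [hf₅.mem 3 (by decide)]; exact em3
  refine Runs.seq (60 * n + 40) 30 (nameTriples_runs (A := τ₅.mem 5) g2 g3 g10 hn gm3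
    (by rw [gm1]; exact hs) (fun _ _ => rfl) hord₅.lt (fun a ha b hb => hord₅.inj ha hb)
    (by omega) (by omega)) ?_ (by omega)
  rintro τ₆ ⟨k15, kname, kframe⟩ hf₆
  have k10 := (hf₆.reg 10 (by decide)).trans g10
  have k4 := (hf₆.reg 4 (by decide)).trans g4
  have km2 := (hf₆.mem 2 (by decide)).trans gm2
  refine Runs.of_vc (by decide) ?_
  simp only [Prog.vc]
  simp [k15, k10, k4, km2]
  refine ⟨by omega, by omega, fun i hi => ?_, ?_⟩
  · rw [kframe i (by omega), gm1]
  set A := τ₅.mem 5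
  -- Without the index as tie-breaker, strict inequality of the keys becomes weak inequality of the
  -- triples.
  have hmono : ∀ a b, a ≤ b → b < sampleLen n →
      triple s (samplePos n (A a)) ≤ triple s (samplePos n (A b)) := by
    intro a b hab hb
    rcases hab.lt_or_eq with hab | rfl
    · have := hord₅.mono a b hab hb
      simp only [triple, Prod.Lex.toLex_lt_toLex, Prod.Lex.toLex_le_toLex] at this ⊢
      omega
    · exact le_rfl
  have hlt : ∀ a < sampleLen n, ∀ b < sampleLen n, tripleName s n A a < tripleName s n A b ↔
      triple s (samplePos n (A a)) < triple s (samplePos n (A b)) := by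
    intro a ha b hb
    rw [← count_ne_lt_iff (g := fun i => triple s (samplePos n (A i))) hmono ha hb]
    exact Nat.add_lt_add_iff_left
  refine ⟨fun t => if t < sampleLen n then τ₆.mem 1 (o + n + 3 + t) else 0,
    ⟨⟨?_, ?_⟩, ?_⟩, ?_, fun t ht => (if_pos ht).symm⟩
  · intro t ht
    obtain ⟨a, ha, rfl⟩ := hord₅.surj ht
    rw [if_pos ht, kname a ha, tripleName]
    omega
  · exact fun t ht => if_neg (by omega)
  · intro t ht u hu
    obtain ⟨a, ha, rfl⟩ := hord₅.surj ht
    obtain ⟨b, hb, rfl⟩ := hord₅.surj hu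
    rw [if_pos ht, if_pos hu, kname a ha, kname b hb]
    exact hlt a ha b hb
  · intro t
    beta_reduce
    split_ifs with ht
    · obtain ⟨a, ha, rfl⟩ := hord₅.surj ht
      rw [kname a ha, tripleName]
      have := Nat.count_le (fun i => triple s (samplePos n (A i)) ≠
        triple s (samplePos n (A (i + 1)))) (n := a)
      omega
    · omega

end WordRAM


/-! ### Ranks of the sample suffixes -/

namespace Suffix

variable {s s' : ℕ → ℕ} {n : ℕ}

/-- The converse of `IsReduction.sfx_lt` follows by trichotomy, because different sample positions
have different suffixes. This includes the position `n`, which occurs at most once and is the only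
empty one. -/
lemma IsReduction.sfx_lt_iff (h : IsReduction s n s') (hs : IsText s n) {t u : ℕ}
    (ht : t < sampleLen n) (hu : u < sampleLen n) :
    sfx s' t < sfx s' u ↔ sfx s (samplePos n t) < sfx s (samplePos n u) := by
  refine ⟨fun htu => ?_, h.sfx_lt hs ht⟩
  rcases lt_trichotomy (sfx s (samplePos n t)) (sfx s (samplePos n u)) with h' | h' | h'
  · exact h'
  · have : t = u := by
      have h1 := samplePos_le ht
      have h2 := samplePos_le hu
      apply samplePos_inj (n := n)
      rcases h1.lt_or_eq with h1 | h1
      · exact hs.sfx_injective h1 h'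
      · rcases h2.lt_or_eq with h2 | h2
        · exact (hs.sfx_injective h2 h'.symm).symm
        · omega
    subst this; exact absurd htu (lt_irrefl _)
  · exact absurd htu (h.sfx_lt hs hu h').not_gt

/-- The ranks of the suffixes at positions that are not divisible by three. -/
structure IsSampleRank (s : ℕ → ℕ) (n : ℕ) (R : ℕ → ℕ) : Prop where
  lt_iff : ∀ x < n + 3, ∀ y < n + 3, x % 3 ≠ 0 → y % 3 ≠ 0 → (R x < R y ↔ sfx s x < sfx s y)
  le : ∀ x < n + 3, x % 3 ≠ 0 → R x ≤ n

/-- The ranks inside the text start at `1`. The positions `n`, `n + 1`, `n + 2`, which comparisons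
may look at, share the rank `0` of the empty suffix. -/
lemma isSampleRank {A R : ℕ → ℕ} (h : IsReduction s n s') (hs : IsText s n)
    (hA : WordRAM.SortedBy (sfx s') (sampleLen n) A)
    (hR : ∀ j < sampleLen n, samplePos n (A j) < n → R (samplePos n (A j)) = j + 1)
    (hR0 : ∀ x, n ≤ x → x < n + 3 → R x = 0) : IsSampleRank s n R := by
  have key : ∀ x < n, x % 3 ≠ 0 → ∃ j < sampleLen n, samplePos n (A j) = x ∧ R x = j + 1 := by
    intro x hx hx3
    obtain ⟨t, ht, rfl⟩ := exists_samplePos hx hx3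
    obtain ⟨j, hj, rfl⟩ := hA.surj ht
    exact ⟨j, hj, rfl, hR j hj hx⟩
  constructor
  · intro x hx y hy hx3 hy3
    by_cases hxn : x < n
    · obtain ⟨j, hj, rfl, h1⟩ := key x hxn hx3
      by_cases hyn : y < n
      · obtain ⟨i, hi, rfl, h2⟩ := key y hyn hy3
        rw [h1, h2, ← h.sfx_lt_iff hs (hA.lt j hj) (hA.lt i hi)]
        exact Nat.add_lt_add_iff_right.trans (hA.lt_iff hj hi).symm
      · rw [hR0 y (by omega) hy]
        exact iff_of_false (by omega) (hs.sfx_lt_of_le hxn (by omega)).not_gt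
    · rw [hR0 x (by omega) hx]
      by_cases hyn : y < n
      · obtain ⟨i, hi, rfl, h2⟩ := key y hyn hy3
        exact iff_of_true (by omega) (hs.sfx_lt_of_le hyn (by omega))
      · rw [hR0 y (by omega) hy, hs.sfx_eq_of_le (i := x) (j := y) (by omega) (by omega)]
        exact iff_of_false (lt_irrefl _) (lt_irrefl _)
  · intro x hx hx3
    by_cases hxn : x < n
    · obtain ⟨j, hj, _, h1⟩ := key x hxn hx3
      unfold sampleLen at hj; omega
    · rw [hR0 x (by omega) hx]; omega

/-- The number of sample positions that lie behind the text. -/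
def extra (n : ℕ) : ℕ := if n % 3 = 1 then 1 else 0

lemma extra_spec : (n + 2) / 3 + (sampleLen n - extra n) = n ∧ extra n ≤ sampleLen n := by
  unfold extra sampleLen; split_ifs <;> omega

/-- A sample position behind the text has the empty suffix, which is the smallest. It therefore
comes first in the enumeration and is skipped by starting at `extra n`. -/
lemma samplePos_lt_of_extra {A : ℕ → ℕ} (h : IsReduction s n s') (hs : IsText s n)
    (hA : WordRAM.SortedBy (sfx s') (sampleLen n) A) {j : ℕ} (hj : j < sampleLen n)
    (hj' : extra n ≤ j) : samplePos n (A j) < n := by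
  have h1 := samplePos_le (hA.lt j hj)
  refine lt_of_le_of_ne h1 fun he => ?_
  have hn : n % 3 = 1 := by
    have := he; unfold samplePos at this
    have := hA.lt j hj; unfold sampleLen at this
    split_ifs at * <;> omega
  rw [extra, if_pos hn] at hj'
  have h0 : samplePos n (A 0) < n := by
    refine lt_of_le_of_ne (samplePos_le (hA.lt 0 (by omega))) fun he' => ?_
    have := hA.inj (by omega) hj (samplePos_inj (he'.trans he.symm))
    omega
  have h2 := hA.mono 0 j (by omega) hj
  rw [h.sfx_lt_iff hs (hA.lt 0 (by omega)) (hA.lt j hj)] at h2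
  exact absurd h2 (hs.sfx_lt_of_le h0 he.ge).not_gt

end Suffix

namespace WordRAM
open Suffix

variable {W S : ℕ}

/-! ### The ascent from a reduced text -/

/-- Lists the sample suffixes in their order in the array `9` and their ranks in the array `8`. -/
def rankSample : Prog :=
  .forTo 16 (.reg 10) (18 ≔ .load 3 (.load 5 (.reg 16)) ;; .store 9 (.reg 16) (.reg 18) ;;
    .store 8 (.reg 18) (.reg 16 + 1)) ;;
  .store 8 (.reg 3) 0 ;; .store 8 (.reg 3 + 1) 0 ;; .store 8 (.reg 3 + 2) 0

/-- The final three stores install the rank `0` behind the text. They also overwrite the rank that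
the loop gives to the position `n` when this is a sample position. -/
lemma rankSample_runs {σ : State} {s s' A : ℕ → ℕ} {n : ℕ} (h3 : σ.reg 3 = n)
    (h10 : σ.reg 10 = sampleLen n) (hpos : ∀ t < sampleLen n, σ.mem 3 t = samplePos n t)
    (hA : SortedBy (sfx s') (sampleLen n) A) (h5 : σ.mem 5 = A) (ht : IsText s n)
    (hr : IsReduction s n s') (hS : n + 3 < S) (hW : n + 3 < W) :
    Runs W S rankSample σ (30 * n + 30) fun τ => IsSampleRank s n (τ.mem 8) ∧
      ∀ j < sampleLen n, τ.mem 9 j = samplePos n (A j) := by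
  have hl : sampleLen n ≤ n := by unfold sampleLen; omega
  refine Runs.seq (30 * n + 10) 20
    (Q₁ := fun τ => (∀ j < sampleLen n, τ.mem 8 (samplePos n (A j)) = j + 1) ∧
      ∀ j < sampleLen n, τ.mem 9 j = samplePos n (A j)) ?_ ?_ (by omega)
  · refine Runs.forTo (sampleLen n) (fun i τ => (∀ j < i, τ.mem 8 (samplePos n (A j)) = j + 1) ∧
      ∀ j < i, τ.mem 9 j = samplePos n (A j)) 15 (by decide) (by omega) (by simp) ?_ ?_
      (by simp; omega) ?_
    · intro τ hf
      simp [hf.reg 10 (by decide), h10]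
    · rintro i hi τ ⟨hI1, hI2⟩ hx hf
      have m5 := (hf.mem 5 (by decide)).trans h5
      have hAi := hA.lt i hi
      have m3 : τ.mem 3 (A i) = samplePos n (A i) := by
        rw [hf.mem 3 (by decide)]; exact hpos _ hAi
      have hp := samplePos_le hAi
      refine Runs.of_vc (by decide) ?_
      simp only [Prog.vc]
      simp [hx, m5, m3, Function.update_apply]
      refine ⟨by omega, by omega, by omega, by omega, fun j hj => ?_, fun j hj => ?_⟩
      · split_ifs with h
        · rw [hA.inj (by omega) hi (samplePos_inj h)]
        · refine hI1 j (lt_of_le_of_ne hj ?_)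
          rintro rfl; exact h rfl
      · split_ifs with h
        · rw [h]
        · exact hI2 j (by omega)
    · exact fun τ hI _ _ => hI
  · rintro τ ⟨hI1, hI2⟩ hf
    have e3 := (hf.reg 3 (by decide)).trans h3
    refine Runs.of_vc (by decide) ?_
    simp only [Prog.vc]
    simp [e3]
    refine ⟨by omega, by omega, by omega, by omega, by omega, by omega, by omega, by omega, isSampleRank hr ht hA ?_ ?_, hI2⟩
    · intro j hj hjn
      simp only [Function.update_apply]
      rw [if_neg (by omega), if_neg (by omega), if_neg (by omega)]
      exact hI1 j hj
    · intro x hx hx'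
      simp only [Function.update_apply]
      split_ifs <;> first | rfl | omega

/-- Compares the suffixes at the positions in the registers `19` and `20`, where the former is
divisible by three and the latter is not. The result is in register `21`. -/
def compareSuffixes : Prog :=
  .cond (.eq (.load 1 (.reg 2 + .reg 19)) (.load 1 (.reg 2 + .reg 20)))
    (.cond (.eq (.reg 20 % 3) 1) (21 ≔ .lt (.load 8 (.reg 19 + 1)) (.load 8 (.reg 20 + 1)))
      (.cond (.eq (.load 1 (.reg 2 + .reg 19 + 1)) (.load 1 (.reg 2 + .reg 20 + 1)))
        (21 ≔ .lt (.load 8 (.reg 19 + 2)) (.load 8 (.reg 20 + 2)))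
        (21 ≔ .lt (.load 1 (.reg 2 + .reg 19 + 1)) (.load 1 (.reg 2 + .reg 20 + 1)))))
    (21 ≔ .lt (.load 1 (.reg 2 + .reg 19)) (.load 1 (.reg 2 + .reg 20)))

/-- One or two letters are compared until both positions have become sample positions, where ranks
decide. If `p` is congruent to `1`, one step leads to the residues `1` and `2`; if `p` is congruent
to `2`, two steps lead to `2` and `1`. -/
lemma compareSuffixes_vc {σ : State} {s : ℕ → ℕ} {n o p q : ℕ} (h2 : σ.reg 2 = o)
    (hq : σ.reg 19 = q) (hp : σ.reg 20 = p) (hqn : q < n) (hpn : p < n) (hq3 : q % 3 = 0)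
    (hs : ∀ j < n + 3, σ.mem 1 (o + j) = s j)
    (hR : IsSampleRank s n (σ.mem 8)) (hS : o + n + 3 < S) (hW : o + n + 3 < W)
    {Q : State → Prop} (hQ : ∀ v, (v ≠ 0 ↔ sfx s q < sfx s p) → Q (σ.setReg 21 v)) :
    compareSuffixes.vc W S σ Q := by
  have a0 := hs q (by omega)
  have a1 := hs (q + 1) (by omega)
  have b0 := hs p (by omega)
  have b1 := hs (p + 1) (by omega)
  simp only [← add_assoc] at a1 b1
  simp only [compareSuffixes, Prog.vc]
  simp [h2, hq, hp, a0, b0, a1, b1]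
  refine ⟨by omega, fun h0 => ⟨by omega, fun h1 => ⟨by omega, ?_⟩, fun h1 => ⟨by omega,
    fun h3 => ⟨by omega, ?_⟩, fun h3 => ⟨by omega, ?_⟩⟩⟩, fun h0 => ⟨by omega, ?_⟩⟩
  · refine hQ _ ?_
    rw [sfx_lt_succ,
      ← hR.lt_iff (q + 1) (by omega) (p + 1) (by omega) (by omega) (by omega)]
    simp [h0]
  · refine hQ _ ?_
    rw [sfx_lt_succ, sfx_lt_succ (i := q + 1),
      ← hR.lt_iff (q + 1 + 1) (by omega) (p + 1 + 1) (by omega) (by omega) (by omega)]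
    simp [h0, h3]
  · refine hQ _ ?_
    rw [sfx_lt_succ, sfx_lt_succ (i := q + 1)]
    simp [h0, h3]
  · refine hQ _ ?_
    rw [sfx_lt_succ]
    simp [h0]

/-- Merges the sorted lists of suffixes in the arrays `5` (positions divided by three) and `9`
into the array `6`. -/
def mergeSuffixes : Prog :=
  17 ≔ 0 ;; 18 ≔ Expr.eq (.reg 3 % 3) 1 ;;
  .forTo 16 (.reg 3)
    (.cond (.lt (.reg 18) (.reg 6))
        (.cond (.lt (.reg 17) (.reg 5))
          (19 ≔ 3 * .load 5 (.reg 17) ;; 20 ≔ .load 9 (.reg 18) ;; compareSuffixes)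
          (21 ≔ 0))
        (21 ≔ 1) ;;
      .cond (.reg 21) (.store 6 (.reg 16) (3 * .load 5 (.reg 17)) ;; 17 ≔ .reg 17 + 1)
        (.store 6 (.reg 16) (.load 9 (.reg 18)) ;; 18 ≔ .reg 18 + 1))

/-- The usual merge: everything written so far precedes the next candidate of either list. Ties
cannot occur, since the two lists contain different residues modulo three. -/
lemma mergeSuffixes_runs {σ : State} {s P A : ℕ → ℕ} {n o : ℕ} (h2 : σ.reg 2 = o)
    (h3 : σ.reg 3 = n) (h5 : σ.reg 5 = (n + 2) / 3) (h6 : σ.reg 6 = sampleLen n)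
    (hs : ∀ j < n + 3, σ.mem 1 (o + j) = s j) (ht : IsText s n)
    (hR : IsSampleRank s n (σ.mem 8))
    (hA : ∀ a < (n + 2) / 3, σ.mem 5 a = A a) (hA' : ∀ a < (n + 2) / 3, A a < (n + 2) / 3)
    (hAs : ∀ a < (n + 2) / 3, a + 1 < (n + 2) / 3 → sfx s (3 * A a) < sfx s (3 * A (a + 1)))
    (hP : ∀ b < sampleLen n, σ.mem 9 b = P b)
    (hP' : ∀ b < sampleLen n, extra n ≤ b → P b < n ∧ P b % 3 ≠ 0)
    (hPs : ∀ b < sampleLen n, extra n ≤ b → b + 1 < sampleLen n → sfx s (P b) < sfx s (P (b + 1)))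
    (hS : o + n + 3 < S) (hW : o + n + 3 < W) :
    Runs W S mergeSuffixes σ (100 * n + 30) fun τ => SortedBy (sfx s) n (τ.mem 6) := by
  have hl : sampleLen n ≤ n := by unfold sampleLen; omega
  obtain ⟨hx1, hx2⟩ := extra_spec (n := n)
  refine Runs.seq 2 (100 * n + 28) (Q₁ := fun τ => τ = σ.setReg 17 0)
    (Runs.of_vc (by decide) (by simp [Prog.vc]; omega)) ?_ (by omega)
  rintro _ rfl -
  refine Runs.seq 10 (100 * n + 15) (Q₁ := fun τ => τ = (σ.setReg 17 0).setReg 18 (extra n))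
    (Runs.of_vc (by decide) (by simp [Prog.vc, h3, extra]; omega)) ?_ (by omega)
  rintro _ rfl -
  -- The second list is read from `extra n` on, which omits the empty suffix; hence the shift in `a
  -- + b = i + extra n`.
  refine Runs.forTo n (fun i τ => ∃ a b, τ.reg 17 = a ∧ τ.reg 18 = b ∧ a ≤ (n + 2) / 3 ∧
      extra n ≤ b ∧ b ≤ sampleLen n ∧ a + b = i + extra n ∧
      (∀ c < i, τ.mem 6 c < n) ∧
      (∀ c' < i, ∀ c < c', sfx s (τ.mem 6 c) < sfx s (τ.mem 6 c')) ∧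
      (a < (n + 2) / 3 → ∀ c < i, sfx s (τ.mem 6 c) < sfx s (3 * A a)) ∧
      (b < sampleLen n → ∀ c < i, sfx s (τ.mem 6 c) < sfx s (P b))) 85
    (by decide) (by omega) ⟨0, extra n, by simp; omega⟩ ?_ ?_ (by simp; omega) ?_
  · intro τ hf
    simp [hf.reg 3 (by decide), h3]
  · rintro i hi τ ⟨a, b, r17, r18, ha, hb1, hb2, hab, hI1, hI2, hI3, hI4⟩ hx hf
    have r2 : τ.reg 2 = o := by simp [hf.reg 2 (by decide), h2]
    have r5 : τ.reg 5 = (n + 2) / 3 := by simp [hf.reg 5 (by decide), h5]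
    have r6 : τ.reg 6 = sampleLen n := by simp [hf.reg 6 (by decide), h6]
    have m1 : τ.mem 1 = σ.mem 1 := by simp [hf.mem 1 (by decide)]
    have m5 : ∀ a < (n + 2) / 3, τ.mem 5 a = A a := by simpa [hf.mem 5 (by decide)] using hA
    have m8 : τ.mem 8 = σ.mem 8 := by simp [hf.mem 8 (by decide)]
    have m9 : ∀ b < sampleLen n, τ.mem 9 b = P b := by simpa [hf.mem 9 (by decide)] using hP
    refine Runs.seq 60 25 (Q₁ := fun υ => τ.reg 16 = υ.reg 16 ∧ τ.reg 17 = υ.reg 17 ∧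
      τ.reg 18 = υ.reg 18 ∧ τ.mem = υ.mem ∧
      (υ.reg 21 ≠ 0 ∧ a < (n + 2) / 3 ∧ (b < sampleLen n → sfx s (3 * A a) < sfx s (P b)) ∨
        υ.reg 21 = 0 ∧ b < sampleLen n ∧ (a < (n + 2) / 3 → sfx s (P b) < sfx s (3 * A a))))
      ?_ ?_ le_rfl
    · refine Runs.of_vc (by decide) ?_
      simp only [Prog.vc]
      simp [r17, r18, r5, r6]
      refine ⟨fun hb => ⟨fun ha => ?_, fun ha => ?_⟩, fun hb => ?_⟩
      · have q1 := hA' a ha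
        obtain ⟨q2, q3⟩ := hP' b hb hb1
        refine ⟨by rw [m5 a ha]; omega, by omega, ?_⟩
        refine compareSuffixes_vc (s := s) (n := n) (o := o) (q := 3 * A a) (p := P b)
          (by simp [r2]) (by simp [m5 a ha]) (by simp [m9 b hb]) (by omega) q2 (by omega)
          (by simpa [m1] using hs) (by simpa [m8] using hR) hS hW fun v hv => ?_
        simp only [State.setReg_reg, State.setReg_mem]
        refine ⟨by simp, by simp [r17], by simp [r18], trivial, ?_⟩
        rcases lt_trichotomy (sfx s (3 * A a)) (sfx s (P b)) with h | h | h
        · exact Or.inl ⟨hv.2 h, ha, fun _ => h⟩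
        · have := ht.sfx_injective (by omega) h
          omega
        · exact Or.inr ⟨not_not.1 fun h0 => h.not_gt (hv.1 h0), hb, fun _ => h⟩
      · simp [hb, ha.not_gt]; omega
      · simp [hb.not_gt]; omega
    · rintro υ ⟨e16, e17, e18, em, hυ⟩ -
      refine Runs.of_vc (by decide) ?_
      simp only [Prog.vc]
      simp [← e16, ← e17, ← e18, ← em, r17, r18, hx]
      rcases hυ with ⟨e21, ha, hlt⟩ | ⟨e21, hb, hlt⟩
      · have q1 := hA' a ha
        refine ⟨fun _ => ?_, fun h => absurd h e21⟩
        rw [m5 a ha]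
        refine ⟨by omega, by omega, by omega, by omega, hb1, hb2, by omega, ?_⟩
        have hu : ∀ c ≤ i, Function.update (τ.mem 6) i (3 * A a) c =
            if c = i then 3 * A a else τ.mem 6 c := fun c _ => Function.update_apply ..
        refine ⟨fun c hc => ?_, fun c' hc' c hc => ?_, fun ha' c hc => ?_, fun hb c hc => ?_⟩
        · rw [hu c hc]; split_ifs <;> [omega; exact hI1 c (by omega)]
        · rw [hu c (by omega), hu c' hc', if_neg (by omega)]
          split_ifs <;> [exact hI3 ha c (by omega); exact hI2 c' (by omega) c hc]
        · rw [hu c hc]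
          split_ifs
          · exact hAs a ha ha'
          · exact (hI3 ha c (by omega)).trans (hAs a ha ha')
        · rw [hu c hc]
          split_ifs
          · exact hlt hb
          · exact (hI3 ha c (by omega)).trans (hlt hb)
      · refine ⟨fun h => absurd e21 h, fun _ => ?_⟩
        obtain ⟨q2, q3⟩ := hP' b hb hb1
        rw [m9 b hb]
        refine ⟨by omega, by omega, by omega, by omega, by omega, by omega, by omega, ?_⟩
        have hu : ∀ c ≤ i, Function.update (τ.mem 6) i (P b) c =
            if c = i then P b else τ.mem 6 c := fun c _ => Function.update_apply ..
        refine ⟨fun c hc => ?_, fun c' hc' c hc => ?_, fun ha c hc => ?_, fun hb' c hc => ?_⟩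
        · rw [hu c hc]; split_ifs <;> [omega; exact hI1 c (by omega)]
        · rw [hu c (by omega), hu c' hc', if_neg (by omega)]
          split_ifs <;> [exact hI4 hb c (by omega); exact hI2 c' (by omega) c hc]
        · rw [hu c hc]
          split_ifs
          · exact hlt ha
          · exact (hI4 hb c (by omega)).trans (hlt ha)
        · rw [hu c hc]
          split_ifs
          · exact hPs b hb hb1 hb'
          · exact (hI4 hb c (by omega)).trans (hPs b hb hb1 hb')
  · rintro τ ⟨a, b, -, -, -, -, -, -, hI1, hI2, -, -⟩ _ _
    exact ⟨hI1, fun c c' h h' => hI2 c' h' c h⟩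

end WordRAM


/-! ### The suffix array: one level of the ascent and the whole recursion -/

namespace WordRAM
open Suffix

variable {W S : ℕ}

/-- From the suffix order of the reduced text to that of the text, both in the array `5`. -/
def upStep (d : ℕ) : Prog :=
  samplePosProg ;; 11 ≔ .reg 3 + .const d ;; rankSample ;; 6 ≔ .reg 10 ;; 10 ≔ .reg 5 ;;
  fill 5 (.reg 16) ;; sortBy (.load 8 (3 * .reg 16 + 1)) ;;
  sortBy (.load 1 (.reg 2 + 3 * .reg 16)) ;; mergeSuffixes ;;
  10 ≔ .reg 3 ;; fill 5 (.load 6 (.reg 16))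

/-- The suffix at `3 * u` is determined by its first letter and by the suffix at `3 * u + 1`, whose
rank is known. Two stable passes, by this rank and then by the letter, sort these suffixes before
the merge. -/
lemma upStep_runs {d : ℕ} {σ : State} {s s' : ℕ → ℕ} {n o : ℕ} (h2 : σ.reg 2 = o)
    (h3 : σ.reg 3 = n) (ht : IsText s n) (hd : ∀ j, s j ≤ n + d)
    (hs : ∀ j < n + 3, σ.mem 1 (o + j) = s j) (hr : IsReduction s n s')
    (hA : SortedBy (sfx s') (sampleLen n) (σ.mem 5))
    (hS : o + 2 * n + d + 10 ≤ S) (hW : S + 2 * n + d + 20 < W) :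
    Runs W S (upStep d) σ (1500 * (n + d + 1)) fun τ => SortedBy (sfx s) n (τ.mem 5) := by
  have hl : sampleLen n ≤ n := by unfold sampleLen; omega
  have hm : (n + 2) / 3 ≤ n := by omega
  refine Runs.seq (30 * n + 40) (1460 * (n + d + 1) - 40) (samplePosProg_runs h3 (by omega)
    (by omega)) ?_ (by omega)
  rintro τ₁ ⟨a5, a10, am3⟩ hf₁
  have a2 := (hf₁.reg 2 (by decide)).trans h2
  have a3 := (hf₁.reg 3 (by decide)).trans h3
  have am1 := hf₁.mem 1 (by decide)
  have am5 := hf₁.mem 5 (by decide)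
  refine Runs.seq 4 (1460 * (n + d + 1) - 44) (Q₁ := fun τ => τ = τ₁.setReg 11 (n + d))
    (Runs.of_vc le_rfl (by simp [Prog.vc, a3]; omega)) ?_ (by omega)
  rintro _ rfl -
  refine Runs.seq (30 * n + 30) (1420 * (n + d + 1) - 44) (rankSample_runs (A := σ.mem 5)
    (s := s) (s' := s') (by simpa using a3) (by simpa using a10) (by simpa using am3) hA
    (by simpa using am5) ht hr (by omega) (by omega)) ?_ (by omega)
  rintro τ₂ ⟨hR, hP⟩ hf₂
  have b2 : τ₂.reg 2 = o := by simp [hf₂.reg 2 (by decide), a2]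
  have b3 : τ₂.reg 3 = n := by simp [hf₂.reg 3 (by decide), a3]
  have b5 : τ₂.reg 5 = (n + 2) / 3 := by simp [hf₂.reg 5 (by decide), a5]
  have b10 : τ₂.reg 10 = sampleLen n := by simp [hf₂.reg 10 (by decide), a10]
  have b11 : τ₂.reg 11 = n + d := by simp [hf₂.reg 11 (by decide)]
  have bm1 : τ₂.mem 1 = σ.mem 1 := by simp [hf₂.mem 1 (by decide), am1]
  refine Runs.seq 2 (1420 * (n + d + 1) - 46) (Q₁ := fun τ => τ = τ₂.setReg 6 (sampleLen n))
    (Runs.of_vc le_rfl (by simp [Prog.vc, b10])) ?_ (by omega)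
  rintro _ rfl -
  refine Runs.seq 2 (1420 * (n + d + 1) - 48)
    (Q₁ := fun τ => τ = (τ₂.setReg 6 (sampleLen n)).setReg 10 ((n + 2) / 3))
    (Runs.of_vc le_rfl (by simp [Prog.vc, b5])) ?_ (by omega)
  rintro _ rfl -
  refine Runs.seq (11 * n + 6) (1400 * (n + d + 1) - 48) ((fill_runs 5 (.reg 16) (fun i => i)
    (m := (n + 2) / 3) (by simp) (by omega) (by omega)
    (fun i hi τ hi' _ _ => by simpa using hi')).mono (by simp; omega) fun τ h _ _ => h) ?_
    (by omega)
  intro τ₃ hτ₃ hf₃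
  have hord : SortedBy (fun j : ℕ => j) ((n + 2) / 3) (τ₃.mem 5) :=
    SortedBy.congr (A := fun i => i) ⟨fun a ha => ha, fun a b h _ => h⟩ hτ₃
  have c2 : τ₃.reg 2 = o := by simp [hf₃.reg 2 (by decide), b2]
  have c3 : τ₃.reg 3 = n := by simp [hf₃.reg 3 (by decide), b3]
  have c5 : τ₃.reg 5 = (n + 2) / 3 := by simp [hf₃.reg 5 (by decide), b5]
  have c6 : τ₃.reg 6 = sampleLen n := by simp [hf₃.reg 6 (by decide)]
  have c10 : τ₃.reg 10 = (n + 2) / 3 := by simp [hf₃.reg 10 (by decide)]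
  have c11 : τ₃.reg 11 = n + d := by simp [hf₃.reg 11 (by decide), b11]
  have cm1 : τ₃.mem 1 = σ.mem 1 := by simp [hf₃.mem 1 (by decide), bm1]
  have cm8 : τ₃.mem 8 = τ₂.mem 8 := by simp [hf₃.mem 8 (by decide)]
  have cm9 : τ₃.mem 9 = τ₂.mem 9 := by simp [hf₃.mem 9 (by decide)]
  refine Runs.seq (220 * n + 6 + 200 * (n + d + 1)) (980 * (n + d + 1) - 48) ((sortBy_runs _
    (fun u => τ₂.mem 8 (3 * u + 1)) _ c10 c11 hord
    (fun u hu => (hR.le (3 * u + 1) (by omega) (by omega)).trans (by omega)) (by omega)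
    (by omega) (by omega) ?_).mono (by simp; omega) fun τ h _ _ => h) ?_ (by omega)
  · intro i hi τ e16 er em
    simp [e16, em 8 (by decide), cm8]
    omega
  intro τ₄ hord₄ hf₄
  have d2 := (hf₄.reg 2 (by decide)).trans c2
  have d3 := (hf₄.reg 3 (by decide)).trans c3
  have d5 := (hf₄.reg 5 (by decide)).trans c5
  have d6 := (hf₄.reg 6 (by decide)).trans c6
  have d10 := (hf₄.reg 10 (by decide)).trans c10
  have d11 := (hf₄.reg 11 (by decide)).trans c11
  have dm1 := (hf₄.mem 1 (by decide)).trans cm1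
  have dm8 := (hf₄.mem 8 (by decide)).trans cm8
  have dm9 := (hf₄.mem 9 (by decide)).trans cm9
  refine Runs.seq (220 * n + 6 + 200 * (n + d + 1)) (550 * (n + d + 1) - 48) ((sortBy_runs _
    (fun u => s (3 * u)) _ d10 d11 hord₄ (fun u _ => hd _) (by omega)
    (by omega) (by omega) ?_).mono (by simp; omega) fun τ h _ _ => h) ?_ (by omega)
  · intro i hi τ e16 er em
    have := hs (3 * i) (by omega)
    simp [e16, em 1 (by decide), dm1, er 2 (by decide), d2, this]
    omega
  intro τ₅ hord₅ hf₅
  have e2 := (hf₅.reg 2 (by decide)).trans d2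
  have e3 := (hf₅.reg 3 (by decide)).trans d3
  have e5 := (hf₅.reg 5 (by decide)).trans d5
  have e6 := (hf₅.reg 6 (by decide)).trans d6
  have em1 := (hf₅.mem 1 (by decide)).trans dm1
  have em8 := (hf₅.mem 8 (by decide)).trans dm8
  have em9 := (hf₅.mem 9 (by decide)).trans dm9
  have hord₆ : SortedBy (fun u => sfx s (3 * u)) ((n + 2) / 3) (τ₅.mem 5) := by
    refine hord₅.of_lt_imp fun x hx y hy hxy => ?_
    have hlt := hR.lt_iff (3 * x + 1) (by omega) (3 * y + 1) (by omega) (by omega) (by omega)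
    have hgt := hR.lt_iff (3 * y + 1) (by omega) (3 * x + 1) (by omega) (by omega) (by omega)
    simp only [Prod.Lex.toLex_lt_toLex] at hxy
    rw [sfx_lt_succ, ← hlt]
    rcases hxy with h | ⟨h, h' | ⟨h', h''⟩⟩
    · exact Or.inl h
    · exact Or.inr ⟨h, h'⟩
    -- Equal ranks mean equal suffixes at `3 * x + 1` and `3 * y + 1`. Since `x < y`, the first of
    -- these positions lies inside the text, so injectivity gives `x = y`.
    · exfalso
      rw [h'] at hlt hgt
      have : sfx s (3 * x + 1) = sfx s (3 * y + 1) := by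
        refine le_antisymm (not_lt.1 fun h => ?_) (not_lt.1 fun h => ?_)
        · exact lt_irrefl _ (hgt.2 h)
        · exact lt_irrefl _ (hlt.2 h)
      by_cases hxn : 3 * x + 1 < n
      · have := ht.sfx_injective hxn this
        omega
      · omega
  refine Runs.seq (100 * n + 30) (30 * n + 20) (mergeSuffixes_runs (s := s) (o := o)
    (A := τ₅.mem 5) (P := fun j => samplePos n (σ.mem 5 j)) e2 e3 e5 e6 (by rw [em1]; exact hs)
    ht (by rw [em8]; exact hR) (fun _ _ => rfl) hord₆.lt
    (fun a _ h => hord₆.mono a (a + 1) (by omega) h) (by rw [em9]; exact hP)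
    (fun b hb hb' => ⟨samplePos_lt_of_extra hr ht hA hb hb', samplePos_mod _⟩)
    (fun b hb _ hb' => (hr.sfx_lt_iff ht (hA.lt b hb) (hA.lt _ hb')).1
      (hA.mono b (b + 1) (by omega) hb')) (by omega) (by omega)) ?_ (by omega)
  intro τ₆ hτ₆ hf₆
  have k3 := (hf₆.reg 3 (by decide)).trans e3
  refine Runs.seq 2 (30 * n + 18) (Q₁ := fun τ => τ = τ₆.setReg 10 n)
    (Runs.of_vc le_rfl (by simp [Prog.vc, k3])) ?_ (by omega)
  rintro _ rfl -
  refine (fill_runs 5 (.load 6 (.reg 16)) (τ₆.mem 6) (m := n) (by simp) (by omega)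
    (by omega) ?_).mono (by simp; omega) fun τ h _ _ => hτ₆.congr h
  intro i hi τ e16 _ em
  simp [e16, em 6 (by decide)]
  omega

/-- The length of the text on level `l`. -/
def levelLen (n l : ℕ) : ℕ := sampleLen^[l] n

/-- The address of the text on level `l`. -/
def levelOff (n : ℕ) : ℕ → ℕ
  | 0 => 0
  | l + 1 => levelOff n l + levelLen n l + 3

lemma levelLen_succ (n l : ℕ) : levelLen n (l + 1) = sampleLen (levelLen n l) :=
  Function.iterate_succ_apply' _ _ _

/-- The ratio tends to `2/3`, but rounding makes `3/4` necessary: equality holds for `n = 4`. Any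
fixed ratio below `1` makes the sum over all levels a geometric series. -/
lemma four_mul_sampleLen_le {n : ℕ} (hn : 2 ≤ n) : 4 * sampleLen n ≤ 3 * n := by
  unfold sampleLen
  by_cases h : 8 ≤ n
  · omega
  · interval_cases n <;> simp

lemma exists_levels (n : ℕ) : ∃ L, levelLen n L ≤ 1 ∧ ∀ l < L, 2 ≤ levelLen n l := by
  have : ∃ L, levelLen n L ≤ 1 := by
    have H : ∀ m l, levelLen n l ≤ m → ∃ L, levelLen n L ≤ 1 := by
      intro m
      induction m with
      | zero => exact fun l hl => ⟨l, by omega⟩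
      | succ m ih =>
        intro l hl
        by_cases h : levelLen n l ≤ 1
        · exact ⟨l, h⟩
        · have := four_mul_sampleLen_le (n := levelLen n l) (by omega)
          exact ih (l + 1) (by rw [levelLen_succ]; omega)
    exact H _ 0 le_rfl
  classical
  refine ⟨Nat.find this, Nat.find_spec this, fun l hl => ?_⟩
  have := Nat.find_min this hl
  omega

/-- A step adds `levelLen n l + 3` to the address and lowers `12 * levelLen n l` by at least `3 *
levelLen n l`. The latter is larger because the length is at least `2`. So the whole stack of texts
fits into linear space. -/
lemma level_bounds {n L : ℕ} (hL : ∀ l < L, 2 ≤ levelLen n l) {l : ℕ} (hl : l ≤ L) :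
    l + levelLen n l ≤ n ∧ levelOff n l + 12 * levelLen n l ≤ 12 * n := by
  induction l with
  | zero => simp [levelLen, levelOff]
  | succ l ih =>
    have h1 := ih (by omega)
    have h2 := hL l (by omega)
    have h3 := four_mul_sampleLen_le h2
    rw [levelOff, levelLen_succ]
    omega

/-- `texts 0, …, texts l` are successive reductions, stored in the array `M`. -/
structure Tower (d n l : ℕ) (texts : ℕ → ℕ → ℕ) (M : ℕ → ℕ) : Prop where
  red : ∀ i < l, IsReduction (texts i) (levelLen n i) (texts (i + 1))
  text : ∀ i ≤ l, IsText (texts i) (levelLen n i)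
  le : ∀ i ≤ l, ∀ j, texts i j ≤ levelLen n i + d
  mem : ∀ i ≤ l, ∀ j < levelLen n i + 3, M (levelOff n i + j) = texts i j

/-- Computes the suffix array of the input in the array `5`. -/
def buildSuffixArray (d : ℕ) : Prog :=
  2 ≔ 0 ;; 3 ≔ .reg 0 ;; 4 ≔ 0 ;; .store 2 0 (.reg 0) ;;
  .forTo 16 (.reg 0) (.store 1 (.reg 16) (.load 0 (.reg 16) + 1)) ;;
  .loop (.lt 1 (.reg 3)) (downStep d) ;;
  .store 5 0 0 ;;
  .loop (.lt 0 (.reg 4))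
    (4 ≔ .reg 4 - 1 ;; 3 ≔ .load 2 (.reg 4) ;; 2 ≔ .reg 2 - (.reg 3 + 3) ;; upStep d)

/-- The text with the letters `x i + 1`. -/
def textOf (n : ℕ) (x : ℕ → ℕ) (i : ℕ) : ℕ := if i < n then x i + 1 else 0

lemma isText_textOf (n : ℕ) (x : ℕ → ℕ) : IsText (textOf n x) n :=
  ⟨fun i hi => by simp [textOf, hi], fun i hi => by simp [textOf, hi.not_gt]⟩

/-- The budget `20000 * ((d + 1) * levelLen n l)` loses at least a quarter on each level, which pays
for the step of cost `1500 * (levelLen n l + d + 1)` because the length is at least `2`. The cells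
behind the current text are still zero; this supplies the three sentinels behind each new text. -/
lemma descent_runs {d n : ℕ} {s : ℕ → ℕ} {σ : State} {L : ℕ} (hL1 : levelLen n L ≤ 1)
    (hL : ∀ l < L, 2 ≤ levelLen n l) (h2 : σ.reg 2 = 0) (h3 : σ.reg 3 = n) (h4 : σ.reg 4 = 0)
    (hm2 : σ.mem 2 0 = n) (ht : IsText s n) (hd : ∀ j, s j ≤ n + d)
    (hs : ∀ j, σ.mem 1 j = s j) (hS : 20 * (n + d + 1) ≤ S) (hW : 2 * S < W) :
    Runs W S (.loop (.lt 1 (.reg 3)) (downStep d)) σ (20000 * ((d + 1) * n) + 5) fun τ =>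
      τ.reg 2 = levelOff n L ∧ τ.reg 4 = L ∧ (∀ i ≤ L, τ.mem 2 i = levelLen n i) ∧
      ∃ texts, texts 0 = s ∧ Tower d n L texts (τ.mem 1) := by
  refine Runs.loop L (fun l τ => τ.reg 2 = levelOff n l ∧ τ.reg 3 = levelLen n l ∧ τ.reg 4 = l ∧
      (∀ i ≤ l, τ.mem 2 i = levelLen n i) ∧ (∀ i, levelOff n l + levelLen n l ≤ i → τ.mem 1 i = 0) ∧
      ∃ texts, texts 0 = s ∧ Tower d n l texts (τ.mem 1))
    (fun l => 1500 * (levelLen n l + d + 1)) (fun l => 20000 * ((d + 1) * levelLen n l) + 5)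
    ?_ ?_ ?_ ?_ (by simp) (by simp [levelLen]) ?_
  · refine ⟨by simp [levelOff, h2], by simp [levelLen, h3], h4, by simp [levelLen, hm2],
      fun i hi => ?_, fun _ => s, rfl, ⟨by simp, ?_, ?_, ?_⟩⟩
    · rw [hs, ht.zero]; simpa [levelLen, levelOff] using hi
    · intro i hi; obtain rfl : i = 0 := by omega
      exact ht
    · intro i hi; obtain rfl : i = 0 := by omega
      exact hd
    · intro i hi; obtain rfl : i = 0 := by omega
      simp [levelOff, hs]
  · rintro i hi τ ⟨-, h3, -⟩ -
    refine ⟨by simp; omega, ?_⟩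
    simp [h3]
    constructor
    · intro h; by_contra h'
      obtain rfl : i = L := by omega
      omega
    · exact fun h => hL i h
  · rintro l hl τ ⟨h2, h3, h4, h5, h6, texts, h7, h8⟩ - -
    have hb := level_bounds hL hl.le
    refine (downStep_runs h2 h3 h4 (hL l hl) (h8.le l le_rfl) (h8.mem l le_rfl) (by omega)
      (by omega) (by omega)).mono le_rfl ?_
    rintro υ ⟨k2, k3, k4, k5, k6, s', hs', hle, hmem⟩ - -
    refine ⟨by simp [k2, levelOff], by rw [k3, levelLen_succ], k4, ?_, ?_,
      fun i => if i ≤ l then texts i else s', by simp [h7], ?_, ?_, ?_, ?_⟩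
    · intro i hi
      rw [k5, Function.update_apply]
      split_ifs with h
      · rw [h, levelLen_succ]
      · exact h5 i (by omega)
    · intro i hi
      rw [levelOff, levelLen_succ] at hi
      rw [k6 i (by omega)]
      exact h6 i (by omega)
    · intro i hi
      rcases (Nat.lt_succ_iff.1 hi).lt_or_eq with hi | rfl
      · rw [if_pos hi.le, if_pos (by omega)]; exact h8.red i hi
      · rw [if_pos le_rfl, if_neg (by omega)]; exact hs'
    · intro i hi
      split_ifs with h
      · exact h8.text i h
      · obtain rfl : i = l + 1 := by omega
        rw [levelLen_succ]; exact hs'.text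
    · intro i hi j
      split_ifs with h
      · exact h8.le i h j
      · obtain rfl : i = l + 1 := by omega
        rw [levelLen_succ]; exact (hle j).trans (by omega)
    · intro i hi j hj
      split_ifs with h
      · rw [k6, h8.mem i h j hj]
        left
        have hmono : ∀ a b, a ≤ b → levelOff n a + levelLen n a ≤ levelOff n b + levelLen n b := by
          intro a b hab
          induction hab with
          | refl => exact le_rfl
          | step _ ih => rw [levelOff]; omega
        have := hmono i l h
        omega
      · obtain rfl : i = l + 1 := by omega
        rw [levelLen_succ] at hj
        rw [levelOff]
        by_cases hj' : j < sampleLen (levelLen n l)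
        · exact hmem j hj'
        · rw [hs'.text.zero j (by omega), k6 _ (by omega)]
          exact h6 _ (by omega)
  · intro l hl
    have h1 := hL l hl
    have h2 := four_mul_sampleLen_le h1
    rw [levelLen_succ]
    have h3 : (d + 1) * (4 * sampleLen (levelLen n l)) ≤ (d + 1) * (3 * levelLen n l) :=
      Nat.mul_le_mul_left _ h2
    have h4 : (d + 1) * 2 ≤ (d + 1) * levelLen n l := Nat.mul_le_mul_left _ h1
    have h5 : 1 * levelLen n l ≤ (d + 1) * levelLen n l := Nat.mul_le_mul_right _ (by omega)
    simp
    rw [mul_left_comm, mul_left_comm (d + 1)] at h3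
    omega
  · rintro τ ⟨h2, -, h4, h5, -, h7⟩ _
    exact ⟨h2, h4, h5, h7⟩

/-- The same geometric series, traversed backwards: the time left is the total budget minus the
budget of the current level. The addresses need no stack, since register `2` is lowered by the
length of the text that is entered plus its three sentinels. -/
lemma ascent_runs {d n : ℕ} {σ : State} {L : ℕ} {texts : ℕ → ℕ → ℕ}
    (hL1 : levelLen n L ≤ 1)
    (hL : ∀ l < L, 2 ≤ levelLen n l) (h2 : σ.reg 2 = levelOff n L) (h4 : σ.reg 4 = L)
    (hm2 : ∀ i ≤ L, σ.mem 2 i = levelLen n i) (ht : Tower d n L texts (σ.mem 1))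
    (hm5 : σ.mem 5 0 = 0) (hS : 20 * (n + d + 1) ≤ S) (hW : 2 * S < W) :
    Runs W S (.loop (.lt 0 (.reg 4)) (4 ≔ .reg 4 - 1 ;; 3 ≔ .load 2 (.reg 4) ;;
      2 ≔ .reg 2 - (.reg 3 + 3) ;; upStep d)) σ (20000 * ((d + 1) * n) + 5) fun τ =>
      SortedBy (sfx (texts 0)) n (τ.mem 5) := by
  have hφ : ∀ l < L, 1500 * (levelLen n l + d + 1) + 40 + 20000 * ((d + 1) * levelLen n (l + 1)) ≤
      20000 * ((d + 1) * levelLen n l) := by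
    intro l hl
    have h1 := hL l hl
    have h2 := four_mul_sampleLen_le h1
    rw [levelLen_succ]
    have h3 : (d + 1) * (4 * sampleLen (levelLen n l)) ≤ (d + 1) * (3 * levelLen n l) :=
      Nat.mul_le_mul_left _ h2
    have h4 : (d + 1) * 2 ≤ (d + 1) * levelLen n l := Nat.mul_le_mul_left _ h1
    have h5 : 1 * levelLen n l ≤ (d + 1) * levelLen n l := Nat.mul_le_mul_right _ (by omega)
    rw [mul_left_comm, mul_left_comm (d + 1)] at h3
    omega
  have hn : 20000 * ((d + 1) * levelLen n 0) = 20000 * ((d + 1) * n) := by simp [levelLen]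
  have hanti : ∀ l ≤ L, 20000 * ((d + 1) * levelLen n l) ≤ 20000 * ((d + 1) * n) := by
    intro l hl
    induction l with
    | zero => exact hn.le
    | succ l ih =>
      have := hφ l (by omega)
      have := ih (by omega)
      omega
  refine Runs.loop L (fun i τ => τ.reg 2 = levelOff n (L - i) ∧ τ.reg 4 = L - i ∧
      SortedBy (sfx (texts (L - i))) (levelLen n (L - i)) (τ.mem 5))
    (fun i => 1500 * (levelLen n (L - i - 1) + d + 1) + 30)
    (fun i => 20000 * ((d + 1) * n) - 20000 * ((d + 1) * levelLen n (L - i)) + 5)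
    ?_ ?_ ?_ ?_ (by simp) (by omega) ?_
  · refine ⟨by simpa using h2, by simpa using h4, ?_, ?_⟩
    -- The last text has at most one letter, so its suffix array can only consist of the entry `0`.
    · intro a ha
      obtain rfl : a = 0 := by simp at ha; omega
      rw [hm5]; exact ha
    · intro a b hab hb
      simp at hb; omega
  · rintro i hi τ ⟨-, h4, -⟩ -
    refine ⟨by simp; omega, ?_⟩
    simp [h4]
  · rintro i hi τ ⟨r2, r4, hA⟩ hf -
    have hb := level_bounds hL (l := L - i - 1) (by omega)
    obtain ⟨j, hj⟩ : ∃ j, L - i = j + 1 := ⟨L - i - 1, by omega⟩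
    have hj' : L - (i + 1) = j := by omega
    have m1 : τ.mem 1 = σ.mem 1 := hf.mem 1 (of_decide_eq_true rfl)
    have m2 : τ.mem 2 j = levelLen n j := by
      rw [hf.mem 2 (of_decide_eq_true rfl)]; exact hm2 j (by omega)
    rw [hj] at r2 r4 hA hb
    simp only [hj, hj', Nat.add_sub_cancel] at hb ⊢
    refine Runs.seq 4 (1500 * (levelLen n j + d + 1) + 20) (Q₁ := fun υ => υ = τ.setReg 4 j)
      (Runs.of_vc (by decide) (by simp [Prog.vc, r4]; omega)) ?_ (by omega)
    rintro _ rfl -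
    refine Runs.seq 3 (1500 * (levelLen n j + d + 1) + 10)
      (Q₁ := fun υ => υ = (τ.setReg 4 j).setReg 3 (levelLen n j))
      (Runs.of_vc (by decide) (by simp [Prog.vc, m2]; omega)) ?_ (by omega)
    rintro _ rfl -
    refine Runs.seq 7 (1500 * (levelLen n j + d + 1))
      (Q₁ := fun υ => υ = ((τ.setReg 4 j).setReg 3 (levelLen n j)).setReg 2 (levelOff n j))
      (Runs.of_vc (by decide) (by
        simp [Prog.vc, r2, levelOff, show levelOff n j + levelLen n j + 3 - (levelLen n j + 3) =
          levelOff n j by omega]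
        omega)) ?_ (by omega)
    rintro _ rfl -
    rw [levelLen_succ] at hA
    refine (upStep_runs (s := texts j) (s' := texts (j + 1)) (n := levelLen n j)
      (o := levelOff n j) (by simp) (by simp) (ht.text j (by omega)) (ht.le j (by omega))
      (by simpa [m1] using ht.mem j (by omega)) (ht.red j (by omega)) (by simpa using hA)
      (by omega) (by omega)).mono le_rfl ?_
    intro υ hυ hfυ _
    refine ⟨?_, ?_, hυ⟩
    · rw [hfυ.reg 2 (of_decide_eq_true rfl)]; simp
    · rw [hfυ.reg 4 (of_decide_eq_true rfl)]; simp
  · intro i hi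
    obtain ⟨j, hj⟩ : ∃ j, L - i = j + 1 := ⟨L - i - 1, by omega⟩
    have h1 := hφ j (by omega)
    have h2 := hanti j (by omega)
    simp only [hj, show L - (i + 1) = j by omega, Nat.add_sub_cancel]
    simp
    omega
  · rintro τ ⟨-, -, hA⟩ _
    simpa [levelLen] using hA

lemma buildSuffixArray_runs {d n : ℕ} {x : ℕ → ℕ} {σ : State} (h0 : σ.reg 0 = n)
    (hm0 : ∀ i < n, σ.mem 0 i = x i) (hx : ∀ i < n, x i < d) (hm1 : ∀ i, σ.mem 1 i = 0)
    (hS : 20 * (n + d + 1) ≤ S) (hW : 2 * S < W) :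
    Runs W S (buildSuffixArray d) σ (41000 * ((d + 1) * (n + 1))) fun τ =>
      SortedBy (sfx (textOf n x)) n (τ.mem 5) ∧ ∀ j, j < n + 3 → τ.mem 1 j = textOf n x j := by
  have hdn : (d + 1) * (n + 1) = (d + 1) * n + d + 1 := by ring
  have hdn' : n ≤ (d + 1) * n := Nat.le_mul_of_pos_left _ (by omega)
  refine Runs.seq 2 (40900 * ((d + 1) * (n + 1)) + 90) (Q₁ := fun τ => τ = σ.setReg 2 0)
    (Runs.of_vc le_rfl (by simp [Prog.vc]; omega)) ?_ (by omega)
  rintro _ rfl -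
  refine Runs.seq 2 (40900 * ((d + 1) * (n + 1)) + 80)
    (Q₁ := fun τ => τ = (σ.setReg 2 0).setReg 3 n)
    (Runs.of_vc le_rfl (by simp [Prog.vc, h0])) ?_ (by omega)
  rintro _ rfl -
  refine Runs.seq 2 (40900 * ((d + 1) * (n + 1)) + 70)
    (Q₁ := fun τ => τ = ((σ.setReg 2 0).setReg 3 n).setReg 4 0)
    (Runs.of_vc le_rfl (by simp [Prog.vc]; omega)) ?_ (by omega)
  rintro _ rfl -
  refine Runs.seq 3 (40900 * ((d + 1) * (n + 1)) + 60)
    (Q₁ := fun τ => τ = (((σ.setReg 2 0).setReg 3 n).setReg 4 0).setMem 2 0 n)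
    (Runs.of_vc le_rfl (by simp [Prog.vc, h0]; omega)) ?_ (by omega)
  rintro _ rfl -
  refine Runs.seq (20 * n + 10) (40800 * ((d + 1) * (n + 1)) + 50)
    (Q₁ := fun τ => ∀ i, τ.mem 1 i = textOf n x i) ?_ ?_ (by omega)
  · refine Runs.forTo n (fun i τ => (∀ j < i, τ.mem 1 j = x j + 1) ∧ ∀ j, i ≤ j → τ.mem 1 j = 0) 7
      (by decide) (by omega) (by simpa using hm1) ?_ ?_ (by simp; omega) ?_
    · intro τ hf
      simp [hf.reg 0 (by decide), h0]
    · rintro i hi τ ⟨hI1, hI2⟩ hr hf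
      have hxi := hx i hi
      have m0 : τ.mem 0 i = x i := by simp [hf.mem 0 (by decide), hm0 i hi]
      refine Runs.of_vc (by decide) ?_
      simp only [Prog.vc]
      simp [hr, m0, Function.update_apply]
      refine ⟨by omega, by omega, fun j hj => ?_, fun j hj => ?_⟩
      · split_ifs with h
        · rw [h]
        · exact hI1 j (by omega)
      · rw [if_neg (by omega)]
        exact hI2 j (by omega)
    · rintro τ ⟨hI1, hI2⟩ _ _ i
      by_cases hi : i < n
      · rw [hI1 i hi, textOf, if_pos hi]
      · rw [hI2 i (by omega), textOf, if_neg hi]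
  intro τ₁ hτ₁ hf₁
  obtain ⟨L, hL1, hL⟩ := exists_levels n
  refine Runs.seq (20000 * ((d + 1) * n) + 5) (20000 * ((d + 1) * n) + 15)
    (descent_runs hL1 hL (by simp [hf₁.reg 2 (by decide)])
    (by simp [hf₁.reg 3 (by decide)]) (by simp [hf₁.reg 4 (by decide)])
    (by simp [hf₁.mem 2 (by decide)]) (isText_textOf n x) (fun j => by
      unfold textOf; split_ifs with h
      · have := hx j h; omega
      · omega) hτ₁ hS hW) ?_ (by omega)
  rintro τ₂ ⟨e2, e4, e5, texts, e7, ht⟩ hf₂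
  refine Runs.seq 3 (20000 * ((d + 1) * n) + 10) (Q₁ := fun τ => τ = τ₂.setMem 5 0 0)
    (Runs.of_vc le_rfl (by simp [Prog.vc]; omega)) ?_ (by omega)
  rintro _ rfl -
  refine (ascent_runs hL1 hL (texts := texts) (by simpa using e2) (by simpa using e4)
    (by simpa using e5) (by simpa using ht) (by simp) hS hW).mono (by omega) ?_
  intro τ₃ hτ₃ hf₃ _
  rw [e7] at hτ₃
  refine ⟨hτ₃, fun j hj => ?_⟩
  have := ht.mem 0 (by omega) j (by simpa [levelLen] using hj)
  rw [hf₃.mem 1 (of_decide_eq_true rfl), ← e7, ← this]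
  simp [levelOff]

end WordRAM


namespace Suffix

variable {s : ℕ → ℕ} {n : ℕ}

/-! ### Longest common extensions -/

/-- The length of the longest common prefix of two suffixes. -/
noncomputable def lce (s : ℕ → ℕ) (i j : ℕ) : ℕ := sInf {h | s (i + h) ≠ s (j + h)}

lemma lce_comm (i j : ℕ) : lce s i j = lce s j i := by
  simp only [lce, ne_comm]

lemma eq_of_lt_lce {i j g : ℕ} (h : g < lce s i j) : s (i + g) = s (j + g) :=
  not_not.1 (Nat.notMem_of_lt_sInf h)

lemma lce_eq {i j h : ℕ} (h1 : ∀ g < h, s (i + g) = s (j + g)) (h2 : s (i + h) ≠ s (j + h)) :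
    lce s i j = h := by
  refine le_antisymm (Nat.sInf_le h2) (not_lt.1 fun hlt => ?_)
  exact Nat.sInf_mem (s := {h | s (i + h) ≠ s (j + h)}) ⟨h, h2⟩ (h1 _ hlt)

lemma IsText.ne_at_lce (hs : IsText s n) {i j : ℕ} (hi : i < n) (hij : i ≠ j) :
    s (i + lce s i j) ≠ s (j + lce s i j) := by
  have : ∃ h, s (i + h) ≠ s (j + h) := by
    by_contra hn
    push Not at hn
    exact hij (hs.sfx_injective hi (by unfold sfx; congr 1; ext h; exact hn h))
  exact Nat.sInf_mem this

/-- At the latest, the zero behind the later suffix meets a positive letter of the earlier one. -/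
lemma IsText.lce_add_le (hs : IsText s n) {i j : ℕ} (hi : i < n) (hj : j < n) (hij : i ≠ j) :
    i + lce s i j ≤ n ∧ j + lce s i j ≤ n := by
  have key : ∀ a b, a < b → b < n → s (a + (n - b)) ≠ s (b + (n - b)) := by
    intro a b hab hb
    rw [hs.zero (b + (n - b)) (by omega)]
    exact (hs.pos _ (by omega)).ne'
  rcases hij.lt_or_gt with h | h
  · have : lce s i j ≤ n - j := Nat.sInf_le (key i j h hj)
    omega
  · have : lce s j i ≤ n - i := Nat.sInf_le (key j i h hi)
    rw [lce_comm] at this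
    omega

lemma lce_of_lt {i j : ℕ} (h : sfx s i < sfx s j) : s (i + lce s i j) < s (j + lce s i j) := by
  obtain ⟨g, h1, h2⟩ := sfx_lt_iff.1 h
  rwa [lce_eq h1 h2.ne]

/-- At the smaller of the two extensions one of the neighbouring pairs still agrees and the other
differs. If both extensions are equal, the letters increase strictly twice and so cannot return to
the same value. -/
lemma lce_eq_min {a b c : ℕ} (hab : sfx s a < sfx s b) (hbc : sfx s b < sfx s c) :
    lce s a c = min (lce s a b) (lce s b c) := by
  have h1 := lce_of_lt hab
  have h2 := lce_of_lt hbc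
  refine lce_eq (fun g hg => ?_) ?_
  · exact (eq_of_lt_lce (lt_of_lt_of_le hg (min_le_left _ _))).trans
      (eq_of_lt_lce (lt_of_lt_of_le hg (min_le_right _ _)))
  · rcases lt_trichotomy (lce s a b) (lce s b c) with h | h | h
    · rw [min_eq_left h.le, ← eq_of_lt_lce h]; exact h1.ne
    · rw [h, min_self]; rw [h] at h1; exact (h1.trans h2).ne
    · rw [min_eq_right h.le, eq_of_lt_lce h]; exact h2.ne

lemma lce_succ {i j : ℕ} (h : s i = s j) (hlt : sfx s i < sfx s j) :
    lce s i j = lce s (i + 1) (j + 1) + 1 := by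
  rw [sfx_lt_succ] at hlt
  have h1 := lce_of_lt (hlt.resolve_left h.not_lt).2
  refine lce_eq (fun g hg => ?_) ?_
  · cases g with
    | zero => exact h
    | succ g =>
      have := eq_of_lt_lce (s := s) (i := i + 1) (j := j + 1) (g := g) (by omega)
      rwa [show i + (g + 1) = i + 1 + g by omega, show j + (g + 1) = j + 1 + g by omega]
  · rw [show i + (lce s (i + 1) (j + 1) + 1) = i + 1 + lce s (i + 1) (j + 1) by omega,
      show j + (lce s (i + 1) (j + 1) + 1) = j + 1 + lce s (i + 1) (j + 1) by omega]
    exact h1.ne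

/-- The common extension of the suffix of rank `r` and its predecessor. -/
noncomputable def lcp (s A : ℕ → ℕ) (r : ℕ) : ℕ := if r = 0 then 0 else lce s (A (r - 1)) (A r)

lemma lcp_succ (A : ℕ → ℕ) (r : ℕ) : lcp s A (r + 1) = lce s (A r) (A (r + 1)) := rfl

/-- `v` is the minimum of `V` on `[l, r]`. -/
structure IsRangeMin (V : ℕ → ℕ) (l r v : ℕ) : Prop where
  le : ∀ i, l ≤ i → i ≤ r → v ≤ V i
  mem : ∃ i, l ≤ i ∧ i ≤ r ∧ V i = v

lemma IsRangeMin.eq {V : ℕ → ℕ} {l r v w : ℕ} (h : IsRangeMin V l r v) (h' : IsRangeMin V l r w) :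
    v = w := by
  obtain ⟨i, h1, h2, rfl⟩ := h.mem
  obtain ⟨j, h3, h4, rfl⟩ := h'.mem
  exact le_antisymm (h.le j h3 h4) (h'.le i h1 h2)

lemma IsRangeMin.union {V : ℕ → ℕ} {l r l' r' v w : ℕ} (h : IsRangeMin V l r v)
    (h' : IsRangeMin V l' r' w) (h1 : l ≤ l') (h2 : l' ≤ r + 1) (h3 : r ≤ r') :
    IsRangeMin V l r' (min v w) := by
  refine ⟨fun i hi hi' => ?_, ?_⟩
  · by_cases hir : i ≤ r
    · exact (min_le_left _ _).trans (h.le i hi hir)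
    · exact (min_le_right _ _).trans (h'.le i (by omega) hi')
  · obtain ⟨i, i1, i2, i3⟩ := h.mem
    obtain ⟨j, j1, j2, j3⟩ := h'.mem
    rcases le_total v w with hvw | hvw
    · exact ⟨i, i1, i2.trans h3, by rw [min_eq_left hvw, i3]⟩
    · exact ⟨j, h1.trans j1, j2, by rw [min_eq_right hvw, j3]⟩

lemma isRangeMin_self (V : ℕ → ℕ) (l : ℕ) : IsRangeMin V l l (V l) :=
  ⟨fun i h h' => by rw [le_antisymm h h'], l, le_rfl, le_rfl, rfl⟩

/-- Iterating `lce_eq_min` along the sorted suffixes. The range starts at `x + 1` because `lcp` at a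
rank refers to the preceding rank. -/
lemma isRangeMin_lce {A : ℕ → ℕ} (hA : WordRAM.SortedBy (sfx s) n A) {x y : ℕ} (hxy : x < y)
    (hy : y < n) : IsRangeMin (lcp s A) (x + 1) y (lce s (A x) (A y)) := by
  induction y with
  | zero => omega
  | succ y ih =>
    rcases (Nat.lt_succ_iff.1 hxy).lt_or_eq with h | rfl
    · rw [lce_eq_min (hA.mono x y h (by omega)) (hA.mono y (y + 1) (by omega) hy)]
      exact (ih h (by omega)).union (isRangeMin_self (lcp s A) (y + 1))
        (by omega) (by omega) (by omega)
    · exact isRangeMin_self (lcp s A) (x + 1)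

/-- If a suffix shares at least one letter with its predecessor, deleting this letter from both
preserves their order and shortens the extension by one. The shortened predecessor need not be
adjacent to the shortened suffix, but the extension is a minimum over a range that ends there, so
the adjacent value is at least as large. -/
lemma lcp_le_succ {A R : ℕ → ℕ} (hs : IsText s n) (hA : WordRAM.SortedBy (sfx s) n A)
    (hR : ∀ i < n, R i < n ∧ A (R i) = i) {i : ℕ} (hi : i + 1 < n) :
    lcp s A (R i) ≤ lcp s A (R (i + 1)) + 1 := by
  obtain ⟨r1, r2⟩ := hR i (by omega)
  obtain ⟨r3, r4⟩ := hR (i + 1) hi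
  rcases Nat.eq_zero_or_pos (R i) with h | h
  · rw [h]; simp [lcp]
  obtain ⟨r, hr⟩ : ∃ r, R i = r + 1 := ⟨R i - 1, by omega⟩
  rw [hr] at r1 r2 ⊢
  rw [lcp_succ, r2]
  rcases Nat.eq_zero_or_pos (lce s (A r) i) with h0 | h0
  · omega
  have hlt : sfx s (A r) < sfx s i := by
    have := hA.mono r (r + 1) (by omega) r1
    rwa [r2] at this
  have heq : s (A r) = s i := eq_of_lt_lce h0
  rw [lce_succ heq hlt]
  have hlt' := ((sfx_lt_succ.1 hlt).resolve_left heq.not_lt).2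
  have har := hA.lt r (by omega)
  refine Nat.succ_le_succ ?_
  -- The shortened predecessor may be empty and thus have no rank; then the extension is zero.
  by_cases hn : A r + 1 = n
  · have : lce s (A r + 1) (i + 1) = 0 := by
      refine lce_eq (by simp) ?_
      rw [hn]
      change s n ≠ s (i + 1)
      rw [hs.zero n le_rfl]
      exact (hs.pos _ hi).ne
    omega
  · obtain ⟨p1, p2⟩ := hR (A r + 1) (by omega)
    have hp : R (A r + 1) < R (i + 1) := by
      rw [← hA.lt_iff p1 r3, p2, r4]; exact hlt'
    obtain ⟨q, hq⟩ : ∃ q, R (i + 1) = q + 1 := ⟨R (i + 1) - 1, by omega⟩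
    have := (isRangeMin_lce hA hp r3).le (R (i + 1)) hp le_rfl
    rwa [p2, r4] at this

end Suffix

/-! ### The array of common extensions of neighbouring suffixes -/

namespace WordRAM
open Suffix

variable {W S : ℕ}

/-- Computes the ranks of the suffixes in the array `8` and the lcp-values in the array `10`. -/
def buildLcp : Prog :=
  .forTo 16 (.reg 0) (.store 8 (.load 5 (.reg 16)) (.reg 16)) ;;
  17 ≔ 0 ;;
  .forTo 16 (.reg 0)
    (18 ≔ .load 8 (.reg 16) ;;
      .cond (.reg 18)
        (19 ≔ .load 5 (.reg 18 - 1) ;;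
          .loop (.eq (.load 1 (.reg 16 + .reg 17)) (.load 1 (.reg 19 + .reg 17)))
            (17 ≔ .reg 17 + 1))
        (17 ≔ 0) ;;
      .store 10 (.reg 18) (.reg 17) ;; 17 ≔ .reg 17 - 1)

lemma extend_runs {σ : State} {s : ℕ → ℕ} {n i j h : ℕ} (h16 : σ.reg 16 = i) (h17 : σ.reg 17 = h)
    (h19 : σ.reg 19 = j) (ht : IsText s n) (hi : i < n) (hj : j < n) (hij : i ≠ j)
    (hh : h ≤ lce s j i) (hs : ∀ j < n + 3, σ.mem 1 j = s j) (hS : n < S) (hW : n + 2 < W) :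
    Runs W S (.loop (.eq (.load 1 (.reg 16 + .reg 17)) (.load 1 (.reg 19 + .reg 17)))
      (17 ≔ .reg 17 + 1)) σ (20 * (lce s j i - h) + 20) fun τ => τ.reg 17 = lce s j i := by
  obtain ⟨b1, b2⟩ := ht.lce_add_le hj hi hij.symm
  refine Runs.loop (lce s j i - h) (fun g τ => τ.reg 17 = h + g) (fun _ => 4)
    (fun g => 20 * (lce s j i - h - g) + 20) (by simpa using h17) ?_ ?_ ?_ ?_ (by simp) ?_
  · intro g hg τ hτ hf
    have e16 := (hf.reg 16 (by decide)).trans h16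
    have e19 := (hf.reg 19 (by decide)).trans h19
    have m1 := hf.mem 1 (by decide)
    simp [hτ, e16, e19, m1, hs (i + (h + g)) (by omega), hs (j + (h + g)) (by omega)]
    refine ⟨by omega, fun heq => ?_, fun hlt => (eq_of_lt_lce (by omega)).symm⟩
    by_contra hn
    have : h + g = lce s j i := by omega
    rw [this] at heq
    exact ht.ne_at_lce hj hij.symm heq.symm
  · intro g hg τ hτ hf _
    refine Runs.of_vc le_rfl ?_
    simp [Prog.vc, hτ]
    omega
  · intro g hg; simp; omega
  · simp
  · intro τ hτ _; omega

/-- The suffixes are visited in text order and each comparison starts at the previous value minus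
one, which is safe by `lcp_le_succ`. The counter never exceeds `n` and drops by at most one per
round, so there are linearly many comparisons. -/
lemma buildLcp_runs {σ : State} {s A : ℕ → ℕ} {n : ℕ} (h0 : σ.reg 0 = n) (ht : IsText s n)
    (hA : SortedBy (sfx s) n A) (hm5 : σ.mem 5 = A)
    (hs : ∀ j < n + 3, σ.mem 1 j = s j) (hS : n + 3 < S) (hW : n + 3 < W) :
    Runs W S buildLcp σ (200 * (n + 1)) fun τ =>
      (∀ i < n, τ.mem 8 i < n ∧ A (τ.mem 8 i) = i) ∧ ∀ r < n, τ.mem 10 r = lcp s A r := by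
  refine Runs.seq (20 * n + 10) (140 * n + 50)
    (Q₁ := fun τ => ∀ r < n, τ.mem 8 (A r) = r) ?_ ?_ (by omega)
  · refine Runs.forTo n (fun i τ => ∀ r < i, τ.mem 8 (A r) = r) 4 (by decide) (by omega)
      (by simp) ?_ ?_ (by simp; omega) fun τ hI _ _ => hI
    · intro τ hf; simp [hf.reg 0 (by decide), h0]
    · intro i hi τ hI hx hf
      have m5 := (hf.mem 5 (by decide)).trans hm5
      have hAi := hA.lt i hi
      refine Runs.of_vc (by decide) ?_
      simp only [Prog.vc]
      simp [hx, m5, Function.update_apply]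
      refine ⟨by omega, by omega, fun r hr => ?_⟩
      split_ifs with h
      · exact (hA.inj (by omega) hi h).symm
      · refine hI r (lt_of_le_of_ne hr ?_)
        rintro rfl; exact h rfl
  intro τ₁ hR₁ hf₁
  have hR : ∀ i < n, τ₁.mem 8 i < n ∧ A (τ₁.mem 8 i) = i := by
    intro i hi
    obtain ⟨r, hr, rfl⟩ := hA.surj hi
    rw [hR₁ r hr]; exact ⟨hr, rfl⟩
  set R := τ₁.mem 8
  refine Runs.seq 2 (140 * n + 48) (Q₁ := fun τ => τ = τ₁.setReg 17 0)
    (Runs.of_vc le_rfl (by simp [Prog.vc]; omega)) ?_ (by omega)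
  rintro _ rfl -
  -- The value of register `17` at the beginning of round `i`.
  let H : ℕ → ℕ := fun i => if i = 0 then 0 else lcp s A (R (i - 1)) - 1
  have hH1 : ∀ i, H (i + 1) = lcp s A (R i) - 1 := fun i => rfl
  have hHn : ∀ i < n, lcp s A (R i) ≤ n := by
    intro i hi
    obtain ⟨r1, r2⟩ := hR i hi
    unfold lcp
    split_ifs with h
    · omega
    · have hlt := hA.lt (R i - 1) (by omega)
      have hne : A (R i - 1) ≠ A (R i) := fun he => by
        have := hA.inj (by omega) r1 he; omega
      have := (ht.lce_add_le hlt (hA.lt _ r1) hne).1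
      omega
  have hHle : ∀ i < n, H i ≤ lcp s A (R i) := by
    intro i hi
    cases i with
    | zero => simp [H]
    | succ i =>
      have := lcp_le_succ ht hA hR hi
      rw [hH1]; omega
  have hHn' : ∀ i ≤ n, H i ≤ n := by
    intro i hi
    cases i with
    | zero => simp [H]
    | succ i => have := hHn i (by omega); rw [hH1]; omega
  -- The term `20 * (n - H i)` pays for the letter comparisons: it falls by `20` for each increment
  -- of register `17` and rises by at most `20` through the final decrement.
  refine Runs.forTo' n (fun i τ => τ.reg 17 = H i ∧ ∀ j < i, τ.mem 10 (R j) = lcp s A (R j))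
    (fun i => 20 * (lcp s A (R i) - H i) + 60)
    (fun i => (n - i) * 100 + 20 * (n - H i)) (by decide) (by omega) (by simp [H]) ?_ ?_ ?_
    (by simp; omega) ?_
  · intro τ hf; simp [hf.reg 0 (by decide), hf₁.reg 0 (by decide), h0]
  · rintro i hi τ ⟨hI1, hI2⟩ hx hf
    obtain ⟨r1, r2⟩ := hR i hi
    have m5 : τ.mem 5 = A := by simp [hf.mem 5 (by decide), hf₁.mem 5 (by decide), hm5]
    have m8 : τ.mem 8 = R := by simp [hf.mem 8 (by decide), R]
    have m1 : τ.mem 1 = σ.mem 1 := by simp [hf.mem 1 (by decide), hf₁.mem 1 (by decide)]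
    have hle := hHle i hi
    refine Runs.seq 4 (20 * (lcp s A (R i) - H i) + 50) (Q₁ := fun υ => υ = τ.setReg 18 (R i))
      (Runs.of_vc (by decide) (by simp [Prog.vc, hx, m8]; omega)) ?_ (by omega)
    rintro _ rfl -
    refine Runs.seq (20 * (lcp s A (R i) - H i) + 40) 10 (Q₁ := fun υ => υ.reg 16 = i ∧
      υ.reg 18 = R i ∧ υ.reg 17 = lcp s A (R i) ∧ υ.mem = τ.mem) ?_ ?_ (by omega)
    · refine Runs.cond (20 * (lcp s A (R i) - H i) + 30) (by simp) (fun hne => ?_) (fun he => ?_)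
        (by simp)
      · simp at hne
        have hlcp : lcp s A (R i) = lce s (A (R i - 1)) i := by
          rw [lcp, if_neg hne, r2]
        rw [hlcp] at hle ⊢
        have hlt := hA.lt (R i - 1) (by omega)
        have hne' : i ≠ A (R i - 1) := fun he => by
          have := hA.inj (a := R i) (b := R i - 1) r1 (by omega) (r2.trans he)
          omega
        refine Runs.seq 5 (20 * (lce s (A (R i - 1)) i - H i) + 20)
          (Q₁ := fun υ => υ = (τ.setReg 18 (R i)).setReg 19 (A (R i - 1)))
          (Runs.of_vc (by decide) (by simp [Prog.vc, m5]; omega)) ?_ (by omega)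
        rintro _ rfl -
        refine (extend_runs (s := s) (n := n) (i := i) (j := A (R i - 1)) (h := H i)
          (by simp [hx]) (by simp [hI1]) (by simp) ht hi hlt hne' hle
          (by simpa [m1] using hs) (by omega) (by omega)).mono le_rfl ?_
        intro υ hυ hfυ _
        refine ⟨?_, ?_, hυ, ?_⟩
        · rw [hfυ.reg 16 (by decide)]; simp [hx]
        · rw [hfυ.reg 18 (by decide)]; simp
        · ext B j; rw [hfυ.mem B (by simp [Prog.wmems])]; simp
      · simp at he
        refine Runs.of_vc (le_trans (by decide : _ ≤ 2) (by omega)) ?_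
        simp [Prog.vc, hx, he, lcp]
        omega
    · rintro υ ⟨u16, u18, u17, um⟩ -
      refine Runs.of_vc (by decide) ?_
      simp only [Prog.vc]
      simp [u18, u17, um, hH1, Function.update_apply]
      refine ⟨by omega, by omega, fun j hj => ?_⟩
      split_ifs with h
      · rw [h]
      · refine hI2 j (lt_of_le_of_ne hj ?_)
        rintro rfl; exact h rfl
  · intro i hi
    have h1 := hHle i hi
    have h2 := hHn i hi
    have h3 := hHn' i hi.le
    rw [hH1]
    obtain ⟨j, rfl⟩ : ∃ j, n = i + 1 + j := ⟨n - (i + 1), by omega⟩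
    simp
    omega
  · rintro τ ⟨-, hI⟩ _ hf
    have m8 : τ.mem 8 = R := by simp [hf.mem 8 (by decide), R]
    rw [m8]
    refine ⟨hR, fun r hr => ?_⟩
    have := hI (A r) (hA.lt r hr)
    rwa [hR₁ r hr] at this

end WordRAM


namespace WordRAM
open Suffix

variable {W S : ℕ}

/-! ### Tables for operations on bits -/

/-- `b` is the index of the lowest bit of `t`. -/
def IsLowBit (t b : ℕ) : Prop := t.testBit b = true ∧ ∀ j < b, t.testBit j = false

/-- Tables of powers of two, binary logarithms and lowest bits, for numbers below `2 ^ B`. -/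
structure BitTables (B : ℕ) (σ : State) : Prop where
  reg : σ.reg 22 = B
  pow : ∀ j ≤ B, σ.mem 11 j = 2 ^ j
  log : ∀ t < 2 ^ B, σ.mem 12 t = Nat.log 2 t
  low : ∀ t < 2 ^ B, t ≠ 0 → IsLowBit t (σ.mem 13 t)

lemma BitTables.frame {B : ℕ} {σ τ : State} {p : Prog} (h : BitTables B σ) (hf : Frame p σ τ)
    (h22 : 22 ∉ p.wregs) (h11 : 11 ∉ p.wmems) (h12 : 12 ∉ p.wmems) (h13 : 13 ∉ p.wmems) :
    BitTables B τ :=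
  ⟨(hf.reg 22 h22).trans h.reg, by rw [hf.mem 11 h11]; exact h.pow,
    by rw [hf.mem 12 h12]; exact h.log, by rw [hf.mem 13 h13]; exact h.low⟩

/-- `B` is the number of bits of the masks for a text of length `n`. -/
structure IsBlockSize (n B : ℕ) : Prop where
  pos : 1 ≤ B
  lt : n + 1 < 2 ^ B
  pow_le : 2 ^ B ≤ 2 * n + 2
  le : B ≤ n + 1

lemma isBlockSize_clog (n : ℕ) : IsBlockSize n (Nat.clog 2 (n + 2)) := by
  have h1 : 0 < Nat.clog 2 (n + 2) := Nat.clog_pos (by omega) (by omega)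
  have h2 : 2 ^ (Nat.clog 2 (n + 2) - 1) < n + 2 :=
    (Nat.lt_clog_iff_pow_lt (by omega)).1 (by omega)
  have h3 : n + 2 ≤ 2 ^ Nat.clog 2 (n + 2) := Nat.le_pow_clog (by omega) _
  have h4 := Nat.lt_two_pow_self (n := Nat.clog 2 (n + 2) - 1)
  obtain ⟨c, hc⟩ : ∃ c, Nat.clog 2 (n + 2) = c + 1 := ⟨Nat.clog 2 (n + 2) - 1, by omega⟩
  rw [hc] at h2 h3 h4 ⊢
  simp only [Nat.add_sub_cancel] at h2 h4
  refine ⟨by omega, by omega, ?_, by omega⟩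
  rw [pow_succ]; omega

/-- Computes the tables of `BitTables`. -/
def buildBitTables : Prog :=
  22 ≔ 0 ;; 25 ≔ 1 ;;
  .loop (.lt (.reg 25) (.reg 0 + 2))
    (.store 11 (.reg 22) (.reg 25) ;; 22 ≔ .reg 22 + 1 ;; 25 ≔ 2 * .reg 25) ;;
  .store 11 (.reg 22) (.reg 25) ;;
  .forTo 16 (.reg 25)
    (.cond (.lt (.reg 16) 2) (.store 12 (.reg 16) 0 ;; .store 13 (.reg 16) 0)
      (.store 12 (.reg 16) (.load 12 (.reg 16 / 2) + 1) ;;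
        .cond (.reg 16 % 2) (.store 13 (.reg 16) 0)
          (.store 13 (.reg 16) (.load 13 (.reg 16 / 2) + 1))))

lemma IsLowBit.le {t b : ℕ} (h : IsLowBit t b) : b ≤ t := by
  have := Nat.ge_two_pow_of_testBit h.1
  exact (Nat.lt_two_pow_self.trans_le this).le

lemma isLowBit_odd {t : ℕ} (h : t % 2 = 1) : IsLowBit t 0 :=
  ⟨by simp [Nat.testBit_zero, h], by simp⟩

lemma IsLowBit.double {t b : ℕ} (h : IsLowBit (t / 2) b) (ht : t % 2 = 0) :
    IsLowBit t (b + 1) := by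
  refine ⟨by rw [Nat.testBit_succ]; exact h.1, fun j hj => ?_⟩
  cases j with
  | zero => simp [Nat.testBit_zero, ht]
  | succ j => rw [Nat.testBit_succ]; exact h.2 j (by omega)

/-- The first loop tests `2 ^ i < n + 2`, which fails first at the binary logarithm rounded up. Both
the logarithm and the lowest bit of an even number are obtained from the entry for `t / 2`, which is
already present. -/
lemma buildBitTables_runs {σ : State} {n B : ℕ} (h0 : σ.reg 0 = n)
    (hB : B = Nat.clog 2 (n + 2)) (hS : 3 * n + 5 ≤ S) (hW : 5 * n + 10 < W) :
    Runs W S buildBitTables σ (200 * (n + 1)) (BitTables B) := by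
  have hb : IsBlockSize n B := hB ▸ isBlockSize_clog n
  obtain ⟨b1, b2, b3, b4⟩ := hb
  refine Runs.seq 2 (190 * (n + 1)) (Q₁ := fun τ => τ = σ.setReg 22 0)
    (Runs.of_vc le_rfl (by simp [Prog.vc]; omega)) ?_ (by omega)
  rintro _ rfl -
  refine Runs.seq 2 (180 * (n + 1)) (Q₁ := fun τ => τ = (σ.setReg 22 0).setReg 25 1)
    (Runs.of_vc le_rfl (by simp [Prog.vc]; omega)) ?_ (by omega)
  rintro _ rfl -
  refine Runs.seq (30 * B + 10) (120 * (n + 1)) (Q₁ := fun τ => τ.reg 22 = B ∧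
    τ.reg 25 = 2 ^ B ∧ ∀ j < B, τ.mem 11 j = 2 ^ j) ?_ ?_ (by omega)
  · refine Runs.loop B (fun i τ => τ.reg 22 = i ∧ τ.reg 25 = 2 ^ i ∧ ∀ j < i, τ.mem 11 j = 2 ^ j)
      (fun _ => 11) (fun i => 30 * (B - i) + 10) (by simp) ?_ ?_ ?_ (by simp) (by simp)
      fun τ h _ => h
    · rintro i hi τ ⟨r22, r25, -⟩ hf
      have e0 : τ.reg 0 = n := by simp [hf.reg 0 (by decide), h0]
      simp [e0, r25]
      refine ⟨by omega, ?_⟩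
      rw [hB, Nat.lt_clog_iff_pow_lt (by omega)]
    · rintro i hi τ ⟨r22, r25, hI⟩ hf _
      have hp : 2 ^ i ≤ 2 ^ B := Nat.pow_le_pow_right (by omega) hi.le
      have hp' : 2 ^ (i + 1) ≤ 2 ^ B := Nat.pow_le_pow_right (by omega) hi
      refine Runs.of_vc (by decide) ?_
      simp only [Prog.vc]
      simp [r22, r25, Function.update_apply]
      rw [pow_succ] at hp'
      refine ⟨by omega, by omega, by omega, by rw [pow_succ, mul_comm], fun j hj => ?_⟩
      split_ifs with h
      · rw [h]
      · exact hI j (by omega)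
    · intro i hi; simp; omega
  rintro τ₁ ⟨r22, r25, hp⟩ hf₁
  refine Runs.seq 3 (115 * (n + 1)) (Q₁ := fun τ => τ = τ₁.setMem 11 B (2 ^ B))
    (Runs.of_vc le_rfl (by simp [Prog.vc, r22, r25]; omega)) ?_ (by omega)
  rintro _ rfl -
  refine Runs.forTo (2 ^ B) (fun i τ => (∀ t < i, τ.mem 12 t = Nat.log 2 t) ∧
      ∀ t < i, t ≠ 0 → IsLowBit t (τ.mem 13 t)) 25 (by decide) (by omega) (by simp) ?_ ?_
      (by simp; omega) ?_
  · intro τ hf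
    simp [hf.reg 25 (by decide), r25]
  · rintro i hi τ ⟨hI1, hI2⟩ hx hf
    refine Runs.of_vc (by decide) ?_
    simp only [Prog.vc]
    simp [hx, Function.update_apply]
    refine ⟨by omega, fun h2 => ⟨by omega, by omega, by omega, by omega, fun t ht => ?_, fun t ht ht0 => ?_⟩,
      fun h2 => ?_⟩
    · split_ifs with h
      · rw [h, Nat.log_of_lt (by omega)]
      · exact hI1 t (by omega)
    · split_ifs with h
      · exact isLowBit_odd (by omega)
      · exact hI2 t (by omega) ht0
    · have k1 := hI1 (i / 2) (by omega)
      have k2 := hI2 (i / 2) (by omega) (by omega)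
      have k3 := Nat.log_le_self 2 (i / 2)
      have k4 := k2.le
      have k5 : Nat.log 2 i = Nat.log 2 (i / 2) + 1 :=
        Nat.log_of_one_lt_of_le (by omega) h2
      have k6 : ∀ t ≤ i, (if t = i then τ.mem 12 (i / 2) + 1 else τ.mem 12 t) = Nat.log 2 t := by
        intro t ht
        split_ifs with h
        · rw [h, k1, k5]
        · exact hI1 t (by omega)
      refine ⟨by omega, by omega, by omega, fun h3 => ⟨by omega, by omega, k6, fun t ht ht0 => ?_⟩,
        fun h3 => ⟨by omega, by omega, k6, fun t ht ht0 => ?_⟩⟩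
      · split_ifs with h
        · rw [h]; exact isLowBit_odd h3
        · exact hI2 t (by omega) ht0
      · split_ifs with h
        · rw [h]; exact k2.double h3
        · exact hI2 t (by omega) ht0
  · rintro τ ⟨hI1, hI2⟩ _ hf
    refine ⟨by simp [hf.reg 22 (by decide), r22], fun j hj => ?_, hI1, hI2⟩
    simp [hf.mem 11 (by decide), Function.update_apply]
    split_ifs with h
    · rw [h]
    · exact hp j (by omega)

/-! ### Range minima within a block -/

/-- The bits of `m` are the positions `j ≤ c` in the block that starts at `b` at which the value
of `V` is less than all later values up to position `c`. -/
structure IsMinMask (V : ℕ → ℕ) (b c m : ℕ) : Prop where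
  lt : m < 2 ^ (c + 1)
  testBit : ∀ j, m.testBit j = true ↔ j ≤ c ∧ ∀ i, j < i → i ≤ c → V (b + j) < V (b + i)

/-- Dividing by `2 ^ l` removes the positions before `l`. The lowest remaining position has a value
below all later ones, as it belongs to the mask. A skipped position is not in the mask, so some
later position has a value at most as large; repeating this leads to the lowest bit or beyond it. -/
lemma IsMinMask.isRangeMin {V : ℕ → ℕ} {b c m l q : ℕ} (h : IsMinMask V b c m)
    (hq : IsLowBit (m / 2 ^ l) q) : IsRangeMin V (b + l) (b + c) (V (b + l + q)) := by
  obtain ⟨h1, h2⟩ := hq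
  rw [Nat.testBit_div_two_pow, h.testBit, add_comm q l] at h1
  obtain ⟨h3, h4⟩ := h1
  refine ⟨?_, b + l + q, by omega, by omega, rfl⟩
  -- positions before the lowest bit have a later position with a value at most as large
  have key : ∀ j, l ≤ j → j ≤ l + q → V (b + l + q) ≤ V (b + j) := by
    have H : ∀ k j, l + q - j ≤ k → l ≤ j → j ≤ c → ¬ (l + q ≤ j ∧ ¬ j = l + q) →
        V (b + l + q) ≤ V (b + j) := by
      intro k
      induction k with
      | zero => intro j h5 h6 h7 h8; rw [show b + l + q = b + j by omega]
      | succ k ih =>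
        intro j h5 h6 h7 h8
        by_cases hj : j = l + q
        · rw [show b + l + q = b + j by omega]
        have h9 := h2 (j - l) (by omega)
        rw [Nat.testBit_div_two_pow, Nat.sub_add_cancel h6] at h9
        have h10 : ¬ (j ≤ c ∧ ∀ i, j < i → i ≤ c → V (b + j) < V (b + i)) := by
          rw [← h.testBit, h9]; simp
        push Not at h10
        obtain ⟨i, i1, i2, i3⟩ := h10 h7
        rcases le_or_gt i (l + q) with hi | hi
        · exact (ih i (by omega) (by omega) i2 (by omega)).trans i3
        · have := h4 i hi i2
          rw [← add_assoc] at this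
          exact this.le.trans i3
    exact fun j hj hj' => H _ j le_rfl hj (by omega) (by omega)
  intro i hi hi'
  obtain ⟨j, rfl⟩ : ∃ j, i = b + j := ⟨i - b, by omega⟩
  rcases le_or_gt j (l + q) with hj | hj
  · exact key j (by omega) hj
  · have := h4 j hj (by omega)
    rw [← add_assoc] at this
    exact this.le

end WordRAM


namespace WordRAM
open Suffix

variable {W S : ℕ}

/-! ### The masks -/

lemma testBit_log {m : ℕ} (h : m ≠ 0) : m.testBit (Nat.log 2 m) = true := by
  rw [← Nat.log2_eq_log_two]; exact Nat.testBit_log2 h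

lemma le_log_of_testBit {m j : ℕ} (h : m.testBit j = true) : j ≤ Nat.log 2 m :=
  Nat.le_log_of_pow_le (by omega) (Nat.ge_two_pow_of_testBit h)

lemma testBit_mod_log {m j : ℕ} :
    (m % 2 ^ Nat.log 2 m).testBit j = true ↔ m.testBit j = true ∧ j ≠ Nat.log 2 m := by
  rw [Nat.testBit_mod_two_pow, Bool.and_eq_true, decide_eq_true_eq]
  constructor
  · rintro ⟨h1, h2⟩; exact ⟨h2, h1.ne⟩
  · rintro ⟨h1, h2⟩; exact ⟨lt_of_le_of_ne (le_log_of_testBit h1) h2, h1⟩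

lemma testBit_add_two_pow {m c j : ℕ} (h : m < 2 ^ c) :
    (m + 2 ^ c).testBit j = true ↔ m.testBit j = true ∨ j = c := by
  have := Nat.two_pow_add_eq_or_of_lt h 1
  rw [mul_one] at this
  rw [add_comm, this, Nat.testBit_or, Nat.testBit_two_pow, Bool.or_eq_true, decide_eq_true_eq,
    or_comm, @eq_comm ℕ c]

/-- The number of bits of `m` that are set, among the first `B`. -/
def bitCount (B m : ℕ) : ℕ := ((Finset.range B).filter fun j => m.testBit j = true).card

lemma bitCount_zero (B : ℕ) : bitCount B 0 = 0 := by simp [bitCount]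

lemma bitCount_mod_log {B m : ℕ} (h : m ≠ 0) (hm : m < 2 ^ B) :
    bitCount B (m % 2 ^ Nat.log 2 m) + 1 ≤ bitCount B m := by
  refine Finset.card_lt_card (Finset.ssubset_iff_of_subset ?_ |>.2 ⟨Nat.log 2 m, ?_, ?_⟩)
  · intro j
    simp only [Finset.mem_filter, testBit_mod_log]
    tauto
  · simpa [testBit_log h] using Nat.log_lt_of_lt_pow h hm
  · simp

lemma bitCount_add_two_pow {B m c : ℕ} (h : m < 2 ^ c) :
    bitCount B (m + 2 ^ c) ≤ bitCount B m + 1 := by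
  refine le_trans (Finset.card_le_card ?_) (Finset.card_insert_le c _)
  intro j
  simp only [Finset.mem_filter, testBit_add_two_pow h, Finset.mem_insert]
  tauto

/-- Removes from the mask in register `17` the positions at which the values are not less than
the value at the position in register `16`. -/
def popMask : Prog :=
  .loop (.lt 0 (.reg 17) *
      (1 - .lt (.load 10 (.reg 18 + .load 12 (.reg 17))) (.load 10 (.reg 16))))
    (17 ≔ .reg 17 % .load 11 (.load 12 (.reg 17)))

/-- The mask is a stack whose top is its highest bit. Values increase with the positions in it, so
popping stops at the first value below the new one and the survivors are exactly the positions with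
smaller values. The result `f` is fixed before the state, because the time is charged to the number
of removed bits. -/
lemma popMask_exists {V : ℕ → ℕ} {B b r : ℕ} (hS : 2 ^ B ≤ S) (hS' : b + B < S) (hr : r < S)
    (hW : S < W) : ∀ m, m < 2 ^ B →
    (∀ i j, i < j → m.testBit i = true → m.testBit j = true → V (b + i) < V (b + j)) →
    ∃ f, (∀ j, f.testBit j = true ↔ m.testBit j = true ∧ V (b + j) < V r) ∧ f ≤ m ∧
      bitCount B f ≤ bitCount B m ∧
      ∀ σ : State, BitTables B σ → σ.mem 10 = V → σ.reg 16 = r → σ.reg 17 = m → σ.reg 18 = b →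
        Runs W S popMask σ (30 * (bitCount B m - bitCount B f) + 20) fun τ => τ.reg 17 = f := by
  intro m
  induction m using Nat.strong_induction_on with
  | _ m ih =>
  intro hm hV
  rcases Nat.eq_zero_or_pos m with rfl | hpos
  · refine ⟨0, by simp, le_rfl, le_rfl, fun σ hσ m10 r16 r17 r18 => ?_⟩
    refine Runs.loop_exit ?_ (by simp [r17]) (by simp) r17
    -- Both factors of the condition are evaluated even for an empty mask; the cell read is then the
    -- beginning of the block, which is in range.
    simp [r17, r18, r16, hσ.log 0 (by positivity)]
    omega
  have hL : Nat.log 2 m < B := Nat.log_lt_of_lt_pow hpos.ne' hm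
  by_cases h : V (b + Nat.log 2 m) < V r
  · refine ⟨m, fun j => ⟨fun hj => ⟨hj, ?_⟩, fun hj => hj.1⟩, le_rfl, le_rfl,
      fun σ hσ m10 r16 r17 r18 => ?_⟩
    · rcases (le_log_of_testBit hj).lt_or_eq with h' | h'
      · exact (hV _ _ h' hj (testBit_log hpos.ne')).trans h
      · rwa [h']
    · refine Runs.loop_exit ?_ (by simp [r17, hσ.log m hm, r18, r16, m10, h]) (by simp) r17
      simp [r17, r18, r16, hσ.log m hm]
      split_ifs <;> omega
  · have hlt : m % 2 ^ Nat.log 2 m < m :=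
      (Nat.mod_lt _ (by positivity)).trans_le (Nat.pow_log_le_self 2 hpos.ne')
    obtain ⟨f, f1, f2, f3, f4⟩ := ih _ hlt (hlt.trans hm) fun i j hij hi hj =>
      hV i j hij (testBit_mod_log.1 hi).1 (testBit_mod_log.1 hj).1
    have hc := bitCount_mod_log hpos.ne' hm
    refine ⟨f, fun j => ?_, f2.trans hlt.le, by omega, fun σ hσ m10 r16 r17 r18 => ?_⟩
    · rw [f1, testBit_mod_log]
      constructor
      · rintro ⟨⟨h1, -⟩, h2⟩; exact ⟨h1, h2⟩
      · rintro ⟨h1, h2⟩; exact ⟨⟨h1, by rintro rfl; exact h h2⟩, h2⟩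
    · refine Runs.loop_step 6
        (30 * (bitCount B (m % 2 ^ Nat.log 2 m) - bitCount B f) + 20)
        (Q₁ := fun τ => τ = σ.setReg 17 (m % 2 ^ Nat.log 2 m)) ?_ ?_ ?_ ?_ (by simp; omega)
      · simp [r17, r18, r16, hσ.log m hm]
        split_ifs <;> omega
      · simp [r17, hσ.log m hm, r18, r16, m10, h]; omega
      · refine Runs.of_vc (by decide) ?_
        simp [Prog.vc, r17, hσ.log m hm, hσ.pow _ hL.le]
        omega
      · rintro _ rfl hf
        exact f4 _ (hσ.frame hf (by decide) (by decide) (by decide) (by decide)) (by simpa using m10)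
          (by simpa using r16) (by simp) (by simpa using r18)

/-- Computes the masks for the array `10` in the array `14`, the number of blocks in register `23`
and the number of positions in all the blocks in register `24`. -/
def buildMasks : Prog :=
  23 ≔ .reg 0 / .reg 22 + 1 ;; 24 ≔ .reg 23 * .reg 22 ;; 17 ≔ 0 ;;
  .forTo 16 (.reg 24)
    (.cond (.reg 16 % .reg 22) .nop (17 ≔ 0) ;; 18 ≔ .reg 16 - .reg 16 % .reg 22 ;; popMask ;;
      17 ≔ .reg 17 + .load 11 (.reg 16 % .reg 22) ;; .store 14 (.reg 16) (.reg 17))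

/-- Tables for range minima of `V` within blocks. -/
structure MaskTables (V : ℕ → ℕ) (B m : ℕ) (σ : State) : Prop where
  bits : BitTables B σ
  val : σ.mem 10 = V
  num : σ.reg 23 = m
  size : σ.reg 24 = m * B
  mask : ∀ r < m * B, IsMinMask V (r - r % B) (r % B) (σ.mem 14 r)

lemma MaskTables.frame {V : ℕ → ℕ} {B m : ℕ} {σ τ : State} {p : Prog} (h : MaskTables V B m σ)
    (hf : Frame p σ τ) (hr : ∀ x ∈ [22, 23, 24], x ∉ p.wregs)
    (hm : ∀ A ∈ [10, 11, 12, 13, 14], A ∉ p.wmems) : MaskTables V B m τ :=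
  ⟨h.bits.frame hf (hr 22 (by simp)) (hm 11 (by simp)) (hm 12 (by simp)) (hm 13 (by simp)),
    (hf.mem 10 (hm 10 (by simp))).trans h.val, (hf.reg 23 (hr 23 (by simp))).trans h.num,
    (hf.reg 24 (hr 24 (by simp))).trans h.size, by
    rw [hf.mem 14 (hm 14 (by simp))]; exact h.mask⟩

/-- A position stays a strict suffix minimum exactly if it was one before and its value is less than
the new value; the new position always is one. -/
lemma isMinMask_push {V : ℕ → ℕ} {b c m f : ℕ} (hm : m < 2 ^ c)
    (h : ∀ j, m.testBit j = true ↔ j < c ∧ ∀ i, j < i → i < c → V (b + j) < V (b + i))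
    (hf : ∀ j, f.testBit j = true ↔ m.testBit j = true ∧ V (b + j) < V (b + c)) (hfm : f ≤ m) :
    IsMinMask V b c (f + 2 ^ c) := by
  refine ⟨by rw [pow_succ]; omega, fun j => ?_⟩
  rw [testBit_add_two_pow (by omega), hf, h]
  constructor
  · rintro (⟨⟨h1, h2⟩, h3⟩ | rfl)
    · refine ⟨h1.le, fun i hi hi' => ?_⟩
      rcases hi'.lt_or_eq with h | rfl
      · exact h2 i hi h
      · exact h3
    · exact ⟨le_rfl, fun i _ _ => by omega⟩
  · rintro ⟨h1, h2⟩
    rcases h1.lt_or_eq with h | h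
    · exact Or.inl ⟨⟨h, fun i hi hi' => h2 i hi hi'.le⟩, h2 c h le_rfl⟩
    · exact Or.inr h

lemma IsBlockSize.size_le {n B : ℕ} (h : IsBlockSize n B) : (n / B + 1) * B ≤ 2 * n + 1 := by
  have := Nat.div_mul_le_self n B
  have := h.le
  rw [Nat.succ_mul]; omega

lemma IsBlockSize.lt_size {n B : ℕ} (h : IsBlockSize n B) : n < (n / B + 1) * B :=
  Nat.lt_mul_of_div_lt (Nat.lt_succ_self _) h.pos

lemma mod_succ_of_ne_zero {i B : ℕ} (hB : 1 ≤ B) (h : (i + 1) % B ≠ 0) :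
    (i + 1) % B = i % B + 1 := by
  rcases Nat.lt_or_ge (i % B + 1) B with h' | h'
  · rw [Nat.add_mod, Nat.mod_eq_of_lt (a := 1) (by omega), Nat.mod_eq_of_lt h']
  · exfalso
    apply h
    have h2 := Nat.mod_lt i hB
    have h3 : i % B + 1 = B := by omega
    have h4 := Nat.div_add_mod i B
    have : i + 1 = B * (i / B + 1) := by rw [mul_add]; omega
    rw [this, Nat.mul_mod_right]

/-- Each pop removes a bit and each position adds at most one, so the term `30 * bitCount B (τ.reg
17)` in the potential pays for all pops. The blocks together contain at most `2 * n + 1` positions.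
-/
lemma buildMasks_runs {σ : State} {n B : ℕ} (h0 : σ.reg 0 = n) (hB : IsBlockSize n B)
    (hσ : BitTables B σ) (hS : 5 * n + 10 ≤ S) (hW : 2 * S < W) :
    Runs W S buildMasks σ (500 * (n + 1)) (MaskTables (σ.mem 10) B (n / B + 1)) := by
  set V := σ.mem 10 with hVdef
  have hn1 : n / B + 1 ≤ n + 1 := Nat.succ_le_succ (Nat.div_le_self _ _)
  have hn2 := hB.size_le
  have hn3 := hB.lt_size
  obtain ⟨b1, b2, b3, b4⟩ := hB
  set M := n / B + 1 with hM
  have r22 := hσ.reg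
  refine Runs.seq 6 (490 * (n + 1)) (Q₁ := fun τ => τ = σ.setReg 23 M)
    (Runs.of_vc (by decide) (by simp [Prog.vc, h0, r22, hM]; omega)) ?_ (by omega)
  rintro _ rfl -
  refine Runs.seq 4 (485 * (n + 1)) (Q₁ := fun τ => τ = (σ.setReg 23 M).setReg 24 (M * B))
    (Runs.of_vc (by decide) (by simp [Prog.vc, r22]; exact lt_of_le_of_lt hn2 (by omega))) ?_ (by omega)
  rintro _ rfl -
  refine Runs.seq 2 (480 * (n + 1))
    (Q₁ := fun τ => τ = ((σ.setReg 23 M).setReg 24 (M * B)).setReg 17 0)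
    (Runs.of_vc (by decide) (by simp [Prog.vc]; omega)) ?_ (by omega)
  rintro _ rfl -
  set σ₁ := ((σ.setReg 23 M).setReg 24 (M * B)).setReg 17 0 with hσ₁
  have hσ₁t : BitTables B σ₁ := by
    refine ⟨?_, ?_, ?_, ?_⟩
    · simp [hσ₁, r22]
    · simpa [hσ₁] using hσ.pow
    · simpa [hσ₁] using hσ.log
    · simpa [hσ₁] using hσ.low
  refine Runs.forTo_potential (M * B)
    (fun i τ => (∀ r < i, IsMinMask V (r - r % B) (r % B) (τ.mem 14 r)) ∧
      (i % B ≠ 0 → τ.mem 14 (i - 1) = τ.reg 17))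
    (fun i τ => (M * B - i) * 150 + 30 * bitCount B (τ.reg 17)) (by decide) (by omega)
    (by simp) ?_ ?_ ?_ ?_
  · intro τ hf
    simp [hf.reg 24 (by decide), hσ₁]
  · rintro i hi τ ⟨hI1, hI2⟩ hx hf
    have hτ := hσ₁t.frame hf (by decide) (by decide) (by decide) (by decide)
    have m10 : τ.mem 10 = V := hf.mem 10 (by decide)
    have t22 := hτ.reg
    -- The stack is emptied at the beginning of each block.
    set m := if i % B = 0 then 0 else τ.reg 17 with hm
    set c := i % B with hc
    have hcB : c < B := Nat.mod_lt _ b1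
    have hci : c ≤ i := Nat.mod_le _ _
    have hmc : bitCount B m ≤ bitCount B (τ.reg 17) := by
      rw [hm]; split_ifs
      · simp [bitCount_zero]
      · exact le_rfl
    have hspec : m < 2 ^ c ∧ ∀ j, m.testBit j = true ↔
        j < c ∧ ∀ k, j < k → k < c → V (i - c + j) < V (i - c + k) := by
      by_cases h : c = 0
      · simp [hm, h]
      · obtain ⟨i, rfl⟩ : ∃ i', i = i' + 1 := ⟨i - 1, by omega⟩
        have h1 := mod_succ_of_ne_zero b1 h
        obtain ⟨h2, h3⟩ := hI1 i (by omega)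
        rw [show m = τ.mem 14 i by rw [hm, if_neg h, ← hI2 h]; rfl]
        have h4 : i - i % B = i + 1 - c := by omega
        rw [h4] at h3
        refine ⟨by rwa [hc, h1], fun j => ?_⟩
        rw [h3]
        simp only [hc, h1, Nat.lt_succ_iff]
    obtain ⟨hs1, hs2⟩ := hspec
    have hp : 2 ^ c ≤ 2 ^ B := Nat.pow_le_pow_right (by omega) hcB.le
    have hp' : 2 ^ (c + 1) ≤ 2 ^ B := Nat.pow_le_pow_right (by omega) hcB
    rw [pow_succ] at hp'
    obtain ⟨f, f1, f2, f3, f4⟩ := popMask_exists (S := S) (W := W) (V := V) (B := B) (b := i - c)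
      (r := i) (by omega) (by omega) (by omega) (by omega) m (by omega) (fun j k hjk hj hk =>
        ((hs2 j).1 hj).2 k hjk ((hs2 k).1 hk).1)
    have hpush : IsMinMask V (i - c) c (f + 2 ^ c) :=
      isMinMask_push hs1 hs2 (by simpa [Nat.sub_add_cancel hci] using f1) f2
    have hcount := bitCount_add_two_pow (B := B) (m := f) (c := c) (by omega)
    refine ⟨30 * (bitCount B m - bitCount B f) + 60, ?_⟩
    refine Runs.seq 6 (30 * (bitCount B m - bitCount B f) + 50)
      (Q₁ := fun υ => υ.reg 17 = m ∧ υ.mem = τ.mem) ?_ ?_ (by omega)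
    · refine Runs.of_vc (by decide) ?_
      simp only [Prog.vc]
      simp [hx, t22, ← hc]
      refine ⟨fun h => by simp [hm, h], fun h => ⟨by omega, by simp [hm, h]⟩⟩
    rintro τ₁ ⟨k17, km⟩ hf₁
    refine Runs.seq 6 (30 * (bitCount B m - bitCount B f) + 40)
      (Q₁ := fun υ => υ = τ₁.setReg 18 (i - c)) ?_ ?_ (by omega)
    · refine Runs.of_vc (by decide) ?_
      simp [Prog.vc, hf₁.reg 16 (by decide), hf₁.reg 22 (by decide), hx, t22, hc]
    rintro _ rfl hf₂
    have hτ₂ : BitTables B (τ₁.setReg 18 (i - c)) :=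
      (hτ.frame hf₁ (by decide) (by decide) (by decide) (by decide)).frame hf₂
        (by decide) (by decide) (by decide) (by decide)
    refine Runs.seq (30 * (bitCount B m - bitCount B f) + 20) 15
      (Q₁ := fun υ => υ.reg 17 = f) ?_ ?_ (by omega)
    · exact f4 _ hτ₂ (by simp [km, m10]) (by simp [hf₁.reg 16 (by decide), hx]) (by simp [k17])
        (by simp)
    intro υ u17 hf₃
    have hυ := hτ₂.frame hf₃ (by decide) (by decide) (by decide) (by decide)
    have u16 : υ.reg 16 = i := by simp [hf₃.reg 16 (by decide), hf₁.reg 16 (by decide), hx]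
    have u14 : υ.mem 14 = τ.mem 14 := by simp [hf₃.mem 14 (by decide), km]
    refine Runs.of_vc (by decide) ?_
    simp only [Prog.vc]
    simp [u16, u17, hυ.reg, ← hc, hυ.pow c hcB.le, u14, Function.update_apply]
    refine ⟨by omega, by omega, ⟨fun r hr => ?_, ?_⟩⟩
    · split_ifs with h
      · rw [h]; exact hpush
      · exact hI1 r (by omega)
    · obtain ⟨j, hj⟩ : ∃ j, M * B = i + 1 + j := ⟨M * B - (i + 1), by omega⟩
      rw [hj, show i + 1 + j - i = j + 1 by omega, show i + 1 + j - (i + 1) = j by omega]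
      omega
  · simp [hσ₁, bitCount_zero]; omega
  · rintro τ ⟨hI, -⟩ _ hf
    exact ⟨hσ₁t.frame hf (by decide) (by decide) (by decide) (by decide),
      hf.mem 10 (by decide), by simp [hf.reg 23 (by decide), hσ₁],
      by simp [hf.reg 24 (by decide), hσ₁], hI⟩

end WordRAM


namespace WordRAM
open Suffix

variable {W S : ℕ}

/-! ### Range minima -/

/-- The minimum of the array `10` on `[l, r]`, for positions in the same block. -/
def blockMin (l r : Expr) : Expr :=
  .load 10 (l + .load 13 (.load 14 r / .load 11 (l % .reg 22)))

/-- The mask of `r` knows nothing beyond `r`, so only the bits before `l` have to be cut off. The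
bit of `r` itself is always set, hence the quotient is nonzero and has a lowest bit. -/
lemma blockMin_spec {V : ℕ → ℕ} {n B : ℕ} {σ : State} {el er : Expr} {l r : ℕ}
    (hB : IsBlockSize n B) (hσ : MaskTables V B (n / B + 1) σ) (hS : 5 * n + 10 ≤ S)
    (hW : 2 * S < W) (hel : el.Safe W S σ) (her : er.Safe W S σ) (hl : el.eval σ = l)
    (hr : er.eval σ = r) (hlr : l ≤ r) (hrn : r < (n / B + 1) * B) (hb : l / B = r / B) :
    (blockMin el er).Safe W S σ ∧ IsRangeMin V l r ((blockMin el er).eval σ) := by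
  have hsize := hB.size_le
  obtain ⟨b1, b2, b3, b4⟩ := hB
  have d1 := Nat.div_add_mod l B
  have d2 := Nat.div_add_mod r B
  rw [hb] at d1
  have hmB : r % B < B := Nat.mod_lt _ b1
  have hM := hσ.mask r hrn
  generalize hm : σ.mem 14 r = m at hM
  have hmlt : m < 2 ^ B := hM.lt.trans_le (Nat.pow_le_pow_right (by omega) hmB)
  have hdlt : m / 2 ^ (l % B) < 2 ^ B := (Nat.div_le_self _ _).trans_lt hmlt
  have hne : m / 2 ^ (l % B) ≠ 0 := by
    have h1 : m.testBit (r % B) = true := (hM.testBit _).2 ⟨le_rfl, fun i _ _ => by omega⟩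
    have h2 : (m / 2 ^ (l % B)).testBit (r % B - l % B) = true := by
      rw [Nat.testBit_div_two_pow, Nat.sub_add_cancel (by omega)]; exact h1
    intro h
    rw [h] at h2
    simp at h2
  have hlow := hσ.bits.low _ hdlt hne
  have hmin := hM.isRangeMin hlow
  have hq : l % B + σ.mem 13 (m / 2 ^ (l % B)) ≤ r % B := by
    have := hlow.1
    rw [Nat.testBit_div_two_pow, hM.testBit] at this
    omega
  have hpow := hσ.bits.pow (l % B) (by omega)
  rw [show r - r % B + l % B = l by omega, show r - r % B + r % B = r by omega] at hmin
  simp only [blockMin, Expr.safe_load, Expr.safe_add, Expr.safe_div, Expr.safe_mod, Expr.safe_reg,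
    Expr.eval_load, Expr.eval_add, Expr.eval_div, Expr.eval_mod, Expr.eval_reg, hl, hr,
    hσ.bits.reg, hpow, hσ.val, hm]
  have hdle : m / 2 ^ (l % B) ≤ m := Nat.div_le_self _ _
  exact ⟨⟨⟨hel, ⟨⟨⟨her, by omega⟩, ⟨hel, trivial⟩, by omega⟩, by omega⟩, by omega⟩, by omega⟩, hmin⟩

/-- Computes the table of minima over runs of blocks whose length is a power of two, in the
array `15`. -/
def buildSparse : Prog :=
  .forTo 16 (.reg 24)
    (.cond (.lt (.reg 16) (.reg 23))
      (25 ≔ .reg 16 * .reg 22 ;;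
        .store 15 (.reg 16) (blockMin (.reg 25) (.reg 25 + (.reg 22 - 1))))
      (25 ≔ .load 11 (.reg 16 / .reg 23 - 1) ;; 26 ≔ .load 15 (.reg 16 - .reg 23) ;;
        .cond (.lt (.reg 16 % .reg 23 + .reg 25) (.reg 23))
          (27 ≔ .load 15 (.reg 16 - .reg 23 + .reg 25) ;;
            .store 15 (.reg 16) (.reg 26 - (.reg 26 - .reg 27)))
          (.store 15 (.reg 16) (.reg 26))))

/-- Tables for range minima of `V`. -/
structure MinTables (V : ℕ → ℕ) (B m : ℕ) (σ : State) : Prop where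
  masks : MaskTables V B m σ
  sparse : ∀ t < m * B,
    IsRangeMin V (t % m * B) (min (t % m + 2 ^ (t / m)) m * B - 1) (σ.mem 15 t)

lemma MinTables.frame {V : ℕ → ℕ} {B m : ℕ} {σ τ : State} {p : Prog} (h : MinTables V B m σ)
    (hf : Frame p σ τ) (hr : ∀ x ∈ [22, 23, 24], x ∉ p.wregs)
    (hm : ∀ A ∈ [10, 11, 12, 13, 14], A ∉ p.wmems) (h15 : 15 ∉ p.wmems) : MinTables V B m τ :=
  ⟨h.masks.frame hf hr hm, by rw [hf.mem 15 h15]; exact h.sparse⟩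

lemma mul_add_mod_div {m b : ℕ} (h : b < m) (q : ℕ) :
    (q * m + b) % m = b ∧ (q * m + b) / m = q := by
  rw [mul_comm, Nat.mul_add_mod, Nat.mod_eq_of_lt h, Nat.mul_add_div (by omega),
    Nat.div_eq_of_lt h]
  simp

/-- The entry `q * M + b` belongs to `2 ^ q` blocks starting at block `b`, truncated at the last
block. There are `B` rows of `M` blocks, and `M * B` is linear in `n`. Minima are computed as `a -
(a - b)` with truncated subtraction. -/
lemma buildSparse_runs {V : ℕ → ℕ} {n B : ℕ} {σ : State} (hB : IsBlockSize n B)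
    (hσ : MaskTables V B (n / B + 1) σ) (hS : 5 * n + 10 ≤ S) (hW : 2 * S < W) :
    Runs W S buildSparse σ (200 * (n + 1)) (MinTables V B (n / B + 1)) := by
  have hsize := hB.size_le
  have hM1 : n / B + 1 ≤ n + 1 := Nat.succ_le_succ (Nat.div_le_self _ _)
  have hM0 : 0 < n / B + 1 := Nat.succ_pos _
  have hframe : ∀ {τ}, Frame buildSparse σ τ → MaskTables V B (n / B + 1) τ := fun hf =>
    hσ.frame hf (by decide) (by decide)
  set M := n / B + 1 with hM
  refine Runs.forTo (M * B) (fun i τ => ∀ t < i,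
    IsRangeMin V (t % M * B) (min (t % M + 2 ^ (t / M)) M * B - 1) (τ.mem 15 t)) 60 (by decide)
    (by omega) (by simp) ?_ ?_ ?_ (fun τ hI _ hf => ⟨hframe hf, hI⟩)
  · intro τ hf
    simp [(hframe hf).size]
  · rintro i hi τ hI hx hf
    have hτ := hframe hf
    have t22 := hτ.bits.reg
    have t23 := hτ.num
    have hnew : ∀ {υ : State} {v : ℕ}, υ.mem = τ.mem →
        IsRangeMin V (i % M * B) (min (i % M + 2 ^ (i / M)) M * B - 1) v →
        ∀ t < i + 1, IsRangeMin V (t % M * B) (min (t % M + 2 ^ (t / M)) M * B - 1)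
          (((υ.setMem 15 i v).setReg 16 (i + 1)).mem 15 t) := by
      intro υ v hυ hv t ht
      simp [Function.update_apply, hυ]
      split_ifs with h
      · rwa [h]
      · exact hI t (by omega)
    obtain ⟨b1, b2, b3, b4⟩ := id hB
    refine Runs.cond 50 (by simp) (fun hc => ?_) (fun hc => ?_) (by simp)
    · simp [hx, t23] at hc
      have hle : (i + 1) * B ≤ M * B := Nat.mul_le_mul_right B hc
      rw [Nat.succ_mul] at hle
      refine Runs.seq 4 46 (Q₁ := fun υ => υ = τ.setReg 25 (i * B))
        (Runs.of_vc (by decide) (by simp [Prog.vc, hx, t22]; omega)) ?_ (by omega)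
      rintro _ rfl hf'
      have hτ' := hτ.frame hf' (by decide) (by decide)
      have hdiv : (i * B + (B - 1)) / B = i := by
        rw [mul_comm, Nat.mul_add_div b1, Nat.div_eq_of_lt (by omega)]; omega
      obtain ⟨s1, s2⟩ := blockMin_spec (el := .reg 25) (er := .reg 25 + (.reg 22 - 1))
        (l := i * B) (r := i * B + (B - 1)) hB hτ' hS hW (by simp) (by simp [t22]; omega) (by simp)
        (by simp [t22]) (by omega) (by change _ < M * B; omega) (by rw [hdiv, Nat.mul_div_cancel _ b1])
      refine Runs.of_vc (by decide) ?_
      simp only [Prog.vc]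
      refine ⟨by simp, s1, by simp [hx]; omega, ?_⟩
      simp only [Expr.eval_reg, State.setReg_reg, hx, Nat.reduceEqDiff, if_false]
      refine hnew (by simp) ?_
      rw [Nat.mod_eq_of_lt hc, Nat.div_eq_of_lt hc, pow_zero, min_eq_left hc]
      have h : (i + 1) * B - 1 = i * B + (B - 1) := by rw [Nat.add_one_mul]; omega
      exact h ▸ s2
    · simp [hx, t23] at hc
      -- A run in row `q + 1` is the union of two runs of row `q`, one row earlier in the table.
      obtain ⟨q, b, hbM, rfl⟩ : ∃ q b, b < M ∧ i = (q + 1) * M + b := by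
        refine ⟨i / M - 1, i % M, Nat.mod_lt _ hM0, ?_⟩
        rw [Nat.sub_add_cancel ((Nat.one_le_div_iff hM0).2 hc), mul_comm, Nat.div_add_mod]
      obtain ⟨e1, e2⟩ := mul_add_mod_div hbM (q + 1)
      rw [e1, e2] at hnew
      have hsub : (q + 1) * M + b - M = q * M + b := by rw [Nat.succ_mul]; omega
      have hqB : q + 1 < B := by
        rw [← e2]; exact Nat.div_lt_of_lt_mul hi
      have hpow := hτ.bits.pow q (by omega)
      have hpB : 2 ^ q ≤ 2 ^ B := Nat.pow_le_pow_right (by omega) (by omega)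
      have h1 := hI (q * M + b) (by omega)
      obtain ⟨e3, e4⟩ := mul_add_mod_div hbM q
      rw [e3, e4] at h1
      have hp1 : 1 ≤ 2 ^ q := Nat.one_le_two_pow
      have hpow2 : 2 ^ (q + 1) = 2 ^ q + 2 ^ q := by rw [pow_succ, mul_two]
      rw [hpow2] at hnew
      set p := 2 ^ q
      refine Runs.seq 7 43 (Q₁ := fun υ => υ = τ.setReg 25 p)
        (Runs.of_vc (by decide) (by simp [Prog.vc, hx, t23, e2, hpow]; omega)) ?_ (by omega)
      rintro _ rfl -
      refine Runs.seq 5 38 (Q₁ := fun υ => υ = (τ.setReg 25 p).setReg 26 (τ.mem 15 (q * M + b)))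
        (Runs.of_vc (by decide) (by simp [Prog.vc, hx, t23, hsub]; omega)) ?_ (by omega)
      rintro _ rfl -
      refine Runs.cond 28 (by simp [hx, t23, e1]; omega) (fun hb => ?_) (fun hb => ?_) (by simp)
      · simp [hx, t23, e1] at hb
        have h2 := hI (q * M + (b + p)) (by omega)
        obtain ⟨e5, e6⟩ := mul_add_mod_div hb q
        rw [e5, e6] at h2
        refine Runs.of_vc (by decide) ?_
        simp only [Prog.vc]
        simp only [Expr.safe_load, Expr.safe_add, Expr.safe_sub, Expr.safe_reg, Expr.eval_load,
          Expr.eval_add, Expr.eval_sub, Expr.eval_reg, State.setReg_reg, State.setReg_mem, hx, t23,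
          Nat.reduceEqDiff, if_true, if_false, hsub, true_and, add_assoc]
        refine ⟨by omega, by omega, ?_⟩
        rw [tsub_tsub_eq_min]
        refine hnew (by simp) ?_
        rw [min_eq_left hb.le] at h1
        rw [← add_assoc]
        have hle : (b + p) * B ≥ 1 * B := Nat.mul_le_mul_right B (by omega)
        refine h1.union h2 (Nat.mul_le_mul_right B (by omega)) (by omega) ?_
        exact Nat.sub_le_sub_right (Nat.mul_le_mul_right B (by omega)) 1
      · simp [hx, t23, e1] at hb
        refine Runs.of_vc (by decide) ?_
        simp only [Prog.vc]
        refine ⟨by simp, by simp, by simp [hx]; omega, ?_⟩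
        simp only [Expr.eval_reg, State.setReg_reg, hx, Nat.reduceEqDiff, if_true, if_false]
        refine hnew (by simp) ?_
        -- The first half already reaches the last block, so both runs are truncated to the same
        -- range.
        rw [min_eq_right (by omega)] at h1 ⊢
        exact h1
  · simp
    omega

/-- Stores in register `25` the minimum of the array `10` between the positions in the registers
`26` and `27`. -/
def rangeMin : Prog :=
  28 ≔ .reg 26 / .reg 22 ;; 29 ≔ .reg 27 / .reg 22 ;;
  .cond (.eq (.reg 28) (.reg 29)) (25 ≔ blockMin (.reg 26) (.reg 27))
    (25 ≔ blockMin (.reg 26) (.reg 28 * .reg 22 + (.reg 22 - 1)) ;; 28 ≔ .reg 28 + 1 ;;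
      .cond (.lt (.reg 28) (.reg 29))
        (30 ≔ .load 12 (.reg 29 - .reg 28) ;; 31 ≔ .load 15 (.reg 30 * .reg 23 + .reg 28) ;;
          25 ≔ .reg 25 - (.reg 25 - .reg 31) ;;
          31 ≔ .load 15 (.reg 30 * .reg 23 + (.reg 29 - .load 11 (.reg 30))) ;;
          25 ≔ .reg 25 - (.reg 25 - .reg 31)) .nop ;;
      31 ≔ blockMin (.reg 29 * .reg 22) (.reg 27) ;; 25 ≔ .reg 25 - (.reg 25 - .reg 31))

/-- Unless both ends share a block, the range consists of the end of one block, some full blocks and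
the beginning of another. The full blocks are covered by two runs of the largest possible power of
two; their overlap does not affect a minimum. -/
lemma rangeMin_runs {V : ℕ → ℕ} {n B l r : ℕ} {σ : State} (hB : IsBlockSize n B)
    (hσ : MinTables V B (n / B + 1) σ) (hS : 5 * n + 10 ≤ S) (hW : 2 * S < W)
    (h26 : σ.reg 26 = l) (h27 : σ.reg 27 = r) (hlr : l ≤ r) (hr : r < (n / B + 1) * B) :
    Runs W S rangeMin σ 150 fun τ => IsRangeMin V l r (τ.reg 25) := by
  have hsize := hB.size_le
  have hM1 : n / B + 1 ≤ n + 1 := Nat.succ_le_succ (Nat.div_le_self _ _)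
  have hblock : ∀ {τ : State} {el er : Expr} {l r : ℕ}, MaskTables V B (n / B + 1) τ →
      el.Safe W S τ → er.Safe W S τ → el.eval τ = l → er.eval τ = r → l ≤ r →
      r < (n / B + 1) * B → l / B = r / B →
      (blockMin el er).Safe W S τ ∧ IsRangeMin V l r ((blockMin el er).eval τ) :=
    fun hτ => blockMin_spec hB hτ hS hW
  set M := n / B + 1 with hM
  obtain ⟨b1, b2, b3, b4⟩ := id hB
  have r22 := hσ.masks.bits.reg
  have r23 := hσ.masks.num
  have hd1 := Nat.div_add_mod l B
  have hd2 := Nat.div_add_mod r B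
  have hm1 := Nat.mod_lt l b1
  have hm2 := Nat.mod_lt r b1
  have hle : l / B ≤ r / B := Nat.div_le_div_right hlr
  have hrM : r / B < M := Nat.div_lt_of_lt_mul (by rwa [mul_comm])
  set x := l / B
  set y := r / B
  rw [mul_comm] at hd1 hd2
  refine Runs.seq 4 146 (Q₁ := fun υ => υ = σ.setReg 28 x)
    (Runs.of_vc (by decide) (by simp [Prog.vc, h26, r22, x])) ?_ (by omega)
  rintro _ rfl hf₁
  refine Runs.seq 4 142 (Q₁ := fun υ => υ = (σ.setReg 28 x).setReg 29 y)
    (Runs.of_vc (by decide) (by simp [Prog.vc, h27, r22, y])) ?_ (by omega)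
  rintro _ rfl hf₂
  have hτ := (hσ.frame hf₁ (by decide) (by decide) (by decide)).frame hf₂
    (by decide) (by decide) (by decide)
  set τ := (σ.setReg 28 x).setReg 29 y with hτdef
  have t26 : τ.reg 26 = l := by simp [hτdef, h26]
  have t27 : τ.reg 27 = r := by simp [hτdef, h27]
  have t28 : τ.reg 28 = x := by simp [hτdef]
  have t29 : τ.reg 29 = y := by simp [hτdef]
  refine Runs.cond 130 (by simp) (fun hc => ?_) (fun hc => ?_) (by simp)
  · simp [t28, t29] at hc
    obtain ⟨s1, s2⟩ := hblock (el := .reg 26) (er := .reg 27) (l := l) (r := r) hτ.masks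
      (by simp) (by simp) t26 t27 hlr hr hc
    refine Runs.of_vc (by decide) ?_
    exact ⟨s1, by simpa using s2⟩
  simp [t28, t29] at hc
  have hxy : x < y := by omega
  have hxy' : (x + 1) * B ≤ y * B := Nat.mul_le_mul_right B hxy
  rw [Nat.succ_mul] at hxy'
  have hxe : (x * B + (B - 1)) / B = x := (mul_add_mod_div (by omega) x).2
  obtain ⟨s1, s2⟩ := hblock (el := .reg 26) (er := .reg 28 * .reg 22 + (.reg 22 - 1)) (l := l)
    (r := x * B + (B - 1)) hτ.masks (by simp)
    (by simp [t28, hτ.masks.bits.reg]; omega) t26 (by simp [t28, hτ.masks.bits.reg]) (by omega)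
    (by omega) (by rw [hxe])
  refine Runs.seq 25 105 (Q₁ := fun υ => IsRangeMin V l (x * B + (B - 1)) (υ.reg 25))
    (Runs.of_vc (by decide) ⟨s1, by simpa using s2⟩) ?_ (by omega)
  rintro τ₁ h1 hf₁
  refine Runs.seq 4 101 (Q₁ := fun υ => υ = τ₁.setReg 28 (x + 1))
    (Runs.of_vc (by decide) (by simp [Prog.vc, hf₁.reg 28 (by decide), t28]; omega)) ?_ (by omega)
  rintro _ rfl hf₂
  have hτ₂ := (hτ.frame hf₁ (by decide) (by decide) (by decide)).frame hf₂
    (by decide) (by decide) (by decide)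
  have u29 : (τ₁.setReg 28 (x + 1)).reg 29 = y := by simp [hf₁.reg 29 (by decide), t29]
  have u27 : (τ₁.setReg 28 (x + 1)).reg 27 = r := by simp [hf₁.reg 27 (by decide), t27]
  have u28 : (τ₁.setReg 28 (x + 1)).reg 28 = x + 1 := by simp
  have u25 : (τ₁.setReg 28 (x + 1)).reg 25 = τ₁.reg 25 := by simp
  rw [← u25] at h1
  generalize τ₁.setReg 28 (x + 1) = υ at hτ₂ u29 u27 u28 u25 h1
  refine Runs.seq 60 40 (Q₁ := fun τ => IsRangeMin V l (y * B - 1) (τ.reg 25)) ?_ ?_ (by omega)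
  · refine Runs.cond 50 (by simp) (fun hc => ?_) (fun hc => ?_) (by simp)
    · simp [u28, u29] at hc
      generalize hx' : x + 1 = x' at *
      have hlog : Nat.log 2 (y - x') < B := Nat.log_lt_of_lt_pow (by omega) (by omega)
      have hp1 : 2 ^ Nat.log 2 (y - x') ≤ y - x' := Nat.pow_log_le_self 2 (by omega)
      have hp2 : y - x' < 2 ^ (Nat.log 2 (y - x') + 1) := Nat.lt_pow_succ_log_self (by omega) _
      rw [pow_succ] at hp2
      have h12 := hτ₂.masks.bits.log (y - x') (by omega)
      have h11 := hτ₂.masks.bits.pow _ hlog.le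
      have h23 := hτ₂.masks.num
      set q := Nat.log 2 (y - x')
      set p := 2 ^ q
      have hqM : (q + 1) * M ≤ B * M := Nat.mul_le_mul_right M hlog
      rw [Nat.succ_mul, mul_comm B] at hqM
      have hT : ∀ b, b < M → b + p ≤ M → IsRangeMin V (b * B) ((b + p) * B - 1)
          (υ.mem 15 (q * M + b)) := by
        intro b hb hb'
        have := hτ₂.sparse (q * M + b) (by omega)
        obtain ⟨e1, e2⟩ := mul_add_mod_div hb q
        rwa [e1, e2, min_eq_left hb'] at this
      have k1 := hT x' (by omega) (by omega)
      have k2 := hT (y - p) (by omega) (by omega)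
      rw [Nat.sub_add_cancel (by omega)] at k2
      refine Runs.of_vc (by decide) ?_
      simp only [Prog.vc]
      simp [u28, u29, h23, h12, h11]
      refine ⟨by omega, by omega, ?_⟩
      rw [tsub_tsub_eq_min, tsub_tsub_eq_min]
      have l1 : x' * B ≤ (y - p) * B := Nat.mul_le_mul_right B (by omega)
      have l2 : (y - p) * B ≤ (x' + p) * B := Nat.mul_le_mul_right B (by omega)
      have l3 : (x' + p) * B ≤ y * B := Nat.mul_le_mul_right B (by omega)
      have l4 : 1 * B ≤ x' * B := Nat.mul_le_mul_right B (by omega)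
      have l5 : x' * B = x * B + B := by rw [← hx', Nat.add_one_mul]
      refine ⟨by omega, ?_⟩
      exact (h1.union k1 (by omega) (by omega) (by omega)).union k2 (by omega) (by omega) (by omega)
    · simp [u28, u29] at hc
      have h : y = x + 1 := by omega
      refine Runs.of_vc (by decide) ?_
      simp only [Prog.vc]
      rw [h, Nat.succ_mul]
      convert h1 using 1
      omega
  rintro τ₂ h2 hf₃
  have hτ₃ := hτ₂.frame hf₃ (by decide) (by decide) (by decide)
  have v29 : τ₂.reg 29 = y := (hf₃.reg 29 (by decide)).trans u29
  have v27 : τ₂.reg 27 = r := (hf₃.reg 27 (by decide)).trans u27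
  obtain ⟨s1, s2⟩ := hblock (el := .reg 29 * .reg 22) (er := .reg 27) (l := y * B)
    (r := r) hτ₃.masks (by simp [v29, hτ₃.masks.bits.reg]; omega) (by simp)
    (by simp [v29, hτ₃.masks.bits.reg]) v27 (by omega) hr (by rw [Nat.mul_div_cancel _ b1])
  refine Runs.of_vc (by decide) ⟨s1, by simp, ?_⟩
  simp only [Expr.eval_sub, Expr.eval_reg, State.setReg_reg, Nat.reduceEqDiff, if_true, if_false]
  rw [tsub_tsub_eq_min]
  exact h2.union s2 (by omega) (by omega) (by omega)

end WordRAM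


/-! ### Borders and shifts -/

namespace LeeBorder

/-- The Lee distance of two letters that are given as natural numbers. -/
def lee (d a b : ℕ) : ℕ := min (a - b + (b - a)) (d - (a - b + (b - a)))

lemma lee_self (d a : ℕ) : lee d a a = 0 := by simp [lee]

lemma lee_comm (d a b : ℕ) : lee d a b = lee d b a := by simp [lee, add_comm]

lemma lee_le (d a b : ℕ) : lee d a b ≤ d := by simp only [lee]; omega

lemma lee_pos {d a b : ℕ} (ha : a < d) (hb : b < d) (h : a ≠ b) : 0 < lee d a b := by
  simp only [lee]; omega

lemma letterDist_eq {d : ℕ} (a b : Fin d) : letterDist a b = lee d a b := by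
  have : ((a : ℤ) - (b : ℤ)).natAbs = (a : ℕ) - b + (b - a) := by omega
  rw [letterDist, lee, this]

/-- The letter at the position `i`, as a natural number. -/
def letter {d : ℕ} (w : List (Fin d)) (i : ℕ) : ℕ := ((w[i]?).map Fin.val).getD 0

lemma letter_lt {d : ℕ} {w : List (Fin d)} {i : ℕ} (h : i < w.length) : letter w i < d := by
  simp [letter, h]

lemma letter_drop {d : ℕ} (w : List (Fin d)) (j i : ℕ) : letter (w.drop j) i = letter w (j + i) := by
  simp [letter]

lemma letter_take {d : ℕ} (w : List (Fin d)) {j i : ℕ} (h : i < j) :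
    letter (w.take j) i = letter w i := by
  simp [letter, h]

lemma wordDist_eq_sum {d : ℕ} : ∀ {m : ℕ} {u v : List (Fin d)}, u.length = m → v.length = m →
    wordDist u v = ∑ i ∈ Finset.range m, lee d (letter u i) (letter v i)
  | 0, [], [], _, _ => rfl
  | m + 1, a :: u, b :: v, hu, hv => by
    have ih := wordDist_eq_sum (m := m) (u := u) (v := v) (by simpa using hu) (by simpa using hv)
    rw [Finset.sum_range_succ', add_comm]
    refine congrArg₂ _ (letterDist_eq a b) ih

/-- The Lee distance of the letters before the position `p` to the letters `i` positions later. -/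
def shiftDist (d : ℕ) (x : ℕ → ℕ) (i p : ℕ) : ℕ := ∑ q ∈ Finset.range p, lee d (x q) (x (q + i))

lemma wordDist_drop_take {d : ℕ} (w : List (Fin d)) (i : ℕ) :
    wordDist (w.drop i) (w.take (w.length - i)) = shiftDist d (letter w) i (w.length - i) := by
  rw [wordDist_eq_sum (m := w.length - i) (by simp) (by simp), shiftDist]
  refine Finset.sum_congr rfl fun q hq => ?_
  rw [letter_drop, letter_take _ (Finset.mem_range.1 hq), lee_comm, add_comm]

lemma shiftDist_mono (d : ℕ) (x : ℕ → ℕ) (i : ℕ) {p q : ℕ} (h : p ≤ q) :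
    shiftDist d x i p ≤ shiftDist d x i q :=
  Finset.sum_le_sum_of_subset (by simpa using h)

lemma shiftDist_succ (d : ℕ) (x : ℕ → ℕ) (i p : ℕ) :
    shiftDist d x i (p + 1) = shiftDist d x i p + lee d (x p) (x (p + i)) :=
  Finset.sum_range_succ _ _

lemma shiftDist_add {d : ℕ} {x : ℕ → ℕ} {i p : ℕ} : ∀ {h : ℕ},
    (∀ g < h, x (p + g) = x (p + i + g)) → shiftDist d x i (p + h) = shiftDist d x i p
  | 0, _ => rfl
  | h + 1, hx => by
    rw [← add_assoc, shiftDist_succ, shiftDist_add fun g hg => hx g (by omega), hx h (by omega),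
      add_right_comm p i h, lee_self, add_zero]

/-- The shift is the length of the word minus the length of the border. -/
lemma hasProperBorder_iff {d k : ℕ} {w : List (Fin d)} : HasProperBorder k w ↔
    ∃ i, 1 ≤ i ∧ i < w.length ∧ shiftDist d (letter w) i (w.length - i) = k := by
  constructor
  · rintro ⟨s, p, hs, hp, hsp, h0, hn, hk⟩
    rw [List.suffix_iff_eq_drop] at hs
    rw [List.prefix_iff_eq_take] at hp
    refine ⟨w.length - s.length, by omega, by omega, ?_⟩
    rw [← wordDist_drop_take, ← hs, Nat.sub_sub_self hn.le, hsp, ← hp, hk]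
  · rintro ⟨i, h1, h2, h3⟩
    exact ⟨w.drop i, w.take (w.length - i), List.drop_suffix _ _, List.take_prefix _ _, by simp,
      by simpa using h2, by simp; omega, by rw [wordDist_drop_take, h3]⟩

lemma wordDist_self {d : ℕ} (w : List (Fin d)) : wordDist w w = 0 := by
  rw [wordDist_eq_sum rfl rfl]
  exact Finset.sum_eq_zero fun _ _ => lee_self _ _

/-- The borders that are not proper, the empty one and the whole word, have distance `0`. -/
lemma hasBorder_iff {d k : ℕ} {w : List (Fin d)} :
    HasBorder k w ↔ k = 0 ∨ HasProperBorder k w := by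
  constructor
  · rintro ⟨s, p, hs, hp, hsp, hk⟩
    rcases Nat.eq_zero_or_pos s.length with h | h
    · left
      rw [List.length_eq_zero_iff] at h
      rw [← hk, h]; rfl
    · rcases hs.length_le.lt_or_eq with h' | h'
      · exact Or.inr ⟨s, p, hs, hp, hsp, h, h', hk⟩
      · left
        rw [hs.eq_of_length h', hp.eq_of_length (hsp.symm.trans h'), wordDist_self] at hk
        exact hk.symm
  · rintro (rfl | ⟨s, p, hs, hp, hsp, -, -, hk⟩)
    · exact ⟨[], [], List.nil_suffix, List.nil_prefix, rfl, rfl⟩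
    · exact ⟨s, p, hs, hp, hsp, hk⟩

end LeeBorder

namespace WordRAM
open Suffix LeeBorder

variable {W S : ℕ}

/-! ### Queries for longest common extensions -/

/-- Stores in register `25` the length of the longest common extension of the positions in the
registers `32` and `33`. -/
def lceQuery : Prog :=
  26 ≔ .load 8 (.reg 32) ;; 27 ≔ .load 8 (.reg 33) ;;
  .cond (.lt (.reg 26) (.reg 27)) (26 ≔ .reg 26 + 1)
    (28 ≔ .reg 26 ;; 26 ≔ .reg 27 + 1 ;; 27 ≔ .reg 28) ;; rangeMin

/-- The tables for longest common extensions in `s`, for positions below `n`. -/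
structure LceTables (s : ℕ → ℕ) (n : ℕ) (σ : State) : Prop where
  len : σ.reg 0 = n
  tables : ∃ A V B, IsBlockSize n B ∧ SortedBy (sfx s) n A ∧ MinTables V B (n / B + 1) σ ∧
    (∀ i < n, σ.mem 8 i < n ∧ A (σ.mem 8 i) = i) ∧ ∀ r < n, V r = lcp s A r

lemma LceTables.frame {s : ℕ → ℕ} {n : ℕ} {σ τ : State} {p : Prog} (h : LceTables s n σ)
    (hf : Frame p σ τ) (hr : ∀ x ∈ [0, 22, 23, 24], x ∉ p.wregs) (hm : p.wmems = []) :
    LceTables s n τ := by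
  obtain ⟨A, V, B, h1, h2, h3, h4, h5⟩ := h.tables
  exact ⟨(hf.reg 0 (hr 0 (by simp))).trans h.len, A, V, B, h1, h2,
    h3.frame hf (fun x hx => hr x (List.mem_cons_of_mem _ hx)) (by simp [hm]) (by simp [hm]),
    by rwa [hf.mem 8 (by simp [hm])], h5⟩

/-- The smaller rank is raised by one because each `lcp` value refers to its left neighbour. The
blocks extend past `n`, where `V` is arbitrary, but the queried ranks stay below `n`. -/
lemma lceQuery_runs {s : ℕ → ℕ} {n p q : ℕ} {σ : State} (hσ : LceTables s n σ)
    (hS : 5 * n + 10 ≤ S) (hW : 2 * S < W) (h32 : σ.reg 32 = p) (h33 : σ.reg 33 = q) (hp : p < n)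
    (hq : q < n) (hpq : p ≠ q) :
    Runs W S lceQuery σ 200 fun τ => τ.reg 25 = lce s p q := by
  obtain ⟨A, V, B, hB, hA, hM, hR, hV⟩ := hσ.tables
  have hsize := hB.lt_size
  obtain ⟨p1, p2⟩ := hR p hp
  obtain ⟨q1, q2⟩ := hR q hq
  have hmin : ∀ {x y v}, x < y → y < n → IsRangeMin V (x + 1) y v → v = lce s (A x) (A y) := by
    intro x y v hxy hy hv
    refine IsRangeMin.eq ?_ (isRangeMin_lce hA hxy hy)
    obtain ⟨i, i1, i2, i3⟩ := hv.mem
    exact ⟨fun i hi hi' => by rw [← hV i (by omega)]; exact hv.le i hi hi',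
      i, i1, i2, by rw [← hV i (by omega)]; exact i3⟩
  set x := σ.mem 8 p
  set y := σ.mem 8 q
  have hxy : x ≠ y := fun h => hpq (by rw [← p2, h, q2])
  refine Runs.seq 3 190 (Q₁ := fun υ => υ = σ.setReg 26 x)
    (Runs.of_vc (by decide) (by simp [Prog.vc, h32, x]; omega)) ?_ (by omega)
  rintro _ rfl hf₁
  refine Runs.seq 3 180 (Q₁ := fun υ => υ = (σ.setReg 26 x).setReg 27 y)
    (Runs.of_vc (by decide) (by simp [Prog.vc, h33, y]; omega)) ?_ (by omega)
  rintro _ rfl hf₂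
  refine Runs.seq 20 150 (Q₁ := fun υ => υ.reg 26 = min x y + 1 ∧ υ.reg 27 = max x y) ?_ ?_
    (by omega)
  · refine Runs.of_vc (by decide) ?_
    simp [Prog.vc]
    omega
  rintro τ ⟨t26, t27⟩ hf₃
  have hτ := ((hM.frame hf₁ (by decide) (by decide) (by decide)).frame hf₂
    (by decide) (by decide) (by decide)).frame hf₃ (by decide) (by decide) (by decide)
  refine (rangeMin_runs hB hτ hS hW t26 t27 (by omega) (by omega)).mono le_rfl fun υ h _ _ => ?_
  rw [hmin (by omega) (by omega) h]
  rcases hxy.lt_or_gt with h | h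
  · rw [min_eq_left h.le, max_eq_right h.le, p2, q2]
  · rw [min_eq_right h.le, max_eq_left h.le, p2, q2, lce_comm]

/-! ### The search for a shift -/

/-- Sets register `37` to `1` if the distance at the shift in register `34` is equal to register
`1`. -/
def checkShift (d : ℕ) : Prog :=
  35 ≔ 0 ;; 36 ≔ 0 ;;
  .loop (.lt (.reg 35 + .reg 34) (.reg 0) * .lt (.reg 36) (.reg 1 + 1))
    (32 ≔ .reg 35 ;; 33 ≔ .reg 35 + .reg 34 ;; lceQuery ;; 35 ≔ .reg 35 + .reg 25 ;;
      .cond (.lt (.reg 35 + .reg 34) (.reg 0))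
        (32 ≔ .load 0 (.reg 35) ;; 33 ≔ .load 0 (.reg 35 + .reg 34) ;;
          32 ≔ (.reg 32 - .reg 33) + (.reg 33 - .reg 32) ;; 33 ≔ .const d - .reg 32 ;;
          36 ≔ .reg 36 + (.reg 32 - (.reg 32 - .reg 33)) ;; 35 ≔ .reg 35 + 1) .nop) ;;
  .cond (.eq (.reg 36) (.reg 1)) (37 ≔ 1) .nop

/-- A round jumps over equal letters and then adds the distance of one mismatching pair, which is
positive. The scan stops at the end of the overlap or once the sum exceeds `k`; the last summand can
carry the sum to at most `k + d`. -/
lemma checkShift_runs {d n k i : ℕ} {x : ℕ → ℕ} {σ : State} (hσ : LceTables (textOf n x) n σ)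
    (hm0 : ∀ q < n, σ.mem 0 q = x q) (hx : ∀ q < n, x q < d) (h1 : σ.reg 1 = k)
    (h34 : σ.reg 34 = i) (hi : 1 ≤ i) (hin : i < n) (hS : 5 * n + 10 ≤ S) (hW : 2 * S < W)
    (hW' : 2 * (k + d) + 2 < W) :
    Runs W S (checkShift d) σ (1000 * (k + 1)) fun τ =>
      τ.reg 37 = if shiftDist d x i (n - i) = k then 1 else σ.reg 37 := by
  have h0 := hσ.len
  refine Runs.seq 2 (990 * (k + 1)) (Q₁ := fun υ => υ = σ.setReg 35 0)
    (Runs.of_vc (by decide) (by simp [Prog.vc]; omega)) ?_ (by omega)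
  rintro _ rfl hf₁
  refine Runs.seq 2 (980 * (k + 1)) (Q₁ := fun υ => υ = (σ.setReg 35 0).setReg 36 0)
    (Runs.of_vc (by decide) (by simp [Prog.vc]; omega)) ?_ (by omega)
  rintro _ rfl hf₂
  have hσ₁ := (hσ.frame hf₁ (by decide) rfl).frame hf₂ (by decide) rfl
  have hσm : ((σ.setReg 35 0).setReg 36 0).mem = σ.mem := rfl
  have hσr : ∀ z, z ≠ 35 → z ≠ 36 → ((σ.setReg 35 0).setReg 36 0).reg z = σ.reg z := by
    intro z h h'; simp [h, h']
  have hz35 : ((σ.setReg 35 0).setReg 36 0).reg 35 = 0 := by simp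
  have hz36 : ((σ.setReg 35 0).setReg 36 0).reg 36 = 0 := by simp
  generalize (σ.setReg 35 0).setReg 36 0 = σ₁ at hσ₁ hσm hσr hz35 hz36
  refine Runs.seq (900 * (k + 1)) 20 (Q₁ := fun τ => τ.reg 36 = shiftDist d x i (τ.reg 35) ∧
    τ.reg 35 ≤ n - i ∧ (τ.reg 35 + i < n → k < τ.reg 36)) ?_ ?_ (by omega)
  · refine Runs.loop_measure
      (fun τ => τ.reg 36 = shiftDist d x i (τ.reg 35) ∧ τ.reg 35 ≤ n - i ∧ τ.reg 36 ≤ k + d)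
      (fun τ => (k + 1 - τ.reg 36) + (if τ.reg 35 + i < n then 1 else 0)) 280
      ⟨by simp [hz35, hz36, shiftDist], by simp [hz35], by simp [hz36]⟩ ?_ ?_ ?_ ?_
    · rintro τ ⟨i1, i2, i3⟩ hf
      have e34 : τ.reg 34 = i := by rw [hf.reg 34 (of_decide_eq_true rfl), hσr 34] <;> simp [h34]
      have e1 : τ.reg 1 = k := by rw [hf.reg 1 (of_decide_eq_true rfl), hσr 1] <;> simp [h1]
      simp [e34, e1]
      refine ⟨by omega, by omega, ?_⟩
      split_ifs <;> omega
    · rintro τ ⟨i1, i2, i3⟩ hf hc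
      have hτ := hσ₁.frame hf (of_decide_eq_true rfl) rfl
      have e34 : τ.reg 34 = i := by rw [hf.reg 34 (of_decide_eq_true rfl), hσr 34] <;> simp [h34]
      have e1 : τ.reg 1 = k := by rw [hf.reg 1 (of_decide_eq_true rfl), hσr 1] <;> simp [h1]
      have em : τ.mem 0 = σ.mem 0 := by rw [hf.mem 0 (of_decide_eq_true rfl), hσm]
      simp [e34, e1, hτ.len] at hc
      obtain ⟨hDk, hpn⟩ := hc
      generalize hp : τ.reg 35 = p at *
      generalize hD : τ.reg 36 = D at *
      have ht := isText_textOf n x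
      obtain ⟨l1, l2⟩ := ht.lce_add_le (i := p) (j := p + i) (by omega) hpn (by omega)
      have hne := ht.ne_at_lce (i := p) (j := p + i) (by omega) (by omega)
      have heq : ∀ g < lce (textOf n x) p (p + i), x (p + g) = x (p + i + g) := by
        intro g hg
        have := eq_of_lt_lce hg
        rw [textOf, textOf, if_pos (by omega), if_pos (by omega)] at this
        omega
      have hsd := shiftDist_add (d := d) heq
      refine Runs.seq 2 278 (Q₁ := fun υ => υ = τ.setReg 32 p)
        (Runs.of_vc (by decide) (by simp [Prog.vc, hp])) ?_ (by omega)
      rintro _ rfl hf₃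
      refine Runs.seq 4 274 (Q₁ := fun υ => υ = (τ.setReg 32 p).setReg 33 (p + i))
        (Runs.of_vc (by decide) (by simp [Prog.vc, hp, e34]; omega)) ?_ (by omega)
      rintro _ rfl hf₄
      have hτ' := (hτ.frame hf₃ (by decide) rfl).frame hf₄ (by decide) rfl
      refine Runs.seq 200 74 (lceQuery_runs (p := p) (q := p + i) hτ' hS hW (by simp) (by simp)
        (by omega) hpn (by omega)) ?_ (by omega)
      intro υ u25 hf₅
      have u35 : υ.reg 35 = p := by simp [hf₅.reg 35 (by decide), hp]
      have u36 : υ.reg 36 = D := by simp [hf₅.reg 36 (by decide), hD]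
      have u34 : υ.reg 34 = i := by simp [hf₅.reg 34 (by decide), e34]
      have u0 : υ.reg 0 = n := by simp [hf₅.reg 0 (by decide), hτ.len]
      have um : υ.mem 0 = σ.mem 0 := by simp [hf₅.mem 0 (by decide), em]
      generalize lce (textOf n x) p (p + i) = h at *
      refine Runs.seq 4 70 (Q₁ := fun υ' => υ' = υ.setReg 35 (p + h))
        (Runs.of_vc (by decide) (by simp [Prog.vc, u35, u25]; omega)) ?_ (by omega)
      rintro _ rfl -
      refine Runs.cond 60 (by simp [u34]; omega) (fun hc => ?_) (fun hc => ?_) (by simp)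
      · simp [u34, u0] at hc
        have hx1 := hx (p + h) (by omega)
        have hx2 := hx (p + h + i) hc
        have hxne : x (p + h) ≠ x (p + h + i) := by
          rw [textOf, textOf, if_pos (by omega), if_pos (by omega)] at hne
          rw [add_right_comm p h i]
          omega
        have hpos := lee_pos hx1 hx2 hxne
        have hle := lee_le d (x (p + h)) (x (p + h + i))
        have hnew : shiftDist d x i (p + h + 1) = D + lee d (x (p + h)) (x (p + h + i)) := by
          rw [shiftDist_succ, hsd, i1]
        refine Runs.of_vc (by simp [Prog.flatCost]) ?_
        simp only [Prog.vc]
        simp [u34, u36, um, hm0 _ hc, hm0 (p + h) (by omega), tsub_tsub_eq_min]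
        rw [hnew, if_pos hpn]
        unfold lee at hpos hle ⊢
        split_ifs <;> omega
      · simp [u34, u0] at hc
        refine Runs.of_vc (le_trans (by decide : _ ≤ 10) (by omega)) ?_
        simp [Prog.vc, u36, hsd, hc, hpn, i1]
        omega
    · simp [hz35, hz36, hin]
      omega
    · rintro τ ⟨i1, i2, i3⟩ hf hc
      have hτ := hσ₁.frame hf (of_decide_eq_true rfl) rfl
      have e34 : τ.reg 34 = i := by rw [hf.reg 34 (of_decide_eq_true rfl), hσr 34] <;> simp [h34]
      have e1 : τ.reg 1 = k := by rw [hf.reg 1 (of_decide_eq_true rfl), hσr 1] <;> simp [h1]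
      simp [e34, e1, hτ.len] at hc
      exact ⟨i1, i2, by omega⟩
  rintro τ ⟨t1, t2, t3⟩ hf
  have e1 : τ.reg 1 = k := by rw [hf.reg 1 (of_decide_eq_true rfl), hσr 1] <;> simp [h1]
  have e37 : τ.reg 37 = σ.reg 37 := by rw [hf.reg 37 (of_decide_eq_true rfl), hσr 37] <;> simp
  -- After an early stop the sum already exceeds `k`, and by monotonicity so does the full distance;
  -- the test against `k` then rightly fails.
  have hmono := shiftDist_mono d x i t2
  have hfull : ¬ τ.reg 35 + i < n → τ.reg 36 = shiftDist d x i (n - i) := fun h => by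
    rw [t1, show τ.reg 35 = n - i by omega]
  refine Runs.of_vc (by decide) ?_
  simp [Prog.vc, e1, e37]
  refine ⟨fun h => ⟨by omega, fun h' => absurd ?_ h'⟩, fun h => ?_⟩
  · rw [← hfull (fun h'' => by have := t3 h''; omega), h]
  · intro h'
    exfalso
    by_cases h'' : τ.reg 35 + i < n
    · have := t3 h''; omega
    · exact h ((hfull h'').trans h')

end WordRAM


/-! ### Assembly of the tables, the search over all shifts, and the choice of constants -/

namespace WordRAM
open Suffix LeeBorder

variable {W S : ℕ}

/-- Computes the tables of `LceTables` for the input over an alphabet of size `d`. -/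
def buildLceTables (d : ℕ) : Prog :=
  buildSuffixArray d ;; buildLcp ;; buildBitTables ;; buildMasks ;; buildSparse

lemma buildLceTables_runs {d n : ℕ} {x : ℕ → ℕ} {σ : State} (h0 : σ.reg 0 = n)
    (hm0 : ∀ i < n, σ.mem 0 i = x i) (hx : ∀ i < n, x i < d) (hm1 : ∀ i, σ.mem 1 i = 0)
    (hS : 20 * (n + d + 1) ≤ S) (hW : 2 * S < W) :
    Runs W S (buildLceTables d) σ (43000 * ((d + 1) * (n + 1))) (LceTables (textOf n x) n) := by
  have hdn : (d + 1) * (n + 1) = d * (n + 1) + (n + 1) := by ring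
  have hB := isBlockSize_clog n
  refine Runs.seq (41000 * ((d + 1) * (n + 1))) (1500 * (n + 1))
    (buildSuffixArray_runs h0 hm0 hx hm1 hS hW) ?_ (by omega)
  rintro τ₁ ⟨hA, ht⟩ hf₁
  have e1 : τ₁.reg 0 = n := (hf₁.reg 0 (of_decide_eq_true rfl)).trans h0
  refine Runs.seq (200 * (n + 1)) (1200 * (n + 1)) (buildLcp_runs e1 (isText_textOf n x) hA rfl ht
    (by omega) (by omega)) ?_ (by omega)
  rintro τ₂ ⟨hR, hV⟩ hf₂
  have e2 : τ₂.reg 0 = n := (hf₂.reg 0 (by decide)).trans e1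
  refine Runs.seq (200 * (n + 1)) (1000 * (n + 1)) (buildBitTables_runs e2 rfl (by omega)
    (by omega)) ?_ (by omega)
  rintro τ₃ hT hf₃
  have e3 : τ₃.reg 0 = n := (hf₃.reg 0 (by decide)).trans e2
  refine Runs.seq (500 * (n + 1)) (200 * (n + 1)) (buildMasks_runs e3 hB hT (by omega) hW) ?_
    (by omega)
  rintro τ₄ hM hf₄
  refine (buildSparse_runs hB hM (by omega) hW).mono le_rfl fun τ₅ hτ hf₅ _ => ?_
  refine ⟨(hf₅.reg 0 (by decide)).trans ((hf₄.reg 0 (by decide)).trans e3),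
    τ₁.mem 5, τ₃.mem 10, _, hB, hA, hτ, ?_, ?_⟩
  · rwa [hf₅.mem 8 (by decide), hf₄.mem 8 (by decide), hf₃.mem 8 (by decide)]
  · rwa [hf₃.mem 10 (by decide)]

/-- Sets register `37` to `1` if the distance at some shift is equal to register `1`, otherwise
to `0`. -/
def searchShift (d : ℕ) : Prog :=
  37 ≔ 0 ;; .forTo 34 (.reg 0) (.cond (.reg 34) (checkShift d) .nop)

lemma searchShift_runs {d n k : ℕ} {x : ℕ → ℕ} {σ : State} (hσ : LceTables (textOf n x) n σ)
    (hm0 : ∀ q < n, σ.mem 0 q = x q) (hx : ∀ q < n, x q < d) (h1 : σ.reg 1 = k)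
    (hS : 5 * n + 10 ≤ S) (hW : 2 * S < W) (hW' : 2 * (k + d) + 2 < W) :
    Runs W S (searchShift d) σ (1100 * ((k + 1) * (n + 1))) fun τ =>
      τ.reg 37 ≤ 1 ∧
        (τ.reg 37 = 1 ↔ ∃ i, 1 ≤ i ∧ i < n ∧ shiftDist d x i (n - i) = k) := by
  have hkn : (k + 1) * (n + 1) = n * (k + 1) + (k + 1) := by ring
  have hkn' : n * 1 ≤ n * (k + 1) := Nat.mul_le_mul_left n (by omega)
  refine Runs.seq 2 (1090 * ((k + 1) * (n + 1))) (Q₁ := fun υ => υ = σ.setReg 37 0)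
    (Runs.of_vc (by decide) (by simp [Prog.vc]; omega)) ?_ (by omega)
  rintro _ rfl hf₁
  have hσ₁ := hσ.frame hf₁ (by decide) rfl
  have e1 : (σ.setReg 37 0).reg 1 = k := by simp [h1]
  have hm : (σ.setReg 37 0).mem = σ.mem := rfl
  have e37 : (σ.setReg 37 0).reg 37 = 0 := by simp
  generalize σ.setReg 37 0 = σ₁ at hσ₁ e1 hm e37
  refine Runs.forTo n (fun i τ => τ.reg 37 ≤ 1 ∧
      (τ.reg 37 = 1 ↔ ∃ j, 1 ≤ j ∧ j < i ∧ shiftDist d x j (n - j) = k)) (1000 * (k + 1) + 10)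
      (of_decide_eq_true rfl) (by omega) (by simp [e37]) ?_ ?_ ?_ (fun τ h _ _ => h)
  · intro τ hf
    simp [(hσ₁.frame hf (of_decide_eq_true rfl) rfl).len]
  · rintro i hi τ ⟨hI1, hI2⟩ hxi hf
    have hτ := hσ₁.frame hf (of_decide_eq_true rfl) rfl
    refine Runs.cond (1000 * (k + 1)) (by simp) (fun hc => ?_) (fun hc => ?_) (by simp)
    · simp [hxi] at hc
      refine (checkShift_runs hτ (by
          rw [hf.mem 0 (by rw [show Prog.wmems _ = [] from rfl]; simp), hm]; exact hm0) hx
        ((hf.reg 1 (of_decide_eq_true rfl)).trans e1) hxi (by omega) hi hS hW hW').mono le_rfl ?_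
      intro υ hυ _ _
      simp only [State.setReg_reg, Nat.reduceEqDiff, if_false, hυ]
      split_ifs with h
      · exact ⟨le_rfl, fun _ => ⟨i, by omega, by omega, h⟩, fun _ => rfl⟩
      · refine ⟨hI1, hI2.trans ⟨?_, ?_⟩⟩
        · rintro ⟨j, j1, j2, j3⟩; exact ⟨j, j1, by omega, j3⟩
        · rintro ⟨j, j1, j2, j3⟩
          refine ⟨j, j1, lt_of_le_of_ne (by omega) ?_, j3⟩
          rintro rfl; exact h j3
    · simp [hxi] at hc
      subst hc
      refine Runs.of_vc (le_trans (by decide : _ ≤ 1) (by omega)) ?_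
      simp only [Prog.vc, State.setReg_reg, Nat.reduceEqDiff, if_false]
      refine ⟨hI1, hI2.trans ⟨?_, ?_⟩⟩
      · rintro ⟨j, j1, j2, j3⟩; omega
      · rintro ⟨j, j1, j2, j3⟩; omega
  · simp
    have : n * (1000 * (k + 1) + 10 + 1 + 7) = 1000 * (n * (k + 1)) + 18 * n := by ring
    omega

lemma two_mul_lt_two_pow {C : ℕ} (h : 5 ≤ C) : 2 * C < 2 ^ (C - 1) := by
  induction C, h using Nat.le_induction with
  | base => decide
  | succ C hC ih =>
    obtain ⟨c, rfl⟩ : ∃ c, C = c + 1 := ⟨C - 1, by omega⟩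
    simp only [Nat.add_sub_cancel] at ih ⊢
    rw [pow_succ]; omega

/-- One factor `N` of `N ^ C` is kept for `N` itself; the other `C - 1` factors are at least `2` and
outweigh `2 * C`. Hence the word size exceeds twice the memory size and the numbers of order `k +
d`. -/
lemma mul_lt_two_pow_clog {C N : ℕ} (hC : 5 ≤ C) (hN : 2 ≤ N) :
    2 * C * N < 2 ^ (C * Nat.clog 2 N) := by
  obtain ⟨c, rfl⟩ : ∃ c, C = c + 1 := ⟨C - 1, by omega⟩
  calc 2 * (c + 1) * N < 2 ^ c * N :=
        Nat.mul_lt_mul_of_pos_right (two_mul_lt_two_pow hC) (by omega)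
    _ ≤ N ^ c * N := Nat.mul_le_mul_right N (Nat.pow_le_pow_left hN c)
    _ = N ^ (c + 1) := (pow_succ _ _).symm
    _ ≤ (2 ^ Nat.clog 2 N) ^ (c + 1) := Nat.pow_le_pow_left (Nat.le_pow_clog (by omega) N) _
    _ = 2 ^ ((c + 1) * Nat.clog 2 N) := by rw [← pow_mul, mul_comm]

lemma good_input {d k : ℕ} (w : List (Fin d)) (h1 : 1 < W) (hn : w.length < W) (hk : k < W)
    (hd : d < W) : Good W (input k w) where
  one_lt := h1
  reg x := by
    simp only [input]
    split_ifs <;> omega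
  mem A i := by
    simp only [input]
    split_ifs
    · by_cases hi : i < w.length
      · exact (letter_lt hi).trans hd
      · simp [hi]; omega
    · omega

/-- A program that starts with the search for a shift, and then leaves in register `0` a value that
depends on its outcome, decides a property. -/
lemma decidable_of_searchShift {d : ℕ} {P : ℕ → List (Fin d) → Prop} {q : Prog}
    (hq : ∀ {W S k : ℕ} {w : List (Fin d)} {σ : State}, 1 < W → σ.reg 1 = k → σ.reg 37 ≤ 1 →
      (σ.reg 37 = 1 ↔ HasProperBorder k w) →
      Runs W S q σ 10 fun τ => (P k w → τ.reg 0 = 1) ∧ (¬ P k w → τ.reg 0 = 0)) :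
    DecidableInTimeSpace P (fun n k => (k + 1) * (n + 1)) (fun n _ => n + 1) := by
  -- The constant must cover the time `43000 * ((d + 1) * (n + 1))` of the tables together with
  -- `1200 * ((k + 1) * (n + 1))` for the rest, and the space `20 * (n + d + 1)`.
  refine ⟨buildLceTables d ;; searchShift d ;; q, 50000 * (d + 1), fun k w => ?_⟩
  set n := w.length with hn
  set C := 50000 * (d + 1) with hC
  have hW := mul_lt_two_pow_clog (C := C) (N := n + k + 2) (by omega) (by omega)
  set W := 2 ^ (C * Nat.clog 2 (n + k + 2))
  have hN1 : 2 * C * (n + k + 2) = 2 * (C * (n + 1)) + 2 * C * (k + 1) := by ring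
  have hN2 : 2 * C * (k + 1) = 100000 * (d * k) + 100000 * d + 100000 * k + 100000 := by
    rw [hC]; ring
  have hS : C * (n + 1) = 50000 * (d * n) + 50000 * d + 50000 * n + 50000 := by rw [hC]; ring
  set S := C * (n + 1)
  have hg : Good W (input k w) := good_input w (by omega) (by omega) (by omega) (by omega)
  have e0 : (input k w).reg 0 = n := rfl
  have e1 : (input k w).reg 1 = k := rfl
  have em : (input k w).mem 0 = letter w := rfl
  have hx : ∀ i < n, letter w i < d := fun i hi => letter_lt hi
  clear_value W S
  have hT : C * ((k + 1) * (n + 1)) = 50000 * ((d + 1) * (n + 1)) + 50000 * ((d + 1) * (n + 1) * k) := by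
    rw [hC]; ring
  have hT' : (d + 1) * (n + 1) * k = d * ((n + 1) * k) + (n + 1) * k := by ring
  have hT'' : (k + 1) * (n + 1) = (n + 1) * k + (n + 1) := by ring
  have hT3 : (d + 1) * (n + 1) = d * (n + 1) + (n + 1) := by ring
  have hrun : Runs W S (buildLceTables d ;; searchShift d ;; q) (input k w)
      (C * ((k + 1) * (n + 1))) fun τ => (P k w → τ.reg 0 = 1) ∧ (¬ P k w → τ.reg 0 = 0) := by
    refine Runs.seq (43000 * ((d + 1) * (n + 1))) (1200 * ((k + 1) * (n + 1)))
      (buildLceTables_runs e0 (fun i _ => congrFun em i) hx (fun i => rfl) (by omega) (by omega))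
      ?_ (by omega)
    intro τ₁ hτ₁ hf₁
    have e1' : τ₁.reg 1 = k := (hf₁.reg 1 (of_decide_eq_true rfl)).trans e1
    refine Runs.seq (1100 * ((k + 1) * (n + 1))) 10 (searchShift_runs hτ₁ (fun i _ => by
        rw [hf₁.mem 0 (of_decide_eq_true rfl), em]) hx e1' (by omega) (by omega) (by omega)) ?_
      (by omega)
    rintro τ₂ ⟨h1, h2⟩ hf₂
    exact hq (by omega) ((hf₂.reg 1 (of_decide_eq_true rfl)).trans e1') h1
      (h2.trans hasProperBorder_iff.symm)
  obtain ⟨t, τ, h1, h2, h3⟩ := hrun hg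
  exact ⟨t, τ, h1, h2, h3⟩

end WordRAM

theorem proposition3 (d : ℕ) :
    WordRAM.DecidableInTimeSpace (d := d) (fun k w => LeeBorder.HasBorder k w)
      (fun n k => (k + 1) * (n + 1)) (fun n _ => n + 1) ∧
    WordRAM.DecidableInTimeSpace (d := d) (fun k w => LeeBorder.HasProperBorder k w)
      (fun n k => (k + 1) * (n + 1)) (fun n _ => n + 1) := by
  open WordRAM in
  constructor
  -- For `k = 0` the empty border always gives the answer `1`; otherwise only proper borders count.
  · refine decidable_of_searchShift (q := .cond (.reg 1) (0 ≔ .reg 37) (0 ≔ 1)) ?_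
    intro W S k w σ hW h1 h37 hP
    refine Runs.of_vc (by decide) ?_
    simp [Prog.vc, h1, LeeBorder.hasBorder_iff, ← hP]
    omega
  · refine decidable_of_searchShift (q := 0 ≔ .reg 37) ?_
    intro W S k w σ hW h1 h37 hP
    refine Runs.of_vc (by decide) ?_
    simp [Prog.vc, ← hP]
    omega
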